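/- Let $H$ be a finite-dimensional Hopf algebra over a field $\Bbbk$, with antipode $S$ (which is bijective), let $\iota:B\rightarrowtail H$ be an injection of left $H$-comodule algebras and $\pi:H\twoheadrightarrow C$ a surjection of right $H$-module coalgebras such that $\iota(B)=\{h\in H:\sum h_{(1)}\otimes\pi(h_{(2)})=h\otimes\pi(1)\}$ (for example, $B$ a left coideal subalgebra of $H$ and $C=H/B^+H$). Let $(\zeta,\gamma^\ast)$ be a partially admissible mapping system for $\iota$: $\zeta:H\to B$ and $\gamma:C\to H$ are linear maps with convolution inverses $\overline\zeta,\overline\gamma$, $\zeta$ preserves left $B$-actions, $\gamma$ preserves right $C$-coactions, both preserve units and counits (the counit of $B$ is $\varepsilon\circ\iota$ and the unit of $C$ is $\pi(1)$), and $(\iota\circ\zeta)\ast(\gamma\circ\pi)=\mathrm{id}_H$. Write $\triangleleft$ for the $H$-action on $C$, $b\mapsto\sum b_{(1)}\otimes b_{(2)}\in H\otimes B$ for the coaction on $B$, and $f\mapsto\sum f_{(1)}\otimes f_{(2)}\in C^\ast\otimes H^\ast$ for the coaction on $C^\ast$ given by $\sum\langle f_{(1)},x\rangle\langle f_{(2)},h\rangle=\langle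 f,x\triangleleft h\rangle$; put $b\leftharpoonup u=\sum\langle u,b_{(1)}\rangle b_{(2)}$ for $u\in H^\ast$, and write $S$ also for the antipode of $H^\ast$. The left partial dual $C^\ast\#B$ of $H$ determined by $(\zeta,\gamma^\ast)$ is the space $C^\ast\otimes B$ with unit $\varepsilon\#1$, product $(f\#b)(g\#c)=\sum fg_{(1)}\#(b\leftharpoonup g_{(2)})c$, counit $\boldsymbol\varepsilon(f\#b)=\langle f,\pi(1)\rangle\,\varepsilon(\iota(b))$, comultiplication $$\boldsymbol\Delta(f\#b)=\sum_{i,j}\Big(f_{(1)}\#b_i\,\zeta[\gamma(x_j)b_{(1)}]\Big)\otimes\Big(\gamma^\ast[f_{(2)}\zeta^\ast(b_i^\ast)]\,x_j^\ast\#b_{(2)}\Big),$$ and associator $$\boldsymbol\phi=\sum_{i,j}(\varepsilon\#b_i)\otimes(\varepsilon\#b_j)\big(\overline\gamma^\ast[S^{-1}(\overline\zeta^\ast(b_i^\ast)_{(1)})]\#1\big)\otimes\big(\overline\gamma^\ast[S^{-1}(\overline\zeta^\ast(b_j^\ast)\,\overline\zeta^\ast(b_i^\ast)_{(2)})]\#1\big),$$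 where $\{b_i\},\{b_i^\ast\}$ and $\{x_j\},\{x_j^\ast\}$ are dual bases of $B,B^\ast$ and of $C,C^\ast$. It is a quasi-bialgebra. (A quasi-bialgebra has $(\mathrm{id}\otimes\boldsymbol\Delta)\boldsymbol\Delta(v)\cdot\boldsymbol\phi=\boldsymbol\phi\cdot(\boldsymbol\Delta\otimes\mathrm{id})\boldsymbol\Delta(v)$; its opposite has the opposite product, the same comultiplication and counit, and associator $\boldsymbol\phi^{-1}$.) Then: (1) $(\overline\zeta\circ S^{-1},\overline\gamma^\ast)$ is a partially admissible mapping system for $\iota:B^{\mathrm{op}}\to H^{\mathrm{op}}$, with quotient map $\pi\circ S^{-1}:H^{\mathrm{op}}\to C^{\mathrm{cop}}$ and action $x\otimes h\mapsto x\triangleleft S^{-1}(h)$; $(\overline\zeta,\overline\gamma^\ast\circ S^{-1})$ is a partially admissible mapping system for $S^{-1}\circ\iota:B^{\mathrm{op}}\to H^{\mathrm{cop}}$, with quotient map $\pi:H^{\mathrm{cop}}\to C^{\mathrm{cop}}$ and coaction $b\mapsto\sum S^{-1}(b_{(1)})\otimes b_{(2)}$; and the left partial dual of $H^{\mathrm{op}}$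 determined by the former is the same quasi-bialgebra (same product, unit, comultiplication, counit and associator on the same space) as the left partial dual of $H^{\mathrm{cop}}$ determined by the latter. (2) Denote the quasi-bialgebra in (1) by $C^{\ast\,\mathrm{op}}\#B^{\mathrm{op}}$. There is an isomorphism of quasi-bialgebras $$\varphi:(C^\ast\#B)^{\mathrm{op}}\to C^{\ast\,\mathrm{op}}\#B^{\mathrm{op}},\qquad f\#b\mapsto(\varepsilon\#b)(f\#1)=\sum f_{(1)}\#\big(b\leftharpoonup S^{-1}(f_{(2)})\big),$$ the product being that of $C^{\ast\,\mathrm{op}}\#B^{\mathrm{op}}$, and its inverse is $\varphi^{-1}(f\#b)=\sum f_{(1)}\#(b\leftharpoonup f_{(2)})$. -/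

import Mathlib

open TensorProduct Module WithConv

noncomputable section

/-! ## Bijectivity of the antipode of a finite-dimensional Hopf algebra -/

section Antipode

variable {k H : Type*} [Field k] [Ring H] [HopfAlgebra k H]

/-- An algebra map out of a Hopf algebra is determined by its composite with the antipode. -/
theorem algHom_ext_comp_antipode {A : Type*} [Ring A] [Algebra k A] (u v : H →ₐ[k] A)
    (h : u.toLinearMap ∘ₗ HopfAlgebra.antipode k = v.toLinearMap ∘ₗ HopfAlgebra.antipode k) :
    u = v := by
  have key : ∀ w : H →ₐ[k] A,
      toConv w.toLinearMap * toConv (w.toLinearMap ∘ₗ HopfAlgebra.antipode k) = 1 ∧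
      toConv (w.toLinearMap ∘ₗ HopfAlgebra.antipode k) * toConv w.toLinearMap = 1 := by
    intro w
    constructor
    · ext c
      rw [(Coalgebra.Repr.arbitrary k c).convMul_apply]
      simp [← map_mul, ← map_sum,
        HopfAlgebra.sum_mul_antipode_eq_algebraMap_counit (Coalgebra.Repr.arbitrary k c)]
    · ext c
      rw [(Coalgebra.Repr.arbitrary k c).convMul_apply]
      simp [← map_mul, ← map_sum,
        HopfAlgebra.sum_antipode_mul_eq_algebraMap_counit (Coalgebra.Repr.arbitrary k c)]
  have e : toConv u.toLinearMap = toConv v.toLinearMap := by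
    refine left_inv_eq_right_inv (key u).1 ?_
    rw [h]
    exact (key v).2
  exact AlgHom.toLinearMap_injective (toConv_injective e)

/-- The square of the antipode is an algebra endomorphism. -/
def antipodeSq (k H : Type*) [Field k] [Ring H] [HopfAlgebra k H] : H →ₐ[k] H :=
  AlgHom.ofLinearMap (HopfAlgebra.antipode k ∘ₗ HopfAlgebra.antipode k)
    (by simp) (by intro x y; simp [HopfAlgebra.antipode_mul_antidistrib])

theorem algHom_ext_comp_antipodeSq {A : Type*} [Ring A] [Algebra k A] (u v : H →ₐ[k] A)
    (h : u.comp (antipodeSq k H) = v.comp (antipodeSq k H)) : u = v := by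
  let opS : (H →ₐ[k] A) → (H →ₐ[k] Aᵐᵒᵖ) := fun w =>
    AlgHom.ofLinearMap ((MulOpposite.opLinearEquiv k).toLinearMap ∘ₗ
        w.toLinearMap ∘ₗ HopfAlgebra.antipode k)
      (by simp)
      (by intro x y; simp [HopfAlgebra.antipode_mul_antidistrib])
  have h1 : opS u = opS v := by
    apply algHom_ext_comp_antipode
    ext x
    exact congrArg (fun w : H →ₐ[k] A => MulOpposite.op (w x)) h
  apply algHom_ext_comp_antipode
  ext x
  exact congrArg (fun w : H →ₐ[k] Aᵐᵒᵖ => (w x).unop) h1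

theorem algHom_ext_comp_antipodeSq_pow {A : Type*} [Ring A] [Algebra k A] (n : ℕ)
    (u v : H →ₐ[k] A)
    (h : ∀ x, u (((antipodeSq k H).toLinearMap ^ n) x) = v (((antipodeSq k H).toLinearMap ^ n) x)) :
    u = v := by
  induction n generalizing u v with
  | zero => ext x; simpa using h x
  | succ n ih =>
    apply algHom_ext_comp_antipodeSq
    apply ih
    intro x
    have := h x
    rw [pow_succ'] at this
    exact this

theorem antipode_bijective (k H : Type*) [Field k] [Ring H] [HopfAlgebra k H]
    [FiniteDimensional k H] : Function.Bijective (HopfAlgebra.antipode k : H →ₗ[k] H) := by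
  set Q : End k H := (antipodeSq k H).toLinearMap with hQ
  -- `Q` is strongly regular up to a power: `Q ^ n = Q ^ (2 * n) * y` with `y` commuting with `Q`
  obtain ⟨n, y, hc, hy⟩ : ∃ (n : ℕ) (y : End k H), Commute y (Q ^ (n + 1)) ∧
      Q ^ (n + 1) * (Q ^ (n + 1) * y) = Q ^ (n + 1) := by
    let R := Algebra.adjoin k {Q}
    have : IsMulCommutative R := Algebra.isMulCommutative_adjoin k (by
      intro a ha b hb; simp only [Set.mem_singleton_iff] at ha hb; rw [ha, hb])
    let _ : CommRing R := { (inferInstance : Ring R) with mul_comm := mul_comm' }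
    have : FiniteDimensional k R := inferInstance
    have : IsArtinianRing R := IsArtinianRing.of_finite k R
    let q : R := ⟨Q, Algebra.self_mem_adjoin_singleton k Q⟩
    obtain ⟨n, z, hz⟩ := IsArtinian.exists_pow_succ_smul_dvd q (1 : R)
    simp only [smul_eq_mul, mul_one, Nat.succ_eq_add_one] at hz
    have step : ∀ m : ℕ, q ^ n * (q ^ m * z ^ m) = q ^ n := by
      intro m
      induction m with
      | zero => simp
      | succ m ih =>
        calc q ^ n * (q ^ (m + 1) * z ^ (m + 1)) = (q ^ (n + 1) * z) * (q ^ m * z ^ m) := by ring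
          _ = q ^ n := by rw [hz, ih]
    refine ⟨n, ((z ^ (n + 1) : R) : End k H), ?_, ?_⟩
    · have := mul_comm (z ^ (n + 1)) (q ^ (n + 1))
      exact congrArg Subtype.val this
    · have : q ^ (n + 1) * (q ^ (n + 1) * z ^ (n + 1)) = q ^ (n + 1) := by
        conv_rhs => rw [pow_succ', ← step (n + 1)]
        ring
      exact congrArg Subtype.val this
  have hmul : ∀ a b, (Q ^ (n + 1)) (a * b) = (Q ^ (n + 1)) a * (Q ^ (n + 1)) b := by
    generalize n + 1 = m
    induction m with
    | zero => simp
    | succ m ih => intro a b; simp only [pow_succ', Module.End.mul_apply, ih]; simp [hQ]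
  have hone : (Q ^ (n + 1)) 1 = 1 := by
    generalize n + 1 = m
    induction m with
    | zero => simp
    | succ m ih => simp only [pow_succ', Module.End.mul_apply, ih]; simp [hQ]
  generalize hT : Q ^ (n + 1) = T at *
  have hyT : ∀ x, y (T x) = T (y x) := fun x => LinearMap.congr_fun hc.eq x
  have hTT : ∀ x, T (T (y x)) = T x := fun x => LinearMap.congr_fun hy x
  have hpT : ∀ x, y (T (T x)) = T x := fun x => by rw [hyT, hyT, hTT]
  let p : H →ₐ[k] H := AlgHom.ofLinearMap (y * T)
    (by
      have := hpT 1
      simpa [hone] using this)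
    (by
      intro a b
      simp only [Module.End.mul_apply]
      have h1 : y (T (T (y a * y b))) = T (y a * y b) := hpT _
      have h2 : T (T (y a) * T (y b)) = T (a * b) := by rw [hmul, hTT, hTT, hmul]
      rw [hyT a, hyT b, ← hmul, ← h1, hmul (y a), h2])
  have hp : p = AlgHom.id k H := by
    apply algHom_ext_comp_antipodeSq_pow (n + 1)
    intro x
    rw [← hQ, hT]
    exact hpT x
  have hinj : Function.Injective T := by
    intro a b hab
    have ha : p a = p b := congrArg y hab
    simpa [hp] using ha
  have hn : Function.Injective (HopfAlgebra.antipode k : H →ₗ[k] H) := by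
    rw [injective_iff_map_eq_zero]
    intro a ha
    apply (injective_iff_map_eq_zero T).1 hinj
    have hQa : Q a = 0 := by
      change HopfAlgebra.antipode k (HopfAlgebra.antipode k a) = 0
      rw [ha, map_zero]
    rw [← hT, pow_succ, Module.End.mul_apply, hQa, map_zero]
  exact ⟨hn, LinearMap.injective_iff_surjective.1 hn⟩

/-- The inverse of the antipode of a finite-dimensional Hopf algebra. -/
def antipodeInv (k H : Type*) [Field k] [Ring H] [HopfAlgebra k H] [FiniteDimensional k H] :
    H →ₗ[k] H :=
  (LinearEquiv.ofBijective (HopfAlgebra.antipode k : H →ₗ[k] H)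
    (antipode_bijective k H)).symm.toLinearMap

variable [FiniteDimensional k H]

@[simp] theorem antipode_antipodeInv (x : H) :
    HopfAlgebra.antipode k (antipodeInv k H x) = x :=
  (LinearEquiv.ofBijective (HopfAlgebra.antipode k : H →ₗ[k] H)
    (antipode_bijective k H)).apply_symm_apply x

@[simp] theorem antipodeInv_antipode (x : H) :
    antipodeInv k H (HopfAlgebra.antipode k x) = x :=
  (LinearEquiv.ofBijective (HopfAlgebra.antipode k : H →ₗ[k] H)
    (antipode_bijective k H)).symm_apply_apply x

theorem sum_antipodeInv_mul {ι : Type*} {a : H} (r : Coalgebra.Repr k a ι) :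
    ∑ i ∈ r.index, antipodeInv k H (r.right i) * r.left i =
      algebraMap k H (Coalgebra.counit a) := by
  apply (antipode_bijective k H).1
  rw [map_sum]
  simp only [HopfAlgebra.antipode_mul_antidistrib, antipode_antipodeInv]
  rw [HopfAlgebra.sum_antipode_mul_eq_algebraMap_counit r]
  simp [Algebra.algebraMap_eq_smul_one]

theorem sum_mul_antipodeInv {ι : Type*} {a : H} (r : Coalgebra.Repr k a ι) :
    ∑ i ∈ r.index, r.right i * antipodeInv k H (r.left i) =
      algebraMap k H (Coalgebra.counit a) := by
  apply (antipode_bijective k H).1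
  rw [map_sum]
  simp only [HopfAlgebra.antipode_mul_antidistrib, antipode_antipodeInv]
  rw [HopfAlgebra.sum_mul_antipode_eq_algebraMap_counit r]
  simp [Algebra.algebraMap_eq_smul_one]

end Antipode

/-! ## The opposite Hopf algebra `Hᵐᵒᵖ` -/

section Op

variable {k H : Type*} [Field k] [Ring H]

instance MulOpposite.instBialgebraOp [Bialgebra k H] : Bialgebra k Hᵐᵒᵖ :=
  Bialgebra.mk' k Hᵐᵒᵖ
    (by simp [MulOpposite.counit_def])
    (by intro a b; simp [MulOpposite.counit_def, mul_comm])
    (by simp [MulOpposite.comul_def, Algebra.TensorProduct.one_def])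
    (by
      intro a b
      induction a using MulOpposite.rec' with | _ a
      induction b using MulOpposite.rec' with | _ b
      have h : ∀ x y : H ⊗[k] H,
          TensorProduct.map (MulOpposite.opLinearEquiv k (M := H)).toLinearMap
            (MulOpposite.opLinearEquiv k (M := H)).toLinearMap (x * y) =
          TensorProduct.map (MulOpposite.opLinearEquiv k (M := H)).toLinearMap
            (MulOpposite.opLinearEquiv k (M := H)).toLinearMap y *
          TensorProduct.map (MulOpposite.opLinearEquiv k (M := H)).toLinearMap
            (MulOpposite.opLinearEquiv k (M := H)).toLinearMap x := by
        intro x y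
        induction x with
        | zero => simp
        | add x x' hx hx' => simp only [add_mul, mul_add, map_add, hx, hx']
        | tmul x x' =>
          induction y with
          | zero => simp
          | add y y' hy hy' => simp only [add_mul, mul_add, map_add, hy, hy']
          | tmul y y' => simp
      simp [MulOpposite.comul_def, h])

/-- The antipode of `Hᵐᵒᵖ` is the inverse of the antipode of `H`. -/
instance MulOpposite.instHopfAlgebraOp [HopfAlgebra k H] [FiniteDimensional k H] :
    HopfAlgebra k Hᵐᵒᵖ where
  antipode := (MulOpposite.opLinearEquiv k).toLinearMap ∘ₗ antipodeInv k H ∘ₗ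
    (MulOpposite.opLinearEquiv k).symm.toLinearMap
  mul_antipode_rTensor_comul := by
    ext a
    induction a using MulOpposite.rec' with | _ a
    have h := sum_mul_antipodeInv (Coalgebra.Repr.arbitrary k a)
    have e : (MulOpposite.opLinearEquiv k).symm (MulOpposite.op a) = a := rfl
    simp only [MulOpposite.comul_def, MulOpposite.counit_def, LinearMap.comp_apply,
      LinearEquiv.coe_coe, e]
    rw [← (Coalgebra.Repr.arbitrary k a).eq]
    simp [MulOpposite.algebraMap_apply, ← h, ← MulOpposite.op_mul]
  mul_antipode_lTensor_comul := by
    ext a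
    induction a using MulOpposite.rec' with | _ a
    have h := sum_antipodeInv_mul (Coalgebra.Repr.arbitrary k a)
    have e : (MulOpposite.opLinearEquiv k).symm (MulOpposite.op a) = a := rfl
    simp only [MulOpposite.comul_def, MulOpposite.counit_def, LinearMap.comp_apply,
      LinearEquiv.coe_coe, e]
    rw [← (Coalgebra.Repr.arbitrary k a).eq]
    simp [MulOpposite.algebraMap_apply, ← h, ← MulOpposite.op_mul]

end Op

/-! ## The coopposite coalgebra -/

section Coop

/-- The coopposite of a coalgebra: the same space (and product), with flipped comultiplication. -/
def Cop (C : Type*) : Type _ := C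

variable {k C : Type*} [Field k]

instance Cop.instAddCommGroup [AddCommGroup C] : AddCommGroup (Cop C) :=
  inferInstanceAs (AddCommGroup C)

instance Cop.instModule [AddCommGroup C] [Module k C] : Module k (Cop C) :=
  inferInstanceAs (Module k C)

instance Cop.instRing [Ring C] : Ring (Cop C) := inferInstanceAs (Ring C)

instance Cop.instAlgebra [Ring C] [Algebra k C] : Algebra k (Cop C) :=
  inferInstanceAs (Algebra k C)

instance Cop.instFiniteDimensional [AddCommGroup C] [Module k C] [FiniteDimensional k C] :
    FiniteDimensional k (Cop C) :=
  inferInstanceAs (FiniteDimensional k C)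

/-- The identity, regarded as a linear equivalence from `C` to its coopposite. -/
def Cop.of (k C : Type*) [Field k] [AddCommGroup C] [Module k C] : C ≃ₗ[k] Cop C :=
  LinearEquiv.refl k C

/-- The flip `C ⊗ C → Cop C ⊗ Cop C`. -/
def Cop.flip (k C : Type*) [Field k] [AddCommGroup C] [Module k C] :
    C ⊗[k] C →ₗ[k] Cop C ⊗[k] Cop C :=
  TensorProduct.map (Cop.of k C).toLinearMap (Cop.of k C).toLinearMap ∘ₗ
    (TensorProduct.comm k C C).toLinearMap

@[simp] theorem Cop.flip_tmul [AddCommGroup C] [Module k C] (a b : C) :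
    Cop.flip k C (a ⊗ₜ b) = Cop.of k C b ⊗ₜ Cop.of k C a := rfl

instance Cop.instCoalgebra [AddCommGroup C] [Module k C] [Coalgebra k C] :
    Coalgebra k (Cop C) where
  comul := Cop.flip k C ∘ₗ Coalgebra.comul ∘ₗ (Cop.of k C).symm.toLinearMap
  counit := Coalgebra.counit ∘ₗ (Cop.of k C).symm.toLinearMap
  coassoc := by
    let R : C ⊗[k] (C ⊗[k] C) →ₗ[k] Cop C ⊗[k] (Cop C ⊗[k] Cop C) :=
      (TensorProduct.assoc k (Cop C) (Cop C) (Cop C)).toLinearMap ∘ₗ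
        (TensorProduct.comm k (Cop C) (Cop C ⊗[k] Cop C)).toLinearMap ∘ₗ
          TensorProduct.map (Cop.of k C).toLinearMap (Cop.flip k C)
    have hR : ∀ (b : C) (s : C ⊗[k] C),
        R (TensorProduct.assoc k C C C (s ⊗ₜ b)) = Cop.of k C b ⊗ₜ Cop.flip k C s := by
      intro b s
      induction s with
      | zero => simp
      | add s s' hs hs' => simp only [TensorProduct.add_tmul, TensorProduct.tmul_add, map_add, hs, hs']
      | tmul a c => simp [R]
    ext x
    obtain ⟨x, rfl⟩ := (Cop.of k C).surjective x
    have h := congrArg R (Coalgebra.coassoc_apply (R := k) x)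
    simp only [LinearMap.comp_apply, LinearEquiv.coe_coe, LinearEquiv.symm_apply_apply]
    generalize Coalgebra.comul (R := k) x = t at h ⊢
    have h1 : ∀ t : C ⊗[k] C, R (TensorProduct.assoc k C C C
          (LinearMap.rTensor C Coalgebra.comul t)) =
        LinearMap.lTensor (Cop C) (Cop.flip k C ∘ₗ Coalgebra.comul ∘ₗ
          (Cop.of k C).symm.toLinearMap) (Cop.flip k C t) := by
      intro t
      induction t with
      | zero => simp
      | add t t' ht ht' => simp only [map_add, ht, ht']
      | tmul a b => simp [hR]
    have h2 : ∀ t : C ⊗[k] C, R (LinearMap.lTensor C Coalgebra.comul t) =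
        TensorProduct.assoc k (Cop C) (Cop C) (Cop C) (LinearMap.rTensor (Cop C)
          (Cop.flip k C ∘ₗ Coalgebra.comul ∘ₗ (Cop.of k C).symm.toLinearMap)
          (Cop.flip k C t)) := by
      intro t
      induction t with
      | zero => simp
      | add t t' ht ht' => simp only [map_add, ht, ht']
      | tmul a b => simp [R]
    rw [← h1, ← h2, h]
  rTensor_counit_comp_comul := by
    ext x
    obtain ⟨x, rfl⟩ := (Cop.of k C).surjective x
    simp only [LinearMap.comp_apply, LinearEquiv.coe_coe, LinearEquiv.symm_apply_apply]
    have h : ∀ t : C ⊗[k] C, LinearMap.rTensor (Cop C)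
        (Coalgebra.counit ∘ₗ (Cop.of k C).symm.toLinearMap) (Cop.flip k C t) =
        TensorProduct.map LinearMap.id (Cop.of k C).toLinearMap (TensorProduct.comm k C k
          (LinearMap.lTensor C Coalgebra.counit t)) := by
      intro t
      induction t with
      | zero => simp
      | add t t' ht ht' => simp only [map_add, ht, ht']
      | tmul a b => simp
    rw [h]
    simp
  lTensor_counit_comp_comul := by
    ext x
    obtain ⟨x, rfl⟩ := (Cop.of k C).surjective x
    simp only [LinearMap.comp_apply, LinearEquiv.coe_coe, LinearEquiv.symm_apply_apply]
    have h : ∀ t : C ⊗[k] C, LinearMap.lTensor (Cop C)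
        (Coalgebra.counit ∘ₗ (Cop.of k C).symm.toLinearMap) (Cop.flip k C t) =
        TensorProduct.map (Cop.of k C).toLinearMap LinearMap.id (TensorProduct.comm k k C
          (LinearMap.rTensor C Coalgebra.counit t)) := by
      intro t
      induction t with
      | zero => simp
      | add t t' ht ht' => simp only [map_add, ht, ht']
      | tmul a b => simp
    rw [h]
    simp

theorem Cop.comul_of [AddCommGroup C] [Module k C] [Coalgebra k C] (x : C) :
    Coalgebra.comul (R := k) (Cop.of k C x) = Cop.flip k C (Coalgebra.comul x) := rfl

theorem Cop.counit_of [AddCommGroup C] [Module k C] [Coalgebra k C] (x : C) :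
    Coalgebra.counit (R := k) (Cop.of k C x) = Coalgebra.counit (R := k) x := rfl

theorem Cop.of_mul [Ring C] [Algebra k C] (x y : C) :
    Cop.of k C (x * y) = Cop.of k C x * Cop.of k C y := rfl

theorem Cop.of_one [Ring C] [Algebra k C] : Cop.of k C 1 = 1 := rfl

theorem Cop.flip_mul [Ring C] [Algebra k C] (x y : C ⊗[k] C) :
    Cop.flip k C (x * y) = Cop.flip k C x * Cop.flip k C y := by
  induction x with
  | zero => simp
  | add x x' hx hx' => simp only [add_mul, map_add, hx, hx']
  | tmul x x' =>
    induction y with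
    | zero => simp
    | add y y' hy hy' => simp only [mul_add, map_add, hy, hy']
    | tmul y y' => simp [Cop.of_mul]

instance Cop.instBialgebra [Ring C] [Bialgebra k C] : Bialgebra k (Cop C) :=
  Bialgebra.mk' k (Cop C)
    (Bialgebra.counit_one (R := k) (A := C))
    (fun {a b} => Bialgebra.counit_mul (R := k) (A := C) a b)
    (by
      rw [← Cop.of_one (k := k) (C := C), Cop.comul_of, Bialgebra.comul_one]
      rfl)
    (by
      intro a b
      obtain ⟨a, rfl⟩ := (Cop.of k C).surjective a
      obtain ⟨b, rfl⟩ := (Cop.of k C).surjective b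
      rw [← Cop.of_mul, Cop.comul_of, Cop.comul_of, Cop.comul_of, Bialgebra.comul_mul,
        Cop.flip_mul])

/-- The antipode of `Cop H` is the inverse of the antipode of `H`. -/
instance Cop.instHopfAlgebra [Ring C] [HopfAlgebra k C] [FiniteDimensional k C] :
    HopfAlgebra k (Cop C) where
  antipode := (Cop.of k C).toLinearMap ∘ₗ antipodeInv k C ∘ₗ (Cop.of k C).symm.toLinearMap
  mul_antipode_rTensor_comul := by
    ext a
    obtain ⟨a, rfl⟩ := (Cop.of k C).surjective a
    have h := sum_antipodeInv_mul (Coalgebra.Repr.arbitrary k a)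
    simp only [LinearMap.comp_apply, Cop.comul_of, Cop.counit_of]
    rw [← (Coalgebra.Repr.arbitrary k a).eq]
    simp only [map_sum, Cop.flip_tmul, LinearMap.rTensor_tmul, LinearMap.comp_apply,
      LinearEquiv.coe_coe, LinearEquiv.symm_apply_apply, LinearMap.mul'_apply, ← Cop.of_mul]
    exact (map_sum (Cop.of k C) _ _).symm.trans (congrArg (Cop.of k C) h)
  mul_antipode_lTensor_comul := by
    ext a
    obtain ⟨a, rfl⟩ := (Cop.of k C).surjective a
    have h := sum_mul_antipodeInv (Coalgebra.Repr.arbitrary k a)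
    simp only [LinearMap.comp_apply, Cop.comul_of, Cop.counit_of]
    rw [← (Coalgebra.Repr.arbitrary k a).eq]
    simp only [map_sum, Cop.flip_tmul, LinearMap.lTensor_tmul, LinearMap.comp_apply,
      LinearEquiv.coe_coe, LinearEquiv.symm_apply_apply, LinearMap.mul'_apply, ← Cop.of_mul]
    exact (map_sum (Cop.of k C) _ _).symm.trans (congrArg (Cop.of k C) h)

end Coop
/-! ## Quasi-bialgebras -/

/-- The structure maps of a quasi-bialgebra on a vector space `V`. -/
@[ext]
structure QuasiBialgebraData (k V : Type*) [Field k] [AddCommGroup V] [Module k V] where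
  mul : V →ₗ[k] V →ₗ[k] V
  one : V
  comul : V →ₗ[k] V ⊗[k] V
  counit : V →ₗ[k] k
  associator : V ⊗[k] (V ⊗[k] V)

namespace QuasiBialgebraData

variable {k V W : Type*} [Field k] [AddCommGroup V] [Module k V] [AddCommGroup W] [Module k W]

/-- The factorwise product on `V ⊗ V`. -/
def mul₂ (Q : QuasiBialgebraData k V) : V ⊗[k] V →ₗ[k] V ⊗[k] V →ₗ[k] V ⊗[k] V :=
  TensorProduct.map₂ Q.mul Q.mul

/-- The factorwise product on `V ⊗ V ⊗ V`. -/
def mul₃ (Q : QuasiBialgebraData k V) :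
    V ⊗[k] (V ⊗[k] V) →ₗ[k] V ⊗[k] (V ⊗[k] V) →ₗ[k] V ⊗[k] (V ⊗[k] V) :=
  TensorProduct.map₂ Q.mul Q.mul₂

/-- The factorwise product on `V ⊗ V ⊗ V ⊗ V`. -/
def mul₄ (Q : QuasiBialgebraData k V) :
    V ⊗[k] (V ⊗[k] (V ⊗[k] V)) →ₗ[k] V ⊗[k] (V ⊗[k] (V ⊗[k] V)) →ₗ[k]
      V ⊗[k] (V ⊗[k] (V ⊗[k] V)) :=
  TensorProduct.map₂ Q.mul Q.mul₃

/-- The unit of `V ⊗ V ⊗ V`. -/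
def one₃ (Q : QuasiBialgebraData k V) : V ⊗[k] (V ⊗[k] V) := Q.one ⊗ₜ (Q.one ⊗ₜ Q.one)

/-- `y` is a two-sided inverse of the associator in `V ⊗ V ⊗ V`. -/
def IsAssociatorInverse (Q : QuasiBialgebraData k V) (y : V ⊗[k] (V ⊗[k] V)) : Prop :=
  Q.mul₃ Q.associator y = Q.one₃ ∧ Q.mul₃ y Q.associator = Q.one₃

/-- The inverse of the associator (meaningful when the associator is invertible). -/
def associatorInv (Q : QuasiBialgebraData k V) : V ⊗[k] (V ⊗[k] V) :=
  Classical.epsilon Q.IsAssociatorInverse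

/-- The axioms of a quasi-bialgebra, with the convention
`(id ⊗ Δ)(Δ(v)) φ = φ (Δ ⊗ id)(Δ(v))`. -/
structure IsQuasiBialgebra (Q : QuasiBialgebraData k V) : Prop where
  mul_assoc : ∀ x y z, Q.mul (Q.mul x y) z = Q.mul x (Q.mul y z)
  one_mul : ∀ x, Q.mul Q.one x = x
  mul_one : ∀ x, Q.mul x Q.one = x
  comul_mul : ∀ x y, Q.comul (Q.mul x y) = Q.mul₂ (Q.comul x) (Q.comul y)
  comul_one : Q.comul Q.one = Q.one ⊗ₜ Q.one
  counit_mul : ∀ x y, Q.counit (Q.mul x y) = Q.counit x * Q.counit y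
  counit_one : Q.counit Q.one = 1
  counit_comul : ∀ x, TensorProduct.lid k V (LinearMap.rTensor V Q.counit (Q.comul x)) = x
  comul_counit : ∀ x, TensorProduct.rid k V (LinearMap.lTensor V Q.counit (Q.comul x)) = x
  associator_invertible : ∃ y, Q.IsAssociatorInverse y
  quasi_coassoc : ∀ x,
    Q.mul₃ (LinearMap.lTensor V Q.comul (Q.comul x)) Q.associator =
      Q.mul₃ Q.associator
        (TensorProduct.assoc k V V V (LinearMap.rTensor V Q.comul (Q.comul x)))
  /-- `(id ⊗ id ⊗ Δ)(φ) (Δ ⊗ id ⊗ id)(φ) = (1 ⊗ φ) (id ⊗ Δ ⊗ id)(φ) (φ ⊗ 1)` -/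
  pentagon :
    Q.mul₄ (LinearMap.lTensor V (LinearMap.lTensor V Q.comul) Q.associator)
        (TensorProduct.assoc k V V (V ⊗[k] V)
          (LinearMap.rTensor (V ⊗[k] V) Q.comul Q.associator)) =
      Q.mul₄
        (Q.mul₄ (Q.one ⊗ₜ Q.associator)
          (LinearMap.lTensor V ((TensorProduct.assoc k V V V).toLinearMap ∘ₗ
            LinearMap.rTensor V Q.comul) Q.associator))
        (LinearMap.lTensor V (TensorProduct.assoc k V V V).toLinearMap
          (TensorProduct.assoc k V (V ⊗[k] V) V (Q.associator ⊗ₜ Q.one)))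
  /-- `(id ⊗ ε ⊗ id)(φ) = 1 ⊗ 1` -/
  associator_counit :
    LinearMap.lTensor V ((TensorProduct.lid k V).toLinearMap ∘ₗ LinearMap.rTensor V Q.counit)
      Q.associator = Q.one ⊗ₜ Q.one

/-- The opposite quasi-bialgebra: opposite product, same comultiplication and counit, and the
inverse of the associator as associator. -/
def op (Q : QuasiBialgebraData k V) : QuasiBialgebraData k V where
  mul := Q.mul.flip
  one := Q.one
  comul := Q.comul
  counit := Q.counit
  associator := Q.associatorInv

/-- `e` is an isomorphism of quasi-bialgebras from `Q` to `Q'`. -/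
structure IsQuasiBialgebraIso (Q : QuasiBialgebraData k V) (Q' : QuasiBialgebraData k W)
    (e : V ≃ₗ[k] W) : Prop where
  source : Q.IsQuasiBialgebra
  target : Q'.IsQuasiBialgebra
  map_mul : ∀ x y, e (Q.mul x y) = Q'.mul (e x) (e y)
  map_one : e Q.one = Q'.one
  map_comul : ∀ x, TensorProduct.map e.toLinearMap e.toLinearMap (Q.comul x) = Q'.comul (e x)
  map_counit : ∀ x, Q'.counit (e x) = Q.counit x
  map_associator :
    TensorProduct.map e.toLinearMap (TensorProduct.map e.toLinearMap e.toLinearMap)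
      Q.associator = Q'.associator

end QuasiBialgebraData

/-! ## Duals of coalgebras and algebras -/

section Dual

variable (k : Type*) [Field k]

/-- The (convolution) product on the dual of a coalgebra: `⟨f g, c⟩ = ∑ ⟨f, c₍₁₎⟩ ⟨g, c₍₂₎⟩`. -/
def dualMul (C : Type*) [AddCommGroup C] [Module k C] [Coalgebra k C] :
    Dual k C →ₗ[k] Dual k C →ₗ[k] Dual k C :=
  (TensorProduct.mk k (Dual k C) (Dual k C)).compr₂
    ((Coalgebra.comul (R := k) (A := C)).dualMap ∘ₗ TensorProduct.dualDistrib k C C)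

/-- The coproduct on the dual of a finite-dimensional algebra:
`∑ ⟨u₍₁₎, x⟩ ⟨u₍₂₎, y⟩ = ⟨u, x y⟩`. -/
def dualComul (H : Type*) [Ring H] [Algebra k H] [FiniteDimensional k H] :
    Dual k H →ₗ[k] Dual k H ⊗[k] Dual k H :=
  (TensorProduct.dualDistribEquiv k H H).symm.toLinearMap ∘ₗ (LinearMap.mul' k H).dualMap

end Dual

/-! ## Partially admissible mapping systems -/

/-- The linear maps making up a mapping system
`B --ι--> H --π--> C`, `ζ : H → B`, `γ : C → H`. -/
structure MappingSystem (k H B C : Type*) [Field k] [Ring H] [HopfAlgebra k H]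
    [Ring B] [Algebra k B] [AddCommGroup C] [Module k C] where
  /-- the inclusion `B → H` -/
  ι : B →ₗ[k] H
  /-- the left `H`-coaction on `B`, `b ↦ ∑ b₍₁₎ ⊗ b₍₂₎` -/
  coact : B →ₗ[k] H ⊗[k] B
  /-- the quotient map `H → C` -/
  π : H →ₗ[k] C
  /-- the right `H`-action on `C`, `x ↦ h ↦ x ◁ h` -/
  act : C →ₗ[k] H →ₗ[k] C
  ζ : H →ₗ[k] B
  /-- the convolution inverse of `ζ` -/
  ζbar : H →ₗ[k] B
  γ : C →ₗ[k] H
  /-- the convolution inverse of `γ` -/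
  γbar : C →ₗ[k] H

namespace MappingSystem

variable {k H B C : Type*} [Field k] [Ring H] [HopfAlgebra k H] [Ring B] [Algebra k B]
  [AddCommGroup C] [Module k C] [Coalgebra k C]

/-- The mapping system is a partially admissible mapping system `(ζ, γ*)` for `ι`. -/
structure IsPAMS (P : MappingSystem k H B C) : Prop where
  -- `B` is a left `H`-comodule algebra
  coact_coassoc : ∀ b, TensorProduct.assoc k H H B
    (LinearMap.rTensor B Coalgebra.comul (P.coact b)) = LinearMap.lTensor H P.coact (P.coact b)
  coact_counit : ∀ b, TensorProduct.lid k B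
    (LinearMap.rTensor B (Coalgebra.counit (R := k) (A := H)) (P.coact b)) = b
  coact_mul : ∀ b c, P.coact (b * c) = P.coact b * P.coact c
  coact_one : P.coact 1 = 1
  -- `ι` is an injection of left `H`-comodule algebras
  ι_injective : Function.Injective P.ι
  ι_mul : ∀ b c, P.ι (b * c) = P.ι b * P.ι c
  ι_one : P.ι 1 = 1
  ι_coact : ∀ b, Coalgebra.comul (P.ι b) = LinearMap.lTensor H P.ι (P.coact b)
  -- `C` is a right `H`-module coalgebra
  act_mul : ∀ x g h, P.act x (g * h) = P.act (P.act x g) h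
  act_one : ∀ x, P.act x 1 = x
  act_comul : ∀ x h, Coalgebra.comul (P.act x h) =
    TensorProduct.map₂ P.act P.act (Coalgebra.comul x) (Coalgebra.comul h)
  act_counit : ∀ x h, Coalgebra.counit (R := k) (P.act x h) =
    Coalgebra.counit (R := k) x * Coalgebra.counit (R := k) h
  -- `π` is a surjection of right `H`-module coalgebras
  π_surjective : Function.Surjective P.π
  π_mul : ∀ g h, P.π (g * h) = P.act (P.π g) h
  π_comul : ∀ h, Coalgebra.comul (P.π h) = TensorProduct.map P.π P.π (Coalgebra.comul h)
  π_counit : ∀ h, Coalgebra.counit (R := k) (P.π h) = Coalgebra.counit (R := k) h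
  -- the image of `ι` is the space of coinvariants of the right `C`-comodule `H`
  mem_range_ι_iff : ∀ h, h ∈ LinearMap.range P.ι ↔
    LinearMap.lTensor H P.π (Coalgebra.comul h) = h ⊗ₜ P.π 1
  -- `ζ` and `γ` are convolution invertible
  ζ_mul_ζbar : toConv P.ζ * toConv P.ζbar = 1
  ζbar_mul_ζ : toConv P.ζbar * toConv P.ζ = 1
  γ_mul_γbar : toConv P.γ * toConv P.γbar = 1
  γbar_mul_γ : toConv P.γbar * toConv P.γ = 1
  -- `ζ` preserves left `B`-actions and `γ` preserves right `C`-coactions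
  ζ_act : ∀ b h, P.ζ (P.ι b * h) = b * P.ζ h
  γ_coact : ∀ x, LinearMap.lTensor H P.π (Coalgebra.comul (P.γ x)) =
    LinearMap.rTensor C P.γ (Coalgebra.comul x)
  -- `ζ` and `γ` are biunitary
  ζ_one : P.ζ 1 = 1
  ζ_counit : ∀ h, Coalgebra.counit (R := k) (P.ι (P.ζ h)) = Coalgebra.counit (R := k) h
  γ_one : P.γ (P.π 1) = 1
  γ_counit : ∀ x, Coalgebra.counit (R := k) (P.γ x) = Coalgebra.counit (R := k) x
  -- `(ι ∘ ζ) * (γ ∘ π) = id` for the convolution product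
  conv_eq_id : toConv (P.ι ∘ₗ P.ζ) * toConv (P.γ ∘ₗ P.π) = toConv LinearMap.id

/-! ### The left partial dual `C* # B` -/

/-- The left hit action of `H` on `C*`: `⟨h ⇀ f, x⟩ = ⟨f, x ◁ h⟩`. -/
def hit (P : MappingSystem k H B C) : H →ₗ[k] Dual k C →ₗ[k] Dual k C :=
  Dual.transpose ∘ₗ P.act.flip

/-- The hit action of `H*` on `B`: `b ↼ u = ∑ ⟨u, b₍₁₎⟩ b₍₂₎`. -/
def hitRight (P : MappingSystem k H B C) : B →ₗ[k] Dual k H →ₗ[k] B :=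
  LinearMap.flip
    ((LinearMap.lcomp k B P.coact) ∘ₗ
      (LinearMap.compRight k (TensorProduct.lid k B).toLinearMap) ∘ₗ
        LinearMap.rTensorHom B)

/-- The product of the smash product `C* # B`, `(f # b)(g # c) = ∑ f (b₍₁₎ ⇀ g) # b₍₂₎ c`. -/
def smashMul (P : MappingSystem k H B C) :
    Dual k C ⊗[k] B →ₗ[k] Dual k C ⊗[k] B →ₗ[k] Dual k C ⊗[k] B :=
  TensorProduct.lift (LinearMap.mk₂ k
    (fun f b => TensorProduct.map₂ (P.hit.compr₂ (dualMul k C f)) (LinearMap.mul k B) (P.coact b))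
    (by
      intro f f' b
      have e : TensorProduct.map₂ (P.hit.compr₂ (dualMul k C (f + f'))) (LinearMap.mul k B) =
          TensorProduct.map₂ (P.hit.compr₂ (dualMul k C f)) (LinearMap.mul k B) +
            TensorProduct.map₂ (P.hit.compr₂ (dualMul k C f')) (LinearMap.mul k B) := by
        refine TensorProduct.ext' fun h c => TensorProduct.ext' fun g d => ?_
        simp [TensorProduct.map₂_apply_tmul, TensorProduct.add_tmul]
      rw [e, LinearMap.add_apply])
    (by
      intro r f b
      have e : TensorProduct.map₂ (P.hit.compr₂ (dualMul k C (r • f))) (LinearMap.mul k B) =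
          r • TensorProduct.map₂ (P.hit.compr₂ (dualMul k C f)) (LinearMap.mul k B) := by
        refine TensorProduct.ext' fun h c => TensorProduct.ext' fun g d => ?_
        simp [TensorProduct.map₂_apply_tmul, TensorProduct.smul_tmul']
      rw [e, LinearMap.smul_apply])
    (by intros; rw [map_add, map_add]) (by intros; rw [map_smul, map_smul]))

/-- `f ↦ f # b`. -/
def inl (b : B) : Dual k C →ₗ[k] Dual k C ⊗[k] B := (TensorProduct.mk k (Dual k C) B).flip b

/-- `b ↦ ε # b`. -/
def inr (k : Type*) {B : Type*} (C : Type*) [Field k] [Ring B] [Algebra k B]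
    [AddCommGroup C] [Module k C] [Coalgebra k C] : B →ₗ[k] Dual k C ⊗[k] B :=
  TensorProduct.mk k (Dual k C) B Coalgebra.counit

variable [FiniteDimensional k H] [FiniteDimensional k B] [FiniteDimensional k C]

/-- The right `H*`-coaction `f ↦ ∑ f₍₁₎ ⊗ f₍₂₎` on `C*`, dual to the action of `H` on `C`:
`∑ ⟨f₍₁₎, x⟩ ⟨f₍₂₎, h⟩ = ⟨f, x ◁ h⟩`. -/
def dualCoact (P : MappingSystem k H B C) : Dual k C →ₗ[k] Dual k C ⊗[k] Dual k H :=
  (TensorProduct.dualDistribEquiv k C H).symm.toLinearMap ∘ₗ (TensorProduct.lift P.act).dualMap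

/-- `Δ(f # 1) = ∑ᵢ (f₍₁₎ # bᵢ) ⊗ (γ*[f₍₂₎ ζ*(bᵢ*)] # 1)` for a basis `bᵢ` of `B`. -/
def comulLeft (P : MappingSystem k H B C) :
    Dual k C →ₗ[k] (Dual k C ⊗[k] B) ⊗[k] (Dual k C ⊗[k] B) :=
  ∑ i, TensorProduct.map
      (inl (Module.finBasis k B i))
      (inl 1 ∘ₗ P.γ.dualMap ∘ₗ
        (dualMul k H).flip (P.ζ.dualMap ((Module.finBasis k B).coord i))) ∘ₗ
    P.dualCoact

/-- `Δ(ε # b) = ∑ⱼ (ε # ζ[γ(xⱼ) b₍₁₎]) ⊗ (xⱼ* # b₍₂₎)` for a basis `xⱼ` of `C`. -/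
def comulRight (P : MappingSystem k H B C) :
    B →ₗ[k] (Dual k C ⊗[k] B) ⊗[k] (Dual k C ⊗[k] B) :=
  ∑ j, TensorProduct.map
      (inr k C ∘ₗ P.ζ ∘ₗ LinearMap.mulLeft k (P.γ (Module.finBasis k C j)))
      (TensorProduct.mk k (Dual k C) B ((Module.finBasis k C).coord j)) ∘ₗ
    P.coact

/-- The comultiplication, `Δ(f # b) = Δ(f # 1) Δ(ε # b)`. -/
def partialDualComul (P : MappingSystem k H B C) :
    Dual k C ⊗[k] B →ₗ[k] (Dual k C ⊗[k] B) ⊗[k] (Dual k C ⊗[k] B) :=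
  TensorProduct.lift
    ((TensorProduct.map₂ P.smashMul P.smashMul).compl₁₂ P.comulLeft P.comulRight)

/-- The counit, `f # b ↦ ⟨f, 1⟩ ⟨ε, b⟩`. -/
def partialDualCounit (P : MappingSystem k H B C) : Dual k C ⊗[k] B →ₗ[k] k :=
  LinearMap.mul' k k ∘ₗ
    TensorProduct.map (Dual.eval k C (P.π 1)) (Coalgebra.counit ∘ₗ P.ι)

/-- The map `u ↦ γbar*(S⁻¹(u)) # 1` from `H*`, where `S` is the antipode of `H*`. -/
def γbarInv (P : MappingSystem k H B C) : Dual k H →ₗ[k] Dual k C ⊗[k] B :=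
  inl 1 ∘ₗ P.γbar.dualMap ∘ₗ (antipodeInv k H).dualMap

/-- The associator: the sum over `i, j` of
`(ε # bᵢ) ⊗ (ε # bⱼ) (γbar*[S⁻¹(ζbar*(bᵢ*)₍₁₎)] # 1) ⊗ (γbar*[S⁻¹(ζbar*(bⱼ*) ζbar*(bᵢ*)₍₂₎)] # 1)`,
for a basis `bᵢ` of `B`. -/
def partialDualAssociator (P : MappingSystem k H B C) :
    (Dual k C ⊗[k] B) ⊗[k] ((Dual k C ⊗[k] B) ⊗[k] (Dual k C ⊗[k] B)) :=
  ∑ i, ∑ j, inr k C (Module.finBasis k B i) ⊗ₜ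
    TensorProduct.map
      (P.smashMul (inr k C (Module.finBasis k B j)) ∘ₗ P.γbarInv)
      (P.γbarInv ∘ₗ dualMul k H (P.ζbar.dualMap ((Module.finBasis k B).coord j)))
      (dualComul k H (P.ζbar.dualMap ((Module.finBasis k B).coord i)))

/-- The left partial dual `C* # B` determined by `(ζ, γ*)`. -/
def partialDual (P : MappingSystem k H B C) : QuasiBialgebraData k (Dual k C ⊗[k] B) where
  mul := P.smashMul
  one := Coalgebra.counit ⊗ₜ 1
  comul := P.partialDualComul
  counit := P.partialDualCounit
  associator := P.partialDualAssociator

/-! ### The induced mapping systems for `Hᵐᵒᵖ` and `Cop H` -/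

/-- The mapping system `Bᵐᵒᵖ --ι--> Hᵐᵒᵖ --π∘S⁻¹--> Cop C` with `(ζbar ∘ S⁻¹, γbar*)`. -/
def op (P : MappingSystem k H B C) : MappingSystem k Hᵐᵒᵖ Bᵐᵒᵖ (Cop C) where
  ι := (MulOpposite.opLinearEquiv k).toLinearMap ∘ₗ P.ι ∘ₗ
    (MulOpposite.opLinearEquiv k).symm.toLinearMap
  coact := TensorProduct.map (MulOpposite.opLinearEquiv k).toLinearMap
    (MulOpposite.opLinearEquiv k).toLinearMap ∘ₗ P.coact ∘ₗ
      (MulOpposite.opLinearEquiv k).symm.toLinearMap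
  π := (Cop.of k C).toLinearMap ∘ₗ P.π ∘ₗ antipodeInv k H ∘ₗ
    (MulOpposite.opLinearEquiv k).symm.toLinearMap
  act := (P.act.compl₁₂ (Cop.of k C).symm.toLinearMap
    (antipodeInv k H ∘ₗ (MulOpposite.opLinearEquiv k).symm.toLinearMap)).compr₂
      (Cop.of k C).toLinearMap
  ζ := (MulOpposite.opLinearEquiv k).toLinearMap ∘ₗ P.ζbar ∘ₗ antipodeInv k H ∘ₗ
    (MulOpposite.opLinearEquiv k).symm.toLinearMap
  ζbar := (MulOpposite.opLinearEquiv k).toLinearMap ∘ₗ P.ζ ∘ₗ antipodeInv k H ∘ₗ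
    (MulOpposite.opLinearEquiv k).symm.toLinearMap
  γ := (MulOpposite.opLinearEquiv k).toLinearMap ∘ₗ P.γbar ∘ₗ (Cop.of k C).symm.toLinearMap
  γbar := (MulOpposite.opLinearEquiv k).toLinearMap ∘ₗ P.γ ∘ₗ (Cop.of k C).symm.toLinearMap

/-- The mapping system `Bᵐᵒᵖ --S⁻¹∘ι--> Cop H --π--> Cop C` with `(ζbar, γbar* ∘ S⁻¹)`. -/
def cop (P : MappingSystem k H B C) : MappingSystem k (Cop H) Bᵐᵒᵖ (Cop C) where
  ι := (Cop.of k H).toLinearMap ∘ₗ antipodeInv k H ∘ₗ P.ι ∘ₗ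
    (MulOpposite.opLinearEquiv k).symm.toLinearMap
  coact := TensorProduct.map ((Cop.of k H).toLinearMap ∘ₗ antipodeInv k H)
    (MulOpposite.opLinearEquiv k).toLinearMap ∘ₗ P.coact ∘ₗ
      (MulOpposite.opLinearEquiv k).symm.toLinearMap
  π := (Cop.of k C).toLinearMap ∘ₗ P.π ∘ₗ (Cop.of k H).symm.toLinearMap
  act := (P.act.compl₁₂ (Cop.of k C).symm.toLinearMap (Cop.of k H).symm.toLinearMap).compr₂
      (Cop.of k C).toLinearMap
  ζ := (MulOpposite.opLinearEquiv k).toLinearMap ∘ₗ P.ζbar ∘ₗ (Cop.of k H).symm.toLinearMap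
  ζbar := (MulOpposite.opLinearEquiv k).toLinearMap ∘ₗ P.ζ ∘ₗ (Cop.of k H).symm.toLinearMap
  γ := (Cop.of k H).toLinearMap ∘ₗ antipodeInv k H ∘ₗ P.γbar ∘ₗ (Cop.of k C).symm.toLinearMap
  γbar := (Cop.of k H).toLinearMap ∘ₗ antipodeInv k H ∘ₗ P.γ ∘ₗ (Cop.of k C).symm.toLinearMap

/-- The identity, regarded as a linear equivalence from `C* # B` to the underlying space of the
partial duals of `Hᵐᵒᵖ` and `Cop H`. -/
def relabel (k B C : Type*) [Field k] [Ring B] [Algebra k B] [AddCommGroup C] [Module k C] :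
    Dual k C ⊗[k] B ≃ₗ[k] Dual k (Cop C) ⊗[k] Bᵐᵒᵖ :=
  TensorProduct.congr (Cop.of k C).symm.dualMap (MulOpposite.opLinearEquiv k)

end MappingSystem

end

open TensorProduct Module WithConv

noncomputable section

set_option linter.unusedSectionVars false

/-! ### Convolution identities and the inverse antipode -/

section ConvTools

variable {k H : Type*} [Field k] [Ring H] [HopfAlgebra k H]

/-! The left partial dual is a coboundary twist seen inside a larger algebra. Let E = C* # H be the
smash product (`Smash`), which contains C* # B through ι (`emb`). E carries a coassociative algebra
map D : E → E ⊗ E with D(f) = f ⊗ 1 and D(h) = ∑ h₍₁₎ ⊗ h₍₂₎ (`split`), and the element J = ∑ⱼ γ(xⱼ)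
⊗ xⱼ* (`twist`) is invertible, with inverse ∑ⱼ γbar(xⱼ) ⊗ xⱼ*. On C* # B one has Δ(v) J = J D(v),
and the associator satisfies φ (J ⊗ 1)(D ⊗ id)(J) = (1 ⊗ J)(id ⊗ D)(J).

These two identities (`map_emb_comul_mul_twist`, `map_emb_associator_mul`) are where the mapping
system enters. Under R ⊗ C* ≅ Hom(C, R), products of elements ∑ⱼ u(xⱼ) ⊗ xⱼ* become convolution
products (`canon_mul`), and both identities reduce to (ι∘ζ) * (γ∘π) = id, its rearrangements γbar∘π
= S * (ι∘ζ) and ι∘ζbar = (γ∘π) * S, and the colinearity of γ and γbar. Once they hold,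
quasi-coassociativity, multiplicativity of Δ and the pentagon follow by cancelling units in tensor
powers of E (`Realization`); only the counit axioms, which D does not see, need separate
computations.

For the opposite, the assignment f ↦ f, h ↦ h extends to an algebra anti-homomorphism from C* # H to
the smash product attached to Hᵐᵒᵖ (`anti`). It intertwines the two maps D, and it sends J⁻¹ to the
twist of the opposite system, because that system has γbar in the role of γ. Applying it to the two
defining identities reverses all products, so (C* # B)ᵒᵖ with associator φ⁻¹ matches the partial
dual of Hᵐᵒᵖ. Its restriction sends f # b = (f # 1)(ε # b) to (ε # b)(f # 1), which is φ.

For part (1), the system for Hᵐᵒᵖ is checked axiom by axiom; the substantial facts are that ζbar∘S⁻¹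
is B-linear on the other side, that γbar is colinear for π∘S⁻¹, and that γbar∘π convolved with
ι∘ζbar is S. The system for `Cop H` is the transport of this one along the Hopf algebra isomorphism
S⁻¹ : Hᵐᵒᵖ → `Cop H`. The partial dual is unchanged by replacing H with an isomorphic copy while
keeping B and C, so the two partial duals are equal. -/

theorem toConv_algHom_comp_mul {C R R' : Type*} [AddCommGroup C] [Module k C] [Coalgebra k C]
    [Ring R] [Algebra k R] [Ring R'] [Algebra k R'] (φ : R →ₐ[k] R') (u v : C →ₗ[k] R) :
    toConv (φ.toLinearMap ∘ₗ u) * toConv (φ.toLinearMap ∘ₗ v) =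
      toConv (φ.toLinearMap ∘ₗ (toConv u * toConv v).ofConv) := by
  rw [LinearMap.algHom_comp_convMul_distrib]

theorem toConv_algHom_comp_one {C R R' : Type*} [AddCommGroup C] [Module k C] [Coalgebra k C]
    [Ring R] [Algebra k R] [Ring R'] [Algebra k R'] (φ : R →ₐ[k] R') :
    toConv (φ.toLinearMap ∘ₗ (1 : WithConv (C →ₗ[k] R)).ofConv) = 1 := by
  ext c
  simp [LinearMap.convOne_def]

section

variable {C R : Type*} [AddCommGroup C] [Module k C] [Coalgebra k C] [Ring R] [Algebra k R]

theorem toConv_mul_apply (u v : C →ₗ[k] R) (c : C) :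
    (toConv u * toConv v).ofConv c =
      LinearMap.mul' k R (TensorProduct.map u v (Coalgebra.comul c)) := rfl

theorem toConv_mulLeft_comp_mul (a : R) (u v : C →ₗ[k] R) :
    toConv (LinearMap.mulLeft k a ∘ₗ u) * toConv v =
      toConv (LinearMap.mulLeft k a ∘ₗ (toConv u * toConv v).ofConv) := by
  ext c
  rw [toConv_mul_apply, LinearMap.comp_apply, toConv_mul_apply]
  generalize Coalgebra.comul (R := k) c = t
  induction t with
  | zero => simp
  | add s t hs ht => simp only [map_add, hs, ht]
  | tmul x y => simp [mul_assoc]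

theorem mul_toConv_mulRight_comp (a : R) (u v : C →ₗ[k] R) :
    toConv u * toConv (LinearMap.mulRight k a ∘ₗ v) =
      toConv (LinearMap.mulRight k a ∘ₗ (toConv u * toConv v).ofConv) := by
  ext c
  rw [toConv_mul_apply, LinearMap.comp_apply, toConv_mul_apply]
  generalize Coalgebra.comul (R := k) c = t
  induction t with
  | zero => simp
  | add s t hs ht => simp only [map_add, hs, ht]
  | tmul x y => simp [mul_assoc]

/-- The convolution unit takes scalar values, which are central. -/
theorem mulLeft_comp_convOne (a : R) :
    LinearMap.mulLeft k a ∘ₗ (1 : WithConv (C →ₗ[k] R)).ofConv =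
      LinearMap.mulRight k a ∘ₗ (1 : WithConv (C →ₗ[k] R)).ofConv := by
  ext c
  simp [LinearMap.convOne_def, Algebra.commutes]

end

/-- The antipode is an anti-homomorphism of coalgebras. -/
theorem comul_antipode (h : H) :
    Coalgebra.comul (HopfAlgebra.antipode k h) =
      TensorProduct.map (HopfAlgebra.antipode k) (HopfAlgebra.antipode k)
        (TensorProduct.comm k H H (Coalgebra.comul (R := k) h)) := by
  let i₁ : H →ₐ[k] H ⊗[k] H := Algebra.TensorProduct.includeLeft
  let i₂ : H →ₐ[k] H ⊗[k] H := Algebra.TensorProduct.includeRight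
  have e₁ : toConv (Coalgebra.comul (R := k) (A := H)) =
      toConv (i₁.toLinearMap ∘ₗ LinearMap.id) * toConv (i₂.toLinearMap ∘ₗ LinearMap.id) := by
    ext h
    rw [(Coalgebra.Repr.arbitrary k h).convMul_apply]
    simp [i₁, i₂, (Coalgebra.Repr.arbitrary k h).eq]
  have e₂ : toConv (TensorProduct.map (HopfAlgebra.antipode k) (HopfAlgebra.antipode k) ∘ₗ
        (TensorProduct.comm k H H).toLinearMap ∘ₗ Coalgebra.comul (R := k)) =
      toConv (i₂.toLinearMap ∘ₗ HopfAlgebra.antipode k) *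
        toConv (i₁.toLinearMap ∘ₗ HopfAlgebra.antipode k) := by
    ext h
    rw [(Coalgebra.Repr.arbitrary k h).convMul_apply]
    conv_lhs => simp only [ofConv_toConv, LinearMap.comp_apply]
    rw [← (Coalgebra.Repr.arbitrary k h).eq]
    simp [i₁, i₂]
  have e : toConv (TensorProduct.map (HopfAlgebra.antipode k) (HopfAlgebra.antipode k) ∘ₗ
        (TensorProduct.comm k H H).toLinearMap ∘ₗ Coalgebra.comul (R := k)) =
      toConv (Coalgebra.comul (R := k) ∘ₗ HopfAlgebra.antipode k (A := H)) := by
    -- Both sides are convolution inverse to Δ : H → H ⊗ H. Since Δ is the convolution of the two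
    -- inclusions, the flipped S ⊗ S inverts it factor by factor.
    refine left_inv_eq_right_inv (a := toConv (Coalgebra.comul (R := k) (A := H))) ?_
      LinearMap.comul_right_inv
    rw [e₁, e₂, mul_assoc, ← mul_assoc (toConv (i₁.toLinearMap ∘ₗ HopfAlgebra.antipode k)),
      toConv_algHom_comp_mul, LinearMap.antipode_mul_id, toConv_algHom_comp_one, one_mul,
      toConv_algHom_comp_mul, LinearMap.antipode_mul_id, toConv_algHom_comp_one]
  exact (LinearMap.congr_fun (toConv_injective e) h).symm

variable [FiniteDimensional k H]

theorem antipodeInv_mul (a b : H) :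
    antipodeInv k H (a * b) = antipodeInv k H b * antipodeInv k H a := by
  apply (antipode_bijective k H).1
  simp [HopfAlgebra.antipode_mul_antidistrib]

@[simp] theorem antipodeInv_one : antipodeInv k H 1 = 1 := by
  apply (antipode_bijective k H).1
  simp

@[simp] theorem counit_antipodeInv (a : H) :
    Coalgebra.counit (R := k) (antipodeInv k H a) = Coalgebra.counit (R := k) a := by
  rw [← HopfAlgebra.counit_antipode, antipode_antipodeInv]

theorem comul_antipodeInv (h : H) :
    Coalgebra.comul (antipodeInv k H h) =
      TensorProduct.map (antipodeInv k H) (antipodeInv k H)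
        (TensorProduct.comm k H H (Coalgebra.comul (R := k) h)) := by
  obtain ⟨h, rfl⟩ := (antipode_bijective k H).2 h
  rw [antipodeInv_antipode, comul_antipode]
  generalize Coalgebra.comul (R := k) h = t
  induction t with
  | zero => simp
  | add s t hs ht => simpa only [map_add] using congrArg₂ (· + ·) hs ht
  | tmul a b => simp

theorem mul_antipodeInv_comul (h : H) :
    LinearMap.mul' k H (LinearMap.lTensor H (antipodeInv k H)
      (TensorProduct.comm k H H (Coalgebra.comul (R := k) h))) =
      algebraMap k H (Coalgebra.counit h) := by
  rw [← sum_mul_antipodeInv (Coalgebra.Repr.arbitrary k h),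
    ← (Coalgebra.Repr.arbitrary k h).eq]
  simp

theorem antipodeInv_mul_comul (h : H) :
    LinearMap.mul' k H (LinearMap.rTensor H (antipodeInv k H)
      (TensorProduct.comm k H H (Coalgebra.comul (R := k) h))) =
      algebraMap k H (Coalgebra.counit h) := by
  rw [← sum_antipodeInv_mul (Coalgebra.Repr.arbitrary k h),
    ← (Coalgebra.Repr.arbitrary k h).eq]
  simp

end ConvTools

/-! ### Consequences of the axioms of a partially admissible mapping system -/

namespace MappingSystem

namespace IsPAMS

variable {k H B C : Type*} [Field k] [Ring H] [HopfAlgebra k H] [Ring B] [Algebra k B]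
  [AddCommGroup C] [Module k C] [Coalgebra k C] {P : MappingSystem k H B C}

/-- The inclusion `ι` as an algebra map. -/
def ιAlgHom (hP : P.IsPAMS) : B →ₐ[k] H := AlgHom.ofLinearMap P.ι hP.ι_one hP.ι_mul

/-- As ι is colinear, applying ε∘ι to the second leg of the coaction recovers ι. This serves
whenever a map sees the B-leg of a coaction only through its counit. -/
theorem rid_lTensor_counit_coact (hP : P.IsPAMS) (b : B) :
    TensorProduct.rid k H (LinearMap.lTensor H (Coalgebra.counit ∘ₗ P.ι) (P.coact b)) = P.ι b := by
  rw [LinearMap.lTensor_comp_apply, ← hP.ι_coact, Coalgebra.lTensor_counit_comul]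
  simp

/-- Elements of the image of ι are coinvariant; apply ε to the first leg of that equation. -/
theorem π_ι (hP : P.IsPAMS) (b : B) :
    P.π (P.ι b) = Coalgebra.counit (R := k) (P.ι b) • P.π 1 := by
  have h := (hP.mem_range_ι_iff (P.ι b)).1 ⟨b, rfl⟩
  have h' := congrArg (fun t => TensorProduct.lid k C (LinearMap.rTensor C Coalgebra.counit t)) h
  simp only [LinearMap.rTensor_tmul, TensorProduct.lid_tmul] at h'
  rw [← h', ← LinearMap.comp_apply (LinearMap.rTensor C _), LinearMap.rTensor_comp_lTensor,
    ← LinearMap.lTensor_comp_rTensor, LinearMap.comp_apply, Coalgebra.rTensor_counit_comul]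
  simp

theorem comul_π_one (hP : P.IsPAMS) :
    Coalgebra.comul (R := k) (P.π 1) = P.π 1 ⊗ₜ[k] P.π 1 := by
  rw [hP.π_comul, Bialgebra.comul_one]
  rfl

theorem act_π_one (hP : P.IsPAMS) (h : H) : P.act (P.π 1) h = P.π h := by
  rw [← hP.π_mul, one_mul]

/-- Apply ε to the first leg of the colinearity of γ. -/
theorem π_γ (hP : P.IsPAMS) (x : C) : P.π (P.γ x) = x := by
  have h := congrArg (fun t => TensorProduct.lid k C (LinearMap.rTensor C Coalgebra.counit t))
    (hP.γ_coact x)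
  rw [← LinearMap.comp_apply (LinearMap.rTensor C _), LinearMap.rTensor_comp_lTensor,
    ← LinearMap.lTensor_comp_rTensor, LinearMap.comp_apply, Coalgebra.rTensor_counit_comul,
    ← LinearMap.comp_apply (LinearMap.rTensor C _), ← LinearMap.rTensor_comp,
    show (Coalgebra.counit ∘ₗ P.γ : C →ₗ[k] k) = Coalgebra.counit from LinearMap.ext hP.γ_counit,
    Coalgebra.rTensor_counit_comul] at h
  simpa using h

theorem γ_comp_π_mul_γbar_comp_π (hP : P.IsPAMS) :
    toConv (P.γ ∘ₗ P.π) * toConv (P.γbar ∘ₗ P.π) = 1 := by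
  ext h
  have := LinearMap.congr_fun (congrArg ofConv hP.γ_mul_γbar) (P.π h)
  rw [LinearMap.convMul_def, LinearMap.convOne_def] at this ⊢
  simp only [LinearMap.comp_apply, hP.π_comul, hP.π_counit] at this ⊢
  rw [← LinearMap.comp_apply (TensorProduct.map _ _), ← TensorProduct.map_comp] at this
  exact this

/-- In the convolution algebra of End(H), id is inverted by S and γ∘π by γbar∘π; this solves (ι∘ζ) *
(γ∘π) = id for γbar∘π. The next statements solve it for the other factors. -/
theorem γbar_comp_π (hP : P.IsPAMS) :
    toConv (P.γbar ∘ₗ P.π) = toConv (HopfAlgebra.antipode k) * toConv (P.ι ∘ₗ P.ζ) := by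
  have h : toConv (HopfAlgebra.antipode k (A := H)) *
      (toConv (P.ι ∘ₗ P.ζ) * toConv (P.γ ∘ₗ P.π)) * toConv (P.γbar ∘ₗ P.π) =
      toConv (P.γbar ∘ₗ P.π) := by
    rw [hP.conv_eq_id, LinearMap.antipode_mul_id, one_mul]
  rw [← h, mul_assoc, mul_assoc, hP.γ_comp_π_mul_γbar_comp_π, mul_one]

theorem ι_comp_ζ_mul_ι_comp_ζbar (hP : P.IsPAMS) :
    toConv (P.ι ∘ₗ P.ζ) * toConv (P.ι ∘ₗ P.ζbar) = 1 := by
  have := toConv_algHom_comp_mul hP.ιAlgHom P.ζ P.ζbar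
  rw [hP.ζ_mul_ζbar, toConv_algHom_comp_one] at this
  exact this

theorem ι_comp_ζbar_mul_ι_comp_ζ (hP : P.IsPAMS) :
    toConv (P.ι ∘ₗ P.ζbar) * toConv (P.ι ∘ₗ P.ζ) = 1 := by
  have := toConv_algHom_comp_mul hP.ιAlgHom P.ζbar P.ζ
  rw [hP.ζbar_mul_ζ, toConv_algHom_comp_one] at this
  exact this

theorem ι_comp_ζbar (hP : P.IsPAMS) :
    toConv (P.ι ∘ₗ P.ζbar) = toConv (P.γ ∘ₗ P.π) * toConv (HopfAlgebra.antipode k) := by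
  have h : toConv (P.ι ∘ₗ P.ζbar) *
      ((toConv (P.ι ∘ₗ P.ζ) * toConv (P.γ ∘ₗ P.π)) * toConv (HopfAlgebra.antipode k (A := H))) =
      toConv (P.ι ∘ₗ P.ζbar) := by
    rw [hP.conv_eq_id, LinearMap.id_mul_antipode, mul_one]
  rw [← h, ← mul_assoc, ← mul_assoc, hP.ι_comp_ζbar_mul_ι_comp_ζ, one_mul]

theorem ι_comp_ζbar_mul_id (hP : P.IsPAMS) :
    toConv (P.ι ∘ₗ P.ζbar) * toConv LinearMap.id = toConv (P.γ ∘ₗ P.π) := by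
  rw [hP.ι_comp_ζbar, mul_assoc, LinearMap.antipode_mul_id, mul_one]

/-- This inverts the factorization of id, and becomes the factorization axiom for Hᵐᵒᵖ. -/
theorem γbar_comp_π_mul_ι_comp_ζbar (hP : P.IsPAMS) :
    toConv (P.γbar ∘ₗ P.π) * toConv (P.ι ∘ₗ P.ζbar) = toConv (HopfAlgebra.antipode k) := by
  rw [hP.γbar_comp_π, mul_assoc, hP.ι_comp_ζ_mul_ι_comp_ζbar, mul_one]

/-- Composing with the algebra map ε∘ι turns ζ into the convolution unit, hence also its inverse. -/
theorem ζbar_counit (hP : P.IsPAMS) (h : H) :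
    Coalgebra.counit (R := k) (P.ι (P.ζbar h)) = Coalgebra.counit (R := k) h := by
  have e := toConv_algHom_comp_mul ((Bialgebra.counitAlgHom k H).comp hP.ιAlgHom) P.ζ P.ζbar
  rw [hP.ζ_mul_ζbar, toConv_algHom_comp_one] at e
  have e' : toConv (((Bialgebra.counitAlgHom k H).comp hP.ιAlgHom).toLinearMap ∘ₗ P.ζ) = 1 := by
    ext h
    exact hP.ζ_counit h
  rw [e', one_mul] at e
  exact LinearMap.congr_fun (congrArg ofConv e) h

theorem γbar_counit (hP : P.IsPAMS) (x : C) :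
    Coalgebra.counit (R := k) (P.γbar x) = Coalgebra.counit (R := k) x := by
  have e := toConv_algHom_comp_mul (Bialgebra.counitAlgHom k H) P.γ P.γbar
  rw [hP.γ_mul_γbar, toConv_algHom_comp_one] at e
  have e' : toConv ((Bialgebra.counitAlgHom k H).toLinearMap ∘ₗ P.γ) = 1 := by
    ext h
    exact hP.γ_counit h
  rw [e', one_mul] at e
  exact LinearMap.congr_fun (congrArg ofConv e) x

theorem ζbar_one (hP : P.IsPAMS) : P.ζbar 1 = 1 := by
  have := LinearMap.congr_fun (congrArg ofConv hP.ζ_mul_ζbar) 1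
  rw [LinearMap.convMul_def, LinearMap.convOne_def] at this
  simpa [Algebra.TensorProduct.one_def, hP.ζ_one] using this

theorem γbar_one (hP : P.IsPAMS) : P.γbar (P.π 1) = 1 := by
  have := LinearMap.congr_fun (congrArg ofConv hP.γ_mul_γbar) (P.π 1)
  rw [LinearMap.convMul_def, LinearMap.convOne_def] at this
  simpa [hP.comul_π_one, hP.γ_one, hP.π_counit] using this

theorem ζ_ι (hP : P.IsPAMS) (b : B) : P.ζ (P.ι b) = b := by
  simpa [hP.ζ_one] using hP.ζ_act b 1

/-- `∑ ζbar(b₍₁₎ h) b₍₂₎ = ε(b) ζbar(h)`. -/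
theorem ζbar_coact (hP : P.IsPAMS) (b : B) (h : H) :
    LinearMap.mul' k B (TensorProduct.map (P.ζbar ∘ₗ LinearMap.mulRight k h) LinearMap.id
      (P.coact b)) = Coalgebra.counit (R := k) (P.ι b) • P.ζbar h := by
  obtain ⟨s, hs⟩ := TensorProduct.exists_finset (P.coact b)
  -- X is h ↦ ∑ ζbar(b₍₁₎ h) b₍₂₎. Evaluating ζbar * ζ = 1 at ι(b)g and using the B-linearity of ζ
  -- gives X * ζ = ε(b) 1; convolving with ζbar on the right then identifies X.
  let X : H →ₗ[k] B := ∑ p ∈ s, LinearMap.mulRight k p.2 ∘ₗ P.ζbar ∘ₗ LinearMap.mulLeft k p.1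
  have key : toConv X * toConv P.ζ = Coalgebra.counit (R := k) (P.ι b) • 1 := by
    ext g
    have e := LinearMap.congr_fun (congrArg ofConv hP.ζbar_mul_ζ) (P.ι b * g)
    rw [LinearMap.convMul_def, LinearMap.convOne_def] at e
    simp only [LinearMap.comp_apply, Bialgebra.comul_mul, hP.ι_coact, hs] at e
    rw [(Coalgebra.Repr.arbitrary k g).convMul_apply]
    rw [← (Coalgebra.Repr.arbitrary k g).eq] at e
    simp only [map_sum, LinearMap.lTensor_tmul, Finset.sum_mul, Finset.mul_sum,
      Algebra.TensorProduct.tmul_mul_tmul, TensorProduct.map_tmul, LinearMap.mul'_apply,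
      hP.ζ_act] at e
    simp only [X, LinearMap.sum_apply, LinearMap.comp_apply,
      LinearMap.mulRight_apply, LinearMap.mulLeft_apply, Finset.sum_mul, mul_assoc]
    rw [e, ofConv_smul, LinearMap.convOne_def]
    simp [Algebra.algebraMap_eq_smul_one, smul_smul]
  have key' : X = Coalgebra.counit (R := k) (P.ι b) • P.ζbar := by
    have := congrArg (· * toConv P.ζbar) key
    simp only [mul_assoc, hP.ζ_mul_ζbar, mul_one, smul_mul_assoc, one_mul] at this
    exact toConv_injective this
  have := LinearMap.congr_fun key' h
  rw [hs]
  simpa [X] using this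

variable [FiniteDimensional k H]

/-- Apply π to ∑ ι(b₍₂₎) S⁻¹(b₍₁₎) = ε(b) 1. Since π(ι(b₍₂₎)) is a multiple of π(1), the left side
collapses to π(S⁻¹(ι(b))). -/
theorem π_antipodeInv_ι (hP : P.IsPAMS) (b : B) :
    P.π (antipodeInv k H (P.ι b)) = Coalgebra.counit (R := k) (P.ι b) • P.π 1 := by
  have e := congrArg P.π (mul_antipodeInv_comul (k := k) (P.ι b))
  rw [hP.ι_coact] at e
  have key : ∀ t : H ⊗[k] B, P.π (LinearMap.mul' k H (LinearMap.lTensor H (antipodeInv k H)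
      (TensorProduct.comm k H H (LinearMap.lTensor H P.ι t)))) =
      P.π (antipodeInv k H (TensorProduct.rid k H
        (LinearMap.lTensor H (Coalgebra.counit ∘ₗ P.ι) t))) := by
    intro t
    induction t with
    | zero => simp
    | add s t hs ht => simp only [map_add, hs, ht]
    | tmul u v => simp [hP.π_mul, hP.π_ι, hP.act_π_one]
  rw [key, hP.rid_lTensor_counit_coact] at e
  rw [e, Algebra.algebraMap_eq_smul_one, map_smul]

/-- `ζbar ∘ S⁻¹` preserves right `B`-actions. -/
theorem ζbar_antipodeInv_mul (hP : P.IsPAMS) (b : B) (h : H) :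
    P.ζbar (antipodeInv k H (P.ι b) * h) = P.ζbar h * b := by
  -- Consider ∑ ζbar(b₍₂₎ S⁻¹(b₍₁₎) h) b₍₃₎. Contracting the first two legs by the antipode gives
  -- ζbar(h) b; contracting the last two by `ζbar_coact` gives ζbar(S⁻¹(ι(b)) h).
  let L : H ⊗[k] (H ⊗[k] B) →ₗ[k] B := LinearMap.mul' k B ∘ₗ
    TensorProduct.map (P.ζbar ∘ₗ LinearMap.mul' k H ∘ₗ
      LinearMap.lTensor H (LinearMap.mulRight k h ∘ₗ antipodeInv k H) ∘ₗ
      (TensorProduct.comm k H H).toLinearMap) LinearMap.id ∘ₗ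
    (TensorProduct.assoc k H H B).symm.toLinearMap
  have hL : ∀ u a v, L (u ⊗ₜ (a ⊗ₜ v)) = P.ζbar (a * (antipodeInv k H u * h)) * v := by
    intro u a v
    simp [L]
  have e := congrArg L (hP.coact_coassoc b)
  have h1 : ∀ t : H ⊗[k] B, L (TensorProduct.assoc k H H B
      (LinearMap.rTensor B Coalgebra.comul t)) =
      P.ζbar h * TensorProduct.lid k B (LinearMap.rTensor B Coalgebra.counit t) := by
    intro t
    induction t with
    | zero => simp
    | add s t hs ht => simp only [map_add, hs, ht, mul_add]
    | tmul u v =>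
      have e := mul_antipodeInv_comul (k := k) u
      rw [LinearMap.rTensor_tmul]
      have : ∀ s : H ⊗[k] H, L (TensorProduct.assoc k H H B (s ⊗ₜ v)) =
          P.ζbar (LinearMap.mul' k H (LinearMap.lTensor H (antipodeInv k H)
            (TensorProduct.comm k H H s)) * h) * v := by
        intro s
        induction s with
        | zero => simp
        | add s t hs ht => simp only [map_add, TensorProduct.add_tmul, hs, ht, add_mul]
        | tmul a c => simp [hL, mul_assoc]
      rw [this, e]
      simp [Algebra.algebraMap_eq_smul_one]
  have h2 : ∀ t : H ⊗[k] B, L (LinearMap.lTensor H P.coact t) =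
      P.ζbar (antipodeInv k H (TensorProduct.rid k H
        (LinearMap.lTensor H (Coalgebra.counit ∘ₗ P.ι) t)) * h) := by
    intro t
    induction t with
    | zero => simp
    | add s t hs ht => simp only [map_add, hs, ht, add_mul]
    | tmul u v =>
      have e := hP.ζbar_coact v (antipodeInv k H u * h)
      have : ∀ s : H ⊗[k] B, L (u ⊗ₜ s) = LinearMap.mul' k B (TensorProduct.map
          (P.ζbar ∘ₗ LinearMap.mulRight k (antipodeInv k H u * h)) LinearMap.id s) := by
        intro s
        induction s with
        | zero => simp
        | add s t hs ht => simp only [map_add, TensorProduct.tmul_add, hs, ht]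
        | tmul a c => simp [hL, mul_assoc]
      rw [LinearMap.lTensor_tmul, this, e]
      simp
  rw [h1, h2, hP.coact_counit, hP.rid_lTensor_counit_coact] at e
  exact e.symm

/-- `γbar` intertwines the coactions of the coopposite coalgebra. -/
theorem γbar_coact (hP : P.IsPAMS) (x : C) :
    LinearMap.lTensor H (P.π ∘ₗ antipodeInv k H) (Coalgebra.comul (P.γbar x)) =
      LinearMap.rTensor C P.γbar (TensorProduct.comm k C C (Coalgebra.comul x)) := by
  -- K is the coaction defined by π∘S⁻¹. It commutes with right multiplication by ι(b) and sends
  -- S(a) to ∑ S(a₍₂₎) ⊗ π(a₍₁₎).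
  let K : H →ₗ[k] H ⊗[k] C := LinearMap.lTensor H (P.π ∘ₗ antipodeInv k H) ∘ₗ Coalgebra.comul
  have hmul : ∀ h b, K (h * P.ι b) = LinearMap.rTensor C (LinearMap.mulRight k (P.ι b)) (K h) := by
    intro h b
    have : ∀ (s : H ⊗[k] H) (t : H ⊗[k] B),
        LinearMap.lTensor H (P.π ∘ₗ antipodeInv k H) (s * LinearMap.lTensor H P.ι t) =
        LinearMap.rTensor C (LinearMap.mulRight k (TensorProduct.rid k H
          (LinearMap.lTensor H (Coalgebra.counit ∘ₗ P.ι) t)))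
          (LinearMap.lTensor H (P.π ∘ₗ antipodeInv k H) s) := by
      intro s t
      induction s with
      | zero => simp
      | add s s' hs hs' => simp only [add_mul, map_add, hs, hs']
      | tmul p q =>
        induction t with
        | zero => simp
        | add t t' ht ht' =>
          simp only [mul_add, map_add, ht, ht']
          simp [TensorProduct.add_tmul, mul_add]
        | tmul u v =>
          simp [antipodeInv_mul, hP.π_mul, hP.π_antipodeInv_ι, hP.act_π_one,
            TensorProduct.smul_tmul']
    have h2 := this (Coalgebra.comul h) (P.coact b)
    rw [hP.rid_lTensor_counit_coact, ← hP.ι_coact, ← Bialgebra.comul_mul] at h2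
    exact h2
  have hS : ∀ a, K (HopfAlgebra.antipode k a) = TensorProduct.comm k C H
      (TensorProduct.map P.π (HopfAlgebra.antipode k) (Coalgebra.comul a)) := by
    intro a
    simp only [K, LinearMap.comp_apply, comul_antipode]
    generalize Coalgebra.comul (R := k) a = t
    induction t with
    | zero => simp
    | add s t hs ht => simp only [map_add, hs, ht]
    | tmul p q => simp
  -- With γbar∘π = S * (ι∘ζ), both sides at π(g) equal ∑ S(g₍₂₎) ι(ζ(g₍₃₎)) ⊗ π(g₍₁₎).
  let L : H ⊗[k] (H ⊗[k] H) →ₗ[k] H ⊗[k] C := (TensorProduct.comm k C H).toLinearMap ∘ₗ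
    TensorProduct.map P.π (LinearMap.mul' k H ∘ₗ
      TensorProduct.map (HopfAlgebra.antipode k) (P.ι ∘ₗ P.ζ))
  obtain ⟨g, rfl⟩ := hP.π_surjective x
  have hg : ∀ g, P.γbar (P.π g) = LinearMap.mul' k H (TensorProduct.map
      (HopfAlgebra.antipode k) (P.ι ∘ₗ P.ζ) (Coalgebra.comul g)) :=
    fun g => LinearMap.congr_fun (congrArg ofConv hP.γbar_comp_π) g
  change K _ = _
  rw [hg g]
  have h1 : ∀ t : H ⊗[k] H, K (LinearMap.mul' k H (TensorProduct.map
      (HopfAlgebra.antipode k) (P.ι ∘ₗ P.ζ) t)) =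
      L (TensorProduct.assoc k H H H (LinearMap.rTensor H Coalgebra.comul t)) := by
    intro t
    induction t with
    | zero => simp
    | add s t hs ht => simp only [map_add, hs, ht]
    | tmul a c =>
      rw [TensorProduct.map_tmul, LinearMap.mul'_apply, LinearMap.comp_apply P.ι, hmul, hS,
        LinearMap.rTensor_tmul]
      generalize Coalgebra.comul (R := k) a = t
      induction t with
      | zero => simp
      | add s t hs ht => simp only [map_add, TensorProduct.add_tmul, hs, ht]
      | tmul p q => simp [L]
  rw [h1, Coalgebra.coassoc_apply, hP.π_comul]
  generalize Coalgebra.comul (R := k) g = t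
  induction t with
  | zero => simp
  | add s t hs ht => simp only [map_add, hs, ht]
  | tmul a c => simp [L, hg]

/-- Pull back along the surjection π. Since γbar∘π = S * (ι∘ζ) and ζbar∘S⁻¹ is right B-linear, the
first factor becomes (ι∘ζbar)(· h) * (ι∘ζ), so convolving with γ∘π leaves (ι∘ζbar)(· h) * id.
Expanding ι∘ζbar = (γ∘π) * S makes S cancel against id, with S(h₍₂₎) left on the right. The identity
is used to move J past the associator. -/
theorem γ_mul_antipode (hP : P.IsPAMS) {κ : Type*} {h : H} (r : Coalgebra.Repr k h κ) :
    toConv (P.ι ∘ₗ P.ζbar ∘ₗ LinearMap.mulRight k h ∘ₗ antipodeInv k H ∘ₗ P.γbar) *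
        toConv P.γ =
      toConv (∑ i ∈ r.index, LinearMap.mulRight k (HopfAlgebra.antipode k (r.right i)) ∘ₗ
        P.γ ∘ₗ P.act.flip (r.left i)) := by
  have hg : ∀ g, P.γbar (P.π g) = LinearMap.mul' k H (TensorProduct.map
      (HopfAlgebra.antipode k) (P.ι ∘ₗ P.ζ) (Coalgebra.comul g)) :=
    fun g => LinearMap.congr_fun (congrArg ofConv hP.γbar_comp_π) g
  have e₁ : toConv (P.ι ∘ₗ P.ζbar ∘ₗ LinearMap.mulRight k h ∘ₗ antipodeInv k H ∘ₗ
      P.γbar ∘ₗ P.π) = toConv (P.ι ∘ₗ P.ζbar ∘ₗ LinearMap.mulRight k h) *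
        toConv (P.ι ∘ₗ P.ζ) := by
    ext g
    simp only [LinearMap.convMul_def, LinearMap.comp_apply, ofConv_toConv, hg]
    generalize Coalgebra.comul (R := k) g = t
    induction t with
    | zero => simp
    | add s t hs ht => simpa only [map_add] using congrArg₂ (· + ·) hs ht
    | tmul a c => simp [antipodeInv_mul, mul_assoc, hP.ζbar_antipodeInv_mul, hP.ι_mul]
  have e₂ : toConv (P.ι ∘ₗ P.ζbar ∘ₗ LinearMap.mulRight k h) = ∑ i ∈ r.index,
      toConv (P.γ ∘ₗ P.π ∘ₗ LinearMap.mulRight k (r.left i)) *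
        toConv (LinearMap.mulLeft k (HopfAlgebra.antipode k (r.right i)) ∘ₗ
          HopfAlgebra.antipode k) := by
    ext g
    have := LinearMap.congr_fun (congrArg ofConv hP.ι_comp_ζbar) (g * h)
    rw [toConv_mul_apply, Bialgebra.comul_mul, ← r.eq] at this
    simp only [ofConv_sum, LinearMap.sum_apply, toConv_mul_apply, LinearMap.comp_apply,
      LinearMap.mulRight_apply] at this ⊢
    rw [this, Finset.mul_sum, map_sum, map_sum]
    refine Finset.sum_congr rfl fun i _ => ?_
    generalize Coalgebra.comul (R := k) g = t
    induction t with
    | zero => simp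
    | add s t hs ht => simp only [add_mul, map_add, hs, ht]
    | tmul a c => simp [HopfAlgebra.antipode_mul_antidistrib]
  have key : toConv (P.ι ∘ₗ P.ζbar ∘ₗ LinearMap.mulRight k h ∘ₗ antipodeInv k H ∘ₗ
      P.γbar ∘ₗ P.π) * toConv (P.γ ∘ₗ P.π) = toConv (∑ i ∈ r.index,
        LinearMap.mulRight k (HopfAlgebra.antipode k (r.right i)) ∘ₗ
        P.γ ∘ₗ P.π ∘ₗ LinearMap.mulRight k (r.left i)) := by
    rw [e₁, mul_assoc, hP.conv_eq_id, e₂, Finset.sum_mul, toConv_sum]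
    refine Finset.sum_congr rfl fun i _ => ?_
    rw [mul_assoc, toConv_mulLeft_comp_mul, LinearMap.antipode_mul_id, mulLeft_comp_convOne,
      mul_toConv_mulRight_comp, toConv_ofConv, mul_one]
  ext x
  obtain ⟨g, rfl⟩ := hP.π_surjective x
  have := LinearMap.congr_fun (congrArg ofConv key) g
  rw [toConv_mul_apply] at this ⊢
  rw [hP.π_comul, ← LinearMap.comp_apply (TensorProduct.map _ _), ← TensorProduct.map_comp]
  refine this.trans ?_
  simp [hP.π_mul]

end IsPAMS

end MappingSystem

/-! ### The induced system for `Hᵐᵒᵖ` -/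

namespace MappingSystem

section Op

variable {k H B C : Type*} [Field k] [Ring H] [HopfAlgebra k H] [FiniteDimensional k H]
  [Ring B] [Algebra k B] [AddCommGroup C] [Module k C]

theorem op_ι_apply (P : MappingSystem k H B C) (b : B) :
    P.op.ι (MulOpposite.op b) = MulOpposite.op (P.ι b) := rfl

theorem op_coact_apply (P : MappingSystem k H B C) (b : B) :
    P.op.coact (MulOpposite.op b) = TensorProduct.map (MulOpposite.opLinearEquiv k).toLinearMap
      (MulOpposite.opLinearEquiv k).toLinearMap (P.coact b) := rfl

theorem op_π_apply (P : MappingSystem k H B C) (h : H) :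
    P.op.π (MulOpposite.op h) = Cop.of k C (P.π (antipodeInv k H h)) := rfl

theorem op_act_apply (P : MappingSystem k H B C) (x : C) (h : H) :
    P.op.act (Cop.of k C x) (MulOpposite.op h) = Cop.of k C (P.act x (antipodeInv k H h)) := rfl

theorem op_ζ_apply (P : MappingSystem k H B C) (h : H) :
    P.op.ζ (MulOpposite.op h) = MulOpposite.op (P.ζbar (antipodeInv k H h)) := rfl

theorem op_ζbar_apply (P : MappingSystem k H B C) (h : H) :
    P.op.ζbar (MulOpposite.op h) = MulOpposite.op (P.ζ (antipodeInv k H h)) := rfl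

theorem op_γ_apply (P : MappingSystem k H B C) (x : C) :
    P.op.γ (Cop.of k C x) = MulOpposite.op (P.γbar x) := rfl

theorem comul_op {H : Type*} [Ring H] [HopfAlgebra k H] (h : H) : Coalgebra.comul (R := k) (MulOpposite.op h) =
    TensorProduct.map (MulOpposite.opLinearEquiv k).toLinearMap
      (MulOpposite.opLinearEquiv k).toLinearMap (Coalgebra.comul h) := rfl

theorem counit_op {H : Type*} [Ring H] [HopfAlgebra k H] (h : H) : Coalgebra.counit (R := k) (MulOpposite.op h) =
    Coalgebra.counit (R := k) h := rfl

/-- The conjugate of `u : H → R` by the isomorphism `S⁻¹` of coalgebras from `Hᵐᵒᵖ` to `Cop H`. -/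
def opConj {R : Type*} [Ring R] [Algebra k R] (u : H →ₗ[k] R) : Hᵐᵒᵖ →ₗ[k] Rᵐᵒᵖ :=
  (MulOpposite.opLinearEquiv k).toLinearMap ∘ₗ u ∘ₗ antipodeInv k H ∘ₗ
    (MulOpposite.opLinearEquiv k).symm.toLinearMap

/-- S⁻¹ reverses the coproduct and Rᵐᵒᵖ reverses the product, so the net effect is to exchange the
convolution factors. This carries inverses and factorizations over to Hᵐᵒᵖ. -/
theorem toConv_opConj_mul {R : Type*} [Ring R] [Algebra k R] (u v : H →ₗ[k] R) :
    toConv (opConj u) * toConv (opConj v) = toConv (opConj (toConv v * toConv u).ofConv) := by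
  ext h
  induction h using MulOpposite.rec' with | _ h
  rw [toConv_mul_apply, comul_op]
  change _ = MulOpposite.op ((toConv v * toConv u).ofConv (antipodeInv k H h))
  rw [toConv_mul_apply, comul_antipodeInv]
  generalize Coalgebra.comul (R := k) h = t
  induction t with
  | zero => simp
  | add s t hs ht => simp only [map_add, hs, ht, MulOpposite.op_add]
  | tmul x y => simp [opConj]

/-- Here the reversals come from the flipped coproduct of `Cop C` and from the product of Rᵐᵒᵖ. -/
theorem toConv_op_comp_mul [Coalgebra k C] {R : Type*} [Ring R] [Algebra k R] (u v : C →ₗ[k] R) :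
    toConv ((MulOpposite.opLinearEquiv k).toLinearMap ∘ₗ u ∘ₗ (Cop.of k C).symm.toLinearMap) *
      toConv ((MulOpposite.opLinearEquiv k).toLinearMap ∘ₗ v ∘ₗ (Cop.of k C).symm.toLinearMap) =
    toConv ((MulOpposite.opLinearEquiv k).toLinearMap ∘ₗ (toConv v * toConv u).ofConv ∘ₗ
      (Cop.of k C).symm.toLinearMap) := by
  ext x
  obtain ⟨x, rfl⟩ := (Cop.of k C).surjective x
  rw [toConv_mul_apply, Cop.comul_of]
  change _ = MulOpposite.op ((toConv v * toConv u).ofConv x)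
  rw [toConv_mul_apply]
  generalize Coalgebra.comul (R := k) x = t
  induction t with
  | zero => simp
  | add s t hs ht => simp only [map_add, hs, ht, MulOpposite.op_add]
  | tmul x y => simp

theorem opConj_one {R : Type*} [Ring R] [Algebra k R] :
    toConv (opConj (1 : WithConv (H →ₗ[k] R)).ofConv) = 1 := by
  ext h
  induction h using MulOpposite.rec' with | _ h
  simp [opConj, LinearMap.convOne_def, counit_op, MulOpposite.algebraMap_apply]

theorem op_comp_one [Coalgebra k C] {R : Type*} [Ring R] [Algebra k R] :
    toConv ((MulOpposite.opLinearEquiv k).toLinearMap ∘ₗ (1 : WithConv (C →ₗ[k] R)).ofConv ∘ₗ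
      (Cop.of k C).symm.toLinearMap) = 1 := by
  ext x
  obtain ⟨x, rfl⟩ := (Cop.of k C).surjective x
  simp [LinearMap.convOne_def, Cop.counit_of, MulOpposite.algebraMap_apply]

theorem opConj_antipode : opConj (HopfAlgebra.antipode k (A := H)) = LinearMap.id := by
  ext h
  simp [opConj]

end Op

namespace IsPAMS

variable {k H B C : Type*} [Field k] [Ring H] [HopfAlgebra k H] [FiniteDimensional k H]
  [Ring B] [Algebra k B] [AddCommGroup C] [Module k C] [Coalgebra k C]
  {P : MappingSystem k H B C}

theorem lTensor_antipodeInv_π_ι (hP : P.IsPAMS) (b : B) :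
    LinearMap.lTensor H (P.π ∘ₗ antipodeInv k H) (Coalgebra.comul (P.ι b)) =
      P.ι b ⊗ₜ P.π 1 := by
  rw [hP.ι_coact]
  have : ∀ t : H ⊗[k] B, LinearMap.lTensor H (P.π ∘ₗ antipodeInv k H) (LinearMap.lTensor H P.ι t) =
      TensorProduct.rid k H (LinearMap.lTensor H (Coalgebra.counit ∘ₗ P.ι) t) ⊗ₜ P.π 1 := by
    intro t
    induction t with
    | zero => simp
    | add s t hs ht => simp only [map_add, hs, ht, TensorProduct.add_tmul]
    | tmul u v => simp [hP.π_antipodeInv_ι, TensorProduct.smul_tmul']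
  rw [this, hP.rid_lTensor_counit_coact]

/-- The coinvariants of `H` for `π ∘ S⁻¹` are those for `π`. -/
theorem mem_range_ι_iff_antipodeInv (hP : P.IsPAMS) (h : H) :
    h ∈ LinearMap.range P.ι ↔
      LinearMap.lTensor H (P.π ∘ₗ antipodeInv k H) (Coalgebra.comul h) = h ⊗ₜ P.π 1 := by
  constructor
  · rintro ⟨b, rfl⟩
    exact hP.lTensor_antipodeInv_π_ι b
  · intro e
    rw [hP.mem_range_ι_iff]
    -- act on the second leg of `h₍₁₎ ⊗ h₍₂₎ ⊗ π(S⁻¹(h₍₃₎))`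
    let L : H ⊗[k] (H ⊗[k] C) →ₗ[k] H ⊗[k] C := LinearMap.lTensor H
      (TensorProduct.lift P.act ∘ₗ (TensorProduct.comm k H C).toLinearMap)
    have h1 : ∀ t : H ⊗[k] H, L (TensorProduct.assoc k H H C
        (LinearMap.rTensor C Coalgebra.comul
          (LinearMap.lTensor H (P.π ∘ₗ antipodeInv k H) t))) =
        L (LinearMap.lTensor H (LinearMap.lTensor H (P.π ∘ₗ antipodeInv k H))
          (TensorProduct.assoc k H H H (LinearMap.rTensor H Coalgebra.comul t))) := by
      intro t
      induction t with
      | zero => simp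
      | add s t hs ht => simp only [map_add, hs, ht]
      | tmul a c =>
        simp only [LinearMap.lTensor_tmul, LinearMap.rTensor_tmul]
        generalize Coalgebra.comul (R := k) a = t
        induction t with
        | zero => simp
        | add s t hs ht => simp only [map_add, TensorProduct.add_tmul, hs, ht]
        | tmul p q => simp
    have h2 : ∀ t : H ⊗[k] H, L (LinearMap.lTensor H (LinearMap.lTensor H (P.π ∘ₗ antipodeInv k H))
          (LinearMap.lTensor H Coalgebra.comul t)) =
        TensorProduct.rid k H (LinearMap.lTensor H Coalgebra.counit t) ⊗ₜ P.π 1 := by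
      intro t
      induction t with
      | zero => simp
      | add s t hs ht => simp only [map_add, hs, ht, TensorProduct.add_tmul]
      | tmul a c =>
        have e := congrArg P.π (antipodeInv_mul_comul (k := k) c)
        simp only [LinearMap.lTensor_tmul, L]
        have : ∀ s : H ⊗[k] H, (TensorProduct.lift P.act ∘ₗ (TensorProduct.comm k H C).toLinearMap)
            (LinearMap.lTensor H (P.π ∘ₗ antipodeInv k H) s) =
            P.π (LinearMap.mul' k H (LinearMap.rTensor H (antipodeInv k H)
              (TensorProduct.comm k H H s))) := by
          intro s
          induction s with
          | zero => simp
          | add s t hs ht => simp only [map_add, hs, ht]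
          | tmul p q => simp [hP.π_mul]
        rw [this, e]
        simp [Algebra.algebraMap_eq_smul_one, TensorProduct.smul_tmul']
    have h3 := h1 (Coalgebra.comul h)
    rw [Coalgebra.coassoc_apply, h2, e, Coalgebra.lTensor_counit_comul] at h3
    simp only [TensorProduct.rid_tmul, one_smul, LinearMap.rTensor_tmul] at h3
    rw [← h3]
    generalize Coalgebra.comul (R := k) h = t
    induction t with
    | zero => simp
    | add s t hs ht => simp only [map_add, TensorProduct.add_tmul, hs, ht]
    | tmul p q => simp [L, hP.act_π_one]

set_option maxHeartbeats 1000000 in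
set_option synthInstance.maxHeartbeats 200000 in
/-- `(ζbar ∘ S⁻¹, γbar*)` is a partially admissible mapping system for `ι : Bᵐᵒᵖ → Hᵐᵒᵖ`. -/
theorem op (hP : P.IsPAMS) : P.op.IsPAMS where
  coact_coassoc b := by
    induction b using MulOpposite.rec' with | _ b
    rw [op_coact_apply]
    have h1 : ∀ t : H ⊗[k] B, TensorProduct.assoc k Hᵐᵒᵖ Hᵐᵒᵖ Bᵐᵒᵖ
        (LinearMap.rTensor Bᵐᵒᵖ Coalgebra.comul (TensorProduct.map
          (MulOpposite.opLinearEquiv k).toLinearMap (MulOpposite.opLinearEquiv k).toLinearMap t)) =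
        TensorProduct.map (MulOpposite.opLinearEquiv k).toLinearMap (TensorProduct.map
          (MulOpposite.opLinearEquiv k).toLinearMap (MulOpposite.opLinearEquiv k).toLinearMap)
          (TensorProduct.assoc k H H B (LinearMap.rTensor B Coalgebra.comul t)) := by
      intro t
      induction t with
      | zero => simp
      | add s t hs ht => simp only [map_add, hs, ht]
      | tmul a c =>
        simp only [LinearMap.rTensor_tmul, TensorProduct.map_tmul, LinearEquiv.coe_coe,
          MulOpposite.coe_opLinearEquiv, comul_op]
        generalize Coalgebra.comul (R := k) a = t
        induction t with
        | zero => simp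
        | add s t hs ht => simp only [map_add, TensorProduct.add_tmul, hs, ht]
        | tmul p q => simp
    have h2 : ∀ t : H ⊗[k] B, LinearMap.lTensor Hᵐᵒᵖ P.op.coact (TensorProduct.map
          (MulOpposite.opLinearEquiv k).toLinearMap (MulOpposite.opLinearEquiv k).toLinearMap t) =
        TensorProduct.map (MulOpposite.opLinearEquiv k).toLinearMap (TensorProduct.map
          (MulOpposite.opLinearEquiv k).toLinearMap (MulOpposite.opLinearEquiv k).toLinearMap)
          (LinearMap.lTensor H P.coact t) := by
      intro t
      induction t with
      | zero => simp
      | add s t hs ht => simp only [map_add, hs, ht]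
      | tmul a c => simp [op_coact_apply]
    rw [h1, h2, hP.coact_coassoc]
  coact_counit b := by
    induction b using MulOpposite.rec' with | _ b
    rw [op_coact_apply]
    conv_rhs => rw [← hP.coact_counit b]
    generalize P.coact b = t
    induction t with
    | zero => simp
    | add s t hs ht => simp only [map_add, hs, ht, MulOpposite.op_add]
    | tmul a c => simp [counit_op]
  coact_mul b c := by
    induction b using MulOpposite.rec' with | _ b
    induction c using MulOpposite.rec' with | _ c
    rw [← MulOpposite.op_mul, op_coact_apply, op_coact_apply, op_coact_apply, hP.coact_mul]
    generalize P.coact b = s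
    generalize P.coact c = t
    induction s with
    | zero => simp
    | add s s' hs hs' => simp only [mul_add, add_mul, map_add, hs, hs']
    | tmul p q =>
      induction t with
      | zero => simp
      | add t t' ht ht' => simp only [mul_add, add_mul, map_add, ht, ht']
      | tmul u v => simp
  coact_one := by
    rw [← MulOpposite.op_one, op_coact_apply, hP.coact_one]
    simp [Algebra.TensorProduct.one_def]
  ι_injective := MulOpposite.op_injective.comp (hP.ι_injective.comp MulOpposite.unop_injective)
  ι_mul b c := by
    induction b using MulOpposite.rec' with | _ b
    induction c using MulOpposite.rec' with | _ c
    rw [← MulOpposite.op_mul, op_ι_apply, op_ι_apply, op_ι_apply, hP.ι_mul, MulOpposite.op_mul]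
  ι_one := by
    rw [← MulOpposite.op_one, op_ι_apply, hP.ι_one, MulOpposite.op_one]
  ι_coact b := by
    induction b using MulOpposite.rec' with | _ b
    rw [op_ι_apply, op_coact_apply, comul_op, hP.ι_coact]
    generalize P.coact b = t
    induction t with
    | zero => simp
    | add s t hs ht => simp only [map_add, hs, ht]
    | tmul a c => simp [op_ι_apply]
  act_mul x g h := by
    induction g using MulOpposite.rec' with | _ g
    induction h using MulOpposite.rec' with | _ h
    obtain ⟨x, rfl⟩ := (Cop.of k C).surjective x
    rw [← MulOpposite.op_mul, op_act_apply, op_act_apply, op_act_apply, antipodeInv_mul,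
      hP.act_mul]
  act_one x := by
    obtain ⟨x, rfl⟩ := (Cop.of k C).surjective x
    rw [← MulOpposite.op_one, op_act_apply, antipodeInv_one, hP.act_one]
  act_comul x h := by
    induction h using MulOpposite.rec' with | _ h
    obtain ⟨x, rfl⟩ := (Cop.of k C).surjective x
    rw [op_act_apply, Cop.comul_of, Cop.comul_of, hP.act_comul, comul_antipodeInv, comul_op]
    generalize Coalgebra.comul (R := k) h = s
    generalize Coalgebra.comul (R := k) x = t
    induction t with
    | zero => simp
    | add t t' ht ht' => simp only [map_add, LinearMap.add_apply, ht, ht']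
    | tmul p q =>
      induction s with
      | zero => simp
      | add s s' hs hs' => simp only [map_add, hs, hs']
      | tmul u v => simp [TensorProduct.map₂_apply_tmul, op_act_apply]
  act_counit x h := by
    induction h using MulOpposite.rec' with | _ h
    obtain ⟨x, rfl⟩ := (Cop.of k C).surjective x
    rw [op_act_apply, Cop.counit_of, Cop.counit_of, hP.act_counit, counit_op,
      counit_antipodeInv]
  π_surjective := by
    intro x
    obtain ⟨x, rfl⟩ := (Cop.of k C).surjective x
    obtain ⟨h, rfl⟩ := hP.π_surjective x
    exact ⟨MulOpposite.op (HopfAlgebra.antipode k h), by rw [op_π_apply, antipodeInv_antipode]⟩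
  π_mul g h := by
    induction g using MulOpposite.rec' with | _ g
    induction h using MulOpposite.rec' with | _ h
    rw [← MulOpposite.op_mul, op_π_apply, op_π_apply, op_act_apply, antipodeInv_mul, hP.π_mul]
  π_comul h := by
    induction h using MulOpposite.rec' with | _ h
    rw [op_π_apply, Cop.comul_of, hP.π_comul, comul_antipodeInv, comul_op]
    generalize Coalgebra.comul (R := k) h = t
    induction t with
    | zero => simp
    | add s t hs ht => simp only [map_add, hs, ht]
    | tmul u v => simp [op_π_apply]
  π_counit h := by
    induction h using MulOpposite.rec' with | _ h
    rw [op_π_apply, Cop.counit_of, hP.π_counit, counit_op, counit_antipodeInv]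
  mem_range_ι_iff h := by
    induction h using MulOpposite.rec' with | _ h
    have e : MulOpposite.op h ∈ LinearMap.range P.op.ι ↔ h ∈ LinearMap.range P.ι := by
      constructor
      · rintro ⟨b, hb⟩
        exact ⟨b.unop, congrArg MulOpposite.unop hb⟩
      · rintro ⟨b, rfl⟩
        exact ⟨MulOpposite.op b, rfl⟩
    rw [e, hP.mem_range_ι_iff_antipodeInv, comul_op, ← MulOpposite.op_one, op_π_apply,
      antipodeInv_one]
    have e' : ∀ t : H ⊗[k] H, LinearMap.lTensor Hᵐᵒᵖ P.op.π (TensorProduct.map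
        (MulOpposite.opLinearEquiv k).toLinearMap (MulOpposite.opLinearEquiv k).toLinearMap t) =
        TensorProduct.congr (MulOpposite.opLinearEquiv k) (Cop.of k C)
          (LinearMap.lTensor H (P.π ∘ₗ antipodeInv k H) t) := by
      intro t
      induction t with
      | zero => simp
      | add s t hs ht => simp only [map_add, hs, ht]
      | tmul u v => simp [op_π_apply]
    rw [e', show MulOpposite.op h ⊗ₜ[k] Cop.of k C (P.π 1) = TensorProduct.congr
      (MulOpposite.opLinearEquiv k) (Cop.of k C) (h ⊗ₜ P.π 1) by simp,
      (LinearEquiv.injective _).eq_iff]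
  ζ_mul_ζbar := by
    rw [← opConj_one, ← hP.ζ_mul_ζbar]
    exact toConv_opConj_mul P.ζbar P.ζ
  ζbar_mul_ζ := by
    rw [← opConj_one, ← hP.ζbar_mul_ζ]
    exact toConv_opConj_mul P.ζ P.ζbar
  γ_mul_γbar := by
    rw [← op_comp_one, ← hP.γ_mul_γbar]
    exact toConv_op_comp_mul P.γbar P.γ
  γbar_mul_γ := by
    rw [← op_comp_one, ← hP.γbar_mul_γ]
    exact toConv_op_comp_mul P.γ P.γbar
  ζ_act b h := by
    induction b using MulOpposite.rec' with | _ b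
    induction h using MulOpposite.rec' with | _ h
    rw [op_ι_apply, ← MulOpposite.op_mul, op_ζ_apply, op_ζ_apply, antipodeInv_mul,
      hP.ζbar_antipodeInv_mul, MulOpposite.op_mul]
  γ_coact x := by
    obtain ⟨x, rfl⟩ := (Cop.of k C).surjective x
    have e := congrArg (TensorProduct.congr (MulOpposite.opLinearEquiv k) (Cop.of k C))
      (hP.γbar_coact x)
    rw [op_γ_apply, comul_op, Cop.comul_of]
    refine Eq.trans ?_ (e.trans ?_)
    · generalize Coalgebra.comul (R := k) (P.γbar x) = t
      induction t with
      | zero => simp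
      | add s t hs ht => simp only [map_add, hs, ht]
      | tmul u v => simp [op_π_apply]
    · generalize Coalgebra.comul (R := k) x = t
      induction t with
      | zero => simp
      | add s t hs ht => simp only [map_add, hs, ht]
      | tmul u v => simp [op_γ_apply]
  ζ_one := by
    rw [← MulOpposite.op_one, op_ζ_apply, antipodeInv_one, hP.ζbar_one, MulOpposite.op_one]
  ζ_counit h := by
    induction h using MulOpposite.rec' with | _ h
    rw [op_ζ_apply, op_ι_apply, counit_op, counit_op, hP.ζbar_counit, counit_antipodeInv]
  γ_one := by
    rw [← MulOpposite.op_one, op_π_apply, antipodeInv_one, op_γ_apply, hP.γbar_one]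
  γ_counit x := by
    obtain ⟨x, rfl⟩ := (Cop.of k C).surjective x
    rw [op_γ_apply, counit_op, hP.γbar_counit, Cop.counit_of]
  conv_eq_id := by
    -- The identity of Hᵐᵒᵖ is the conjugate of S, and S = (γbar∘π) * (ι∘ζbar); conjugation
    -- exchanges the two factors.
    rw [← opConj_antipode, ← ofConv_toConv (HopfAlgebra.antipode k (A := H)),
      ← hP.γbar_comp_π_mul_ι_comp_ζbar]
    exact toConv_opConj_mul (P.ι ∘ₗ P.ζbar) (P.γbar ∘ₗ P.π)

end IsPAMS

end MappingSystem

/-- A linear equivalence of Hopf algebras preserves all the structure. -/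
structure IsHopfEquiv {k H H' : Type*} [Field k] [Ring H] [HopfAlgebra k H] [Ring H']
    [HopfAlgebra k H'] (e : H ≃ₗ[k] H') : Prop where
  map_mul : ∀ a b, e (a * b) = e a * e b
  map_one : e 1 = 1
  comul_map : ∀ a, Coalgebra.comul (e a) =
    TensorProduct.map e.toLinearMap e.toLinearMap (Coalgebra.comul (R := k) a)
  counit_map : ∀ a, Coalgebra.counit (R := k) (e a) = Coalgebra.counit (R := k) a
  antipode_map : ∀ a, HopfAlgebra.antipode k (e a) = e (HopfAlgebra.antipode k a)

/-! ### Invariance of the partial dual under isomorphisms of H -/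

namespace MappingSystem

variable {k H H' B C : Type*} [Field k] [Ring H] [HopfAlgebra k H] [Ring H'] [HopfAlgebra k H']
  [Ring B] [Algebra k B] [AddCommGroup C] [Module k C]

/-- The mapping system obtained by replacing `H` with an isomorphic Hopf algebra. -/
def transport (P : MappingSystem k H B C) (e : H ≃ₗ[k] H') : MappingSystem k H' B C where
  ι := e.toLinearMap ∘ₗ P.ι
  coact := LinearMap.rTensor B e.toLinearMap ∘ₗ P.coact
  π := P.π ∘ₗ e.symm.toLinearMap
  act := P.act.compl₂ e.symm.toLinearMap
  ζ := P.ζ ∘ₗ e.symm.toLinearMap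
  ζbar := P.ζbar ∘ₗ e.symm.toLinearMap
  γ := e.toLinearMap ∘ₗ P.γ
  γbar := e.toLinearMap ∘ₗ P.γbar

variable [Coalgebra k C] {P : MappingSystem k H B C} {e : H ≃ₗ[k] H'}

theorem toConv_comp_symm_mul {R : Type*} [Ring R] [Algebra k R] (he : IsHopfEquiv e)
    (u v : H →ₗ[k] R) :
    toConv (u ∘ₗ e.symm.toLinearMap) * toConv (v ∘ₗ e.symm.toLinearMap) =
      toConv ((toConv u * toConv v).ofConv ∘ₗ e.symm.toLinearMap) := by
  ext h
  obtain ⟨h, rfl⟩ := e.surjective h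
  rw [toConv_mul_apply, he.comul_map, LinearMap.comp_apply, LinearEquiv.coe_coe,
    e.symm_apply_apply, toConv_mul_apply]
  generalize Coalgebra.comul (R := k) h = t
  induction t with
  | zero => simp
  | add s t hs ht => simp only [map_add, hs, ht]
  | tmul p q => simp

theorem one_comp_symm {R : Type*} [Ring R] [Algebra k R] (he : IsHopfEquiv e) :
    toConv ((1 : WithConv (H →ₗ[k] R)).ofConv ∘ₗ e.symm.toLinearMap) = 1 := by
  ext h
  obtain ⟨h, rfl⟩ := e.surjective h
  simp [LinearMap.convOne_def, he.counit_map]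

/-- The algebra map underlying an isomorphism of Hopf algebras. -/
def hopfEquivAlgHom (he : IsHopfEquiv e) : H →ₐ[k] H' :=
  AlgHom.ofLinearMap e.toLinearMap he.map_one he.map_mul

theorem IsPAMS.transport (hP : P.IsPAMS) (he : IsHopfEquiv e) : (P.transport e).IsPAMS where
  coact_coassoc b := by
    have h1 : ∀ t : H ⊗[k] B, TensorProduct.assoc k H' H' B (LinearMap.rTensor B Coalgebra.comul
        (LinearMap.rTensor B e.toLinearMap t)) =
        TensorProduct.map e.toLinearMap (LinearMap.rTensor B e.toLinearMap)
          (TensorProduct.assoc k H H B (LinearMap.rTensor B Coalgebra.comul t)) := by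
      intro t
      induction t with
      | zero => simp
      | add s t hs ht => simp only [map_add, hs, ht]
      | tmul a c =>
        simp only [LinearMap.rTensor_tmul, LinearEquiv.coe_coe, he.comul_map]
        generalize Coalgebra.comul (R := k) a = t
        induction t with
        | zero => simp
        | add s t hs ht => simp only [map_add, TensorProduct.add_tmul, hs, ht]
        | tmul p q => simp
    have h2 : ∀ t : H ⊗[k] B, LinearMap.lTensor H' (P.transport e).coact
        (LinearMap.rTensor B e.toLinearMap t) =
        TensorProduct.map e.toLinearMap (LinearMap.rTensor B e.toLinearMap)
          (LinearMap.lTensor H P.coact t) := by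
      intro t
      induction t with
      | zero => simp
      | add s t hs ht => simp only [map_add, hs, ht]
      | tmul a c => simp [MappingSystem.transport]
    change TensorProduct.assoc k H' H' B (LinearMap.rTensor B Coalgebra.comul
        (LinearMap.rTensor B e.toLinearMap (P.coact b))) =
        LinearMap.lTensor H' (P.transport e).coact
        (LinearMap.rTensor B e.toLinearMap (P.coact b))
    rw [h1, h2, hP.coact_coassoc]
  coact_counit b := by
    refine Eq.trans ?_ (hP.coact_counit b)
    simp only [MappingSystem.transport, LinearMap.comp_apply]
    generalize P.coact b = t
    induction t with
    | zero => simp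
    | add s t hs ht => simp only [map_add, hs, ht]
    | tmul a c => simp [he.counit_map]
  coact_mul b c := by
    simp only [MappingSystem.transport, LinearMap.comp_apply, hP.coact_mul]
    generalize P.coact b = s
    generalize P.coact c = t
    induction s with
    | zero => simp
    | add s s' hs hs' => simp only [add_mul, map_add, hs, hs']
    | tmul p q =>
      induction t with
      | zero => simp
      | add t t' ht ht' => simp only [mul_add, map_add, ht, ht']
      | tmul u v => simp [he.map_mul]
  coact_one := by
    simp [MappingSystem.transport, hP.coact_one, Algebra.TensorProduct.one_def, he.map_one]
  ι_injective := e.injective.comp hP.ι_injective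
  ι_mul b c := by simp [MappingSystem.transport, hP.ι_mul, he.map_mul]
  ι_one := by simp [MappingSystem.transport, hP.ι_one, he.map_one]
  ι_coact b := by
    simp only [MappingSystem.transport, LinearMap.comp_apply, LinearEquiv.coe_coe, he.comul_map,
      hP.ι_coact]
    generalize P.coact b = t
    induction t with
    | zero => simp
    | add s t hs ht => simp only [map_add, hs, ht]
    | tmul a c => simp
  act_mul x g h := by
    obtain ⟨g, rfl⟩ := e.surjective g
    obtain ⟨h, rfl⟩ := e.surjective h
    simp [MappingSystem.transport, ← he.map_mul, hP.act_mul]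
  act_one x := by simp [MappingSystem.transport, ← he.map_one, hP.act_one]
  act_comul x h := by
    obtain ⟨h, rfl⟩ := e.surjective h
    simp only [MappingSystem.transport, LinearMap.compl₂_apply, LinearEquiv.coe_coe,
      e.symm_apply_apply, hP.act_comul, he.comul_map]
    generalize Coalgebra.comul (R := k) h = s
    generalize Coalgebra.comul (R := k) x = t
    induction t with
    | zero => simp
    | add t t' ht ht' => simp only [map_add, LinearMap.add_apply, ht, ht']
    | tmul p q =>
      induction s with
      | zero => simp
      | add s s' hs hs' => simp only [map_add, hs, hs']
      | tmul u v => simp [TensorProduct.map₂_apply_tmul]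
  act_counit x h := by
    obtain ⟨h, rfl⟩ := e.surjective h
    simp [MappingSystem.transport, hP.act_counit, he.counit_map]
  π_surjective := hP.π_surjective.comp e.symm.surjective
  π_mul g h := by
    obtain ⟨g, rfl⟩ := e.surjective g
    obtain ⟨h, rfl⟩ := e.surjective h
    simp [MappingSystem.transport, ← he.map_mul, hP.π_mul]
  π_comul h := by
    obtain ⟨h, rfl⟩ := e.surjective h
    simp only [MappingSystem.transport, LinearMap.comp_apply, LinearEquiv.coe_coe,
      e.symm_apply_apply, hP.π_comul, he.comul_map]
    generalize Coalgebra.comul (R := k) h = t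
    induction t with
    | zero => simp
    | add s t hs ht => simp only [map_add, hs, ht]
    | tmul u v => simp
  π_counit h := by
    obtain ⟨h, rfl⟩ := e.surjective h
    simp [MappingSystem.transport, hP.π_counit, he.counit_map]
  mem_range_ι_iff h := by
    obtain ⟨h, rfl⟩ := e.surjective h
    have e' : e h ∈ LinearMap.range (P.transport e).ι ↔ h ∈ LinearMap.range P.ι := by
      constructor
      · rintro ⟨b, hb⟩
        exact ⟨b, e.injective hb⟩
      · rintro ⟨b, rfl⟩
        exact ⟨b, rfl⟩
    have h1 : ∀ t : H ⊗[k] H, LinearMap.lTensor H' (P.transport e).π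
        (TensorProduct.map e.toLinearMap e.toLinearMap t) =
        TensorProduct.congr e (LinearEquiv.refl k C) (LinearMap.lTensor H P.π t) := by
      intro t
      induction t with
      | zero => simp
      | add s t hs ht => simp only [map_add, hs, ht]
      | tmul u v => simp [MappingSystem.transport]
    rw [e', hP.mem_range_ι_iff, he.comul_map, h1,
      show e h ⊗ₜ[k] (P.transport e).π 1 = TensorProduct.congr e (LinearEquiv.refl k C)
        (h ⊗ₜ P.π 1) by simp [MappingSystem.transport, ← he.map_one],
      (LinearEquiv.injective _).eq_iff]
  ζ_mul_ζbar := by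
    rw [← one_comp_symm he, ← hP.ζ_mul_ζbar]
    exact toConv_comp_symm_mul he _ _
  ζbar_mul_ζ := by
    rw [← one_comp_symm he, ← hP.ζbar_mul_ζ]
    exact toConv_comp_symm_mul he _ _
  γ_mul_γbar := by
    rw [← toConv_algHom_comp_one (hopfEquivAlgHom he), ← hP.γ_mul_γbar]
    exact toConv_algHom_comp_mul (hopfEquivAlgHom he) _ _
  γbar_mul_γ := by
    rw [← toConv_algHom_comp_one (hopfEquivAlgHom he), ← hP.γbar_mul_γ]
    exact toConv_algHom_comp_mul (hopfEquivAlgHom he) _ _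
  ζ_act b h := by
    obtain ⟨h, rfl⟩ := e.surjective h
    simp [MappingSystem.transport, ← he.map_mul, hP.ζ_act]
  γ_coact x := by
    have h := congrArg (LinearMap.rTensor C e.toLinearMap) (hP.γ_coact x)
    simp only [MappingSystem.transport, LinearMap.comp_apply, LinearEquiv.coe_coe, he.comul_map]
    refine Eq.trans ?_ (h.trans ?_)
    · generalize Coalgebra.comul (R := k) (P.γ x) = t
      induction t with
      | zero => simp
      | add s t hs ht => simp only [map_add, hs, ht]
      | tmul u v => simp
    · rw [LinearMap.rTensor_comp_apply]
  ζ_one := by simp [MappingSystem.transport, ← he.map_one, hP.ζ_one]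
  ζ_counit h := by
    obtain ⟨h, rfl⟩ := e.surjective h
    simp [MappingSystem.transport, he.counit_map, hP.ζ_counit]
  γ_one := by simp [MappingSystem.transport, ← he.map_one, hP.γ_one]
  γ_counit x := by simp [MappingSystem.transport, he.counit_map, hP.γ_counit]
  conv_eq_id := by
    have h1 := toConv_algHom_comp_mul (hopfEquivAlgHom he)
      (P.ι ∘ₗ P.ζ ∘ₗ e.symm.toLinearMap) (P.γ ∘ₗ P.π ∘ₗ e.symm.toLinearMap)
    have h2 := toConv_comp_symm_mul he (P.ι ∘ₗ P.ζ) (P.γ ∘ₗ P.π)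
    rw [hP.conv_eq_id] at h2
    refine h1.trans ?_
    rw [LinearMap.comp_assoc, LinearMap.comp_assoc] at h2
    rw [h2]
    ext h
    simp [hopfEquivAlgHom]

theorem hit_apply (P : MappingSystem k H B C) (h : H) (f : Dual k C) (x : C) :
    P.hit h f x = f (P.act x h) := rfl

theorem hit_transport (h : H) (f : Dual k C) : (P.transport e).hit (e h) f = P.hit h f := by
  ext x
  simp [hit_apply, MappingSystem.transport]

theorem smashMul_tmul (P : MappingSystem k H B C) (f : Dual k C) (b : B) (x : Dual k C ⊗[k] B) :
    P.smashMul (f ⊗ₜ b) x =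
      TensorProduct.map₂ (P.hit.compr₂ (dualMul k C f)) (LinearMap.mul k B) (P.coact b) x := rfl

/-- The coaction moves its H-leg by e, and the action on C undoes this by e⁻¹. -/
theorem smashMul_transport : (P.transport e).smashMul = P.smashMul := by
  refine TensorProduct.ext' fun f b => TensorProduct.ext' fun g c => ?_
  rw [smashMul_tmul, smashMul_tmul]
  change TensorProduct.map₂ _ _ (LinearMap.rTensor B e.toLinearMap (P.coact b)) _ = _
  generalize P.coact b = t
  induction t with
  | zero => simp
  | add s t hs ht => simp only [map_add, LinearMap.add_apply, hs, ht]
  | tmul h d =>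
    simp only [LinearMap.rTensor_tmul, TensorProduct.map₂_apply_tmul, TensorProduct.map_tmul,
      LinearMap.compr₂_apply, LinearEquiv.coe_coe, hit_transport]

theorem dualMul_apply (f g : Dual k C) (x : C) : dualMul k C f g x =
    LinearMap.mul' k k (TensorProduct.map f g (Coalgebra.comul x)) := by
  change TensorProduct.dualDistrib k C C (f ⊗ₜ g) (Coalgebra.comul x) = _
  generalize Coalgebra.comul (R := k) x = t
  induction t with
  | zero => simp
  | add s t hs ht => simp only [map_add, hs, ht]
  | tmul p q => simp

theorem dualMul_comp_symm (he : IsHopfEquiv e) (u w : Dual k H) :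
    dualMul k H' (e.symm.toLinearMap.dualMap u) (e.symm.toLinearMap.dualMap w) =
      e.symm.toLinearMap.dualMap (dualMul k H u w) := by
  ext h
  obtain ⟨h, rfl⟩ := e.surjective h
  simp only [LinearMap.dualMap_apply, LinearEquiv.coe_coe, e.symm_apply_apply, dualMul_apply,
    he.comul_map]
  generalize Coalgebra.comul (R := k) h = t
  induction t with
  | zero => simp
  | add s t hs ht => simp only [map_add, hs, ht]
  | tmul p q => simp

/-- The inverse may be written with any basis of the second factor, so bases transported along an
isomorphism are allowed. -/
theorem dualDistribEquiv_symm_eq_sum (M N : Type*) [AddCommGroup M] [Module k M]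
    [FiniteDimensional k M] [AddCommGroup N] [Module k N] [FiniteDimensional k N]
    {κ : Type*} [Fintype κ] (v : Basis κ k N) (f : Dual k (M ⊗[k] N)) :
    (TensorProduct.dualDistribEquiv k M N).symm f =
      ∑ i, (f ∘ₗ (TensorProduct.mk k M N).flip (v i)) ⊗ₜ v.coord i := by
  rw [LinearEquiv.symm_apply_eq, map_sum]
  refine TensorProduct.ext' fun m n => ?_
  conv_lhs => rw [← v.sum_repr n, TensorProduct.tmul_sum, map_sum]
  simp [TensorProduct.dualDistribEquiv, TensorProduct.dualDistribEquivOfBasis, mul_comm]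

variable [FiniteDimensional k H] [FiniteDimensional k H']

theorem dualComul_eq_sum {κ : Type*} [Fintype κ] (v : Basis κ k H) (f : Dual k H) :
    dualComul k H f = ∑ i, (f ∘ₗ LinearMap.mulRight k (v i)) ⊗ₜ v.coord i := by
  simp only [dualComul, LinearMap.comp_apply, LinearEquiv.coe_coe]
  rw [dualDistribEquiv_symm_eq_sum H H v]
  rfl

theorem dualComul_comp_symm (he : IsHopfEquiv e) (u : Dual k H) :
    dualComul k H' (e.symm.toLinearMap.dualMap u) =
      TensorProduct.map e.symm.toLinearMap.dualMap e.symm.toLinearMap.dualMap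
        (dualComul k H u) := by
  -- Choosing on H' the image of the basis of H makes the two sums agree term by term.
  rw [dualComul_eq_sum ((finBasis k H).map e), dualComul_eq_sum (finBasis k H), map_sum]
  refine Finset.sum_congr rfl fun i _ => ?_
  rw [TensorProduct.map_tmul]
  congr 1
  ext h
  obtain ⟨h, rfl⟩ := e.surjective h
  simp [← he.map_mul]

variable [FiniteDimensional k C]

theorem dualCoact_eq_sum (P : MappingSystem k H B C) {κ : Type*} [Fintype κ] (v : Basis κ k H)
    (f : Dual k C) : P.dualCoact f = ∑ i, P.hit (v i) f ⊗ₜ v.coord i := by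
  simp only [dualCoact, LinearMap.comp_apply, LinearEquiv.coe_coe]
  rw [dualDistribEquiv_symm_eq_sum C H v]
  rfl

theorem dualCoact_transport (f : Dual k C) : (P.transport e).dualCoact f =
    LinearMap.lTensor (Dual k C) e.symm.toLinearMap.dualMap (P.dualCoact f) := by
  rw [dualCoact_eq_sum _ ((finBasis k H).map e), dualCoact_eq_sum _ (finBasis k H), map_sum]
  refine Finset.sum_congr rfl fun i _ => ?_
  rw [LinearMap.lTensor_tmul, Basis.map_apply, hit_transport]
  rfl

variable [FiniteDimensional k B]

theorem comulLeft_transport (he : IsHopfEquiv e) : (P.transport e).comulLeft = P.comulLeft := by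
  ext f
  simp only [comulLeft, LinearMap.sum_apply, LinearMap.comp_apply, dualCoact_transport]
  refine Finset.sum_congr rfl fun i _ => ?_
  generalize P.dualCoact f = t
  induction t with
  | zero => simp
  | add s t hs ht => simp only [map_add, hs, ht]
  | tmul f u =>
    simp only [LinearMap.lTensor_tmul, TensorProduct.map_tmul, LinearMap.comp_apply,
      LinearMap.flip_apply]
    rw [show (P.transport e).ζ.dualMap ((finBasis k B).coord i) =
      e.symm.toLinearMap.dualMap (P.ζ.dualMap ((finBasis k B).coord i)) from rfl,
      dualMul_comp_symm he]
    congr 2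
    ext x
    simp [MappingSystem.transport]

theorem comulRight_transport (he : IsHopfEquiv e) :
    (P.transport e).comulRight = P.comulRight := by
  ext b
  simp only [comulRight, LinearMap.sum_apply, LinearMap.comp_apply]
  refine Finset.sum_congr rfl fun j _ => ?_
  change TensorProduct.map _ _ (LinearMap.rTensor B e.toLinearMap (P.coact b)) = _
  generalize P.coact b = t
  induction t with
  | zero => simp
  | add s t hs ht => simp only [map_add, hs, ht]
  | tmul h d => simp [MappingSystem.transport, ← he.map_mul]

theorem partialDualCounit_transport (he : IsHopfEquiv e) :
    (P.transport e).partialDualCounit = P.partialDualCounit := by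
  refine TensorProduct.ext' fun f b => ?_
  simp [partialDualCounit, MappingSystem.transport, ← he.map_one, he.counit_map]

theorem antipodeInv_map (he : IsHopfEquiv e) (h : H) :
    antipodeInv k H' (e h) = e (antipodeInv k H h) := by
  apply (antipode_bijective k H').1
  rw [antipode_antipodeInv, he.antipode_map, antipode_antipodeInv]

theorem γbarInv_transport (he : IsHopfEquiv e) (u : Dual k H) :
    (P.transport e).γbarInv (e.symm.toLinearMap.dualMap u) = P.γbarInv u := by
  simp only [γbarInv, LinearMap.comp_apply]
  congr 1
  ext x
  simp [MappingSystem.transport, antipodeInv_map he]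

theorem partialDualAssociator_transport (he : IsHopfEquiv e) :
    (P.transport e).partialDualAssociator = P.partialDualAssociator := by
  simp only [partialDualAssociator]
  refine Finset.sum_congr rfl fun i _ => Finset.sum_congr rfl fun j _ => ?_
  congr 1
  have hζ : ∀ i, (P.transport e).ζbar.dualMap ((finBasis k B).coord i) =
      e.symm.toLinearMap.dualMap (P.ζbar.dualMap ((finBasis k B).coord i)) := fun _ => rfl
  rw [hζ i, hζ j, dualComul_comp_symm he, smashMul_transport]
  generalize dualComul k H (P.ζbar.dualMap ((finBasis k B).coord i)) = t
  induction t with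
  | zero => simp
  | add s t hs ht => simp only [map_add, hs, ht]
  | tmul u w =>
    simp only [TensorProduct.map_tmul, LinearMap.comp_apply, γbarInv_transport he,
      dualMul_comp_symm he]

/-- The chosen bases in the structure maps are bases of B and C, which transport leaves alone. H
enters only through its products, its dual and its antipode, and these are matched by e. -/
theorem partialDual_transport (he : IsHopfEquiv e) :
    (P.transport e).partialDual = P.partialDual := by
  ext1
  · exact smashMul_transport
  · rfl
  · simp only [partialDual, partialDualComul, smashMul_transport, comulLeft_transport he,
      comulRight_transport he]
  · exact partialDualCounit_transport he
  · exact partialDualAssociator_transport he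

end MappingSystem

/-! ### Passing from `Hᵐᵒᵖ` to `Cop H` -/

section OpCop

variable {k H B C : Type*} [Field k] [Ring H] [HopfAlgebra k H] [FiniteDimensional k H]
  [Ring B] [Algebra k B] [AddCommGroup C] [Module k C] [Coalgebra k C]

/-- The inverse of the antipode, as an isomorphism of Hopf algebras from `Hᵐᵒᵖ` to `Cop H`. -/
def opEquivCop (k H : Type*) [Field k] [Ring H] [HopfAlgebra k H] [FiniteDimensional k H] :
    Hᵐᵒᵖ ≃ₗ[k] Cop H :=
  (MulOpposite.opLinearEquiv k).symm ≪≫ₗ (LinearEquiv.ofBijective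
    (HopfAlgebra.antipode k : H →ₗ[k] H) (antipode_bijective k H)).symm ≪≫ₗ Cop.of k H

theorem opEquivCop_op (h : H) :
    opEquivCop k H (MulOpposite.op h) = Cop.of k H (antipodeInv k H h) := rfl

theorem antipode_op (h : H) : HopfAlgebra.antipode k (MulOpposite.op h) =
    MulOpposite.op (antipodeInv k H h) := rfl

theorem antipode_cop (h : H) : HopfAlgebra.antipode k (Cop.of k H h) =
    Cop.of k H (antipodeInv k H h) := rfl

theorem isHopfEquiv_opEquivCop : IsHopfEquiv (opEquivCop k H) where
  map_mul a b := by
    induction a using MulOpposite.rec' with | _ a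
    induction b using MulOpposite.rec' with | _ b
    rw [← MulOpposite.op_mul, opEquivCop_op, opEquivCop_op, opEquivCop_op, antipodeInv_mul,
      Cop.of_mul]
  map_one := by
    rw [← MulOpposite.op_one, opEquivCop_op, antipodeInv_one, Cop.of_one]
  comul_map a := by
    induction a using MulOpposite.rec' with | _ a
    rw [opEquivCop_op, Cop.comul_of, comul_antipodeInv, MappingSystem.comul_op]
    generalize Coalgebra.comul (R := k) a = t
    induction t with
    | zero => simp
    | add s t hs ht => simp only [map_add, hs, ht]
    | tmul p q => simp [opEquivCop_op]
  counit_map a := by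
    induction a using MulOpposite.rec' with | _ a
    rw [opEquivCop_op, Cop.counit_of, counit_antipodeInv, MappingSystem.counit_op]
  antipode_map a := by
    induction a using MulOpposite.rec' with | _ a
    rw [opEquivCop_op, antipode_op, antipode_cop, opEquivCop_op]

/-- Composing into H with S⁻¹ and out of H with S cancels the S⁻¹ in π, ζ, ζbar and the action, and
inserts it in ι, the coaction, γ and γbar. The two systems are thus equal, not merely isomorphic. -/
theorem MappingSystem.cop_eq_transport_op (P : MappingSystem k H B C) :
    P.cop = P.op.transport (opEquivCop k H) := by
  have hs : ∀ h : H, (opEquivCop k H).symm (Cop.of k H h) =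
      MulOpposite.op (HopfAlgebra.antipode k h) := by
    intro h
    rw [LinearEquiv.symm_apply_eq, opEquivCop_op, antipodeInv_antipode]
  simp only [MappingSystem.cop, MappingSystem.transport, MappingSystem.mk.injEq]
  refine ⟨rfl, ?_, ?_, ?_, ?_, ?_, rfl, rfl⟩
  · ext b
    induction b using MulOpposite.rec' with | _ b
    simp only [LinearMap.comp_apply, LinearEquiv.coe_coe, MulOpposite.coe_opLinearEquiv_symm,
      MulOpposite.unop_op, MappingSystem.op_coact_apply]
    generalize P.coact b = t
    induction t with
    | zero => simp
    | add s t hs ht => simp only [map_add, hs, ht]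
    | tmul p q => simp [opEquivCop_op]
  · ext h
    obtain ⟨h, rfl⟩ := (Cop.of k H).surjective h
    simp [hs, MappingSystem.op_π_apply]
  · ext x h
    obtain ⟨h, rfl⟩ := (Cop.of k H).surjective h
    obtain ⟨x, rfl⟩ := (Cop.of k C).surjective x
    simp [hs, MappingSystem.op_act_apply]
  · ext h
    obtain ⟨h, rfl⟩ := (Cop.of k H).surjective h
    simp [hs, MappingSystem.op_ζ_apply]
  · ext h
    obtain ⟨h, rfl⟩ := (Cop.of k H).surjective h
    simp [hs, MappingSystem.op_ζbar_apply]

theorem MappingSystem.IsPAMS.cop {P : MappingSystem k H B C} (hP : P.IsPAMS) : P.cop.IsPAMS := by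
  rw [P.cop_eq_transport_op]
  exact hP.op.transport isHopfEquiv_opEquivCop

theorem MappingSystem.partialDual_cop [FiniteDimensional k B] [FiniteDimensional k C]
    (P : MappingSystem k H B C) : P.cop.partialDual = P.op.partialDual := by
  rw [P.cop_eq_transport_op]
  exact MappingSystem.partialDual_transport isHopfEquiv_opEquivCop

end OpCop

/-! ## Twisting a coassociative algebra map -/

namespace CoassocTwist

variable {k E : Type*} [Field k] [Ring E] [Algebra k E]

/-- `D ⊗ id` on `E ⊗ E`. -/
def splitFst (D : E →ₐ[k] E ⊗[k] E) : E ⊗[k] E →ₐ[k] E ⊗[k] (E ⊗[k] E) :=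
  (Algebra.TensorProduct.assoc k k k E E E).toAlgHom.comp
    (Algebra.TensorProduct.map D (AlgHom.id k E))

/-- `id ⊗ D` on `E ⊗ E`. -/
def splitSnd (D : E →ₐ[k] E ⊗[k] E) : E ⊗[k] E →ₐ[k] E ⊗[k] (E ⊗[k] E) :=
  Algebra.TensorProduct.map (AlgHom.id k E) D

/-- `x ↦ 1 ⊗ x` -/
def oneL (k E F : Type*) [Field k] [Ring E] [Algebra k E] [Ring F] [Algebra k F] :
    F →ₐ[k] E ⊗[k] F :=
  Algebra.TensorProduct.includeRight

/-- `x ↦ x ⊗ 1` on `E ⊗ E`. -/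
def oneR (k E : Type*) [Field k] [Ring E] [Algebra k E] : E ⊗[k] E →ₐ[k] E ⊗[k] (E ⊗[k] E) :=
  (Algebra.TensorProduct.assoc k k k E E E).toAlgHom.comp Algebra.TensorProduct.includeLeft

/-- `x ↦ x ⊗ 1` on `E ⊗ E ⊗ E`. -/
def oneR₃ (k E : Type*) [Field k] [Ring E] [Algebra k E] :
    E ⊗[k] (E ⊗[k] E) →ₐ[k] E ⊗[k] (E ⊗[k] (E ⊗[k] E)) :=
  (Algebra.TensorProduct.map (AlgHom.id k E)
      (Algebra.TensorProduct.assoc k k k E E E).toAlgHom).comp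
    ((Algebra.TensorProduct.assoc k k k E (E ⊗[k] E) E).toAlgHom.comp
      Algebra.TensorProduct.includeLeft)

/-- `D ⊗ id ⊗ id` on `E ⊗ E ⊗ E`. -/
def splitFst₃ (D : E →ₐ[k] E ⊗[k] E) :
    E ⊗[k] (E ⊗[k] E) →ₐ[k] E ⊗[k] (E ⊗[k] (E ⊗[k] E)) :=
  (Algebra.TensorProduct.assoc k k k E E (E ⊗[k] E)).toAlgHom.comp
    (Algebra.TensorProduct.map D (AlgHom.id k (E ⊗[k] E)))

/-- `id ⊗ D ⊗ id` on `E ⊗ E ⊗ E`. -/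
def splitSnd₃ (D : E →ₐ[k] E ⊗[k] E) :
    E ⊗[k] (E ⊗[k] E) →ₐ[k] E ⊗[k] (E ⊗[k] (E ⊗[k] E)) :=
  Algebra.TensorProduct.map (AlgHom.id k E) (splitFst D)

/-- `id ⊗ id ⊗ D` on `E ⊗ E ⊗ E`. -/
def splitThd₃ (D : E →ₐ[k] E ⊗[k] E) :
    E ⊗[k] (E ⊗[k] E) →ₐ[k] E ⊗[k] (E ⊗[k] (E ⊗[k] E)) :=
  Algebra.TensorProduct.map (AlgHom.id k E) (splitSnd D)

@[simp] theorem splitFst_tmul (D : E →ₐ[k] E ⊗[k] E) (a b : E) :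
    splitFst D (a ⊗ₜ b) = TensorProduct.assoc k E E E (D a ⊗ₜ b) := rfl

@[simp] theorem splitSnd_tmul (D : E →ₐ[k] E ⊗[k] E) (a b : E) :
    splitSnd D (a ⊗ₜ b) = a ⊗ₜ D b := rfl

@[simp] theorem oneL_apply {F : Type*} [Ring F] [Algebra k F] (x : F) :
    oneL k E F x = 1 ⊗ₜ x := rfl

@[simp] theorem oneR_apply (x : E ⊗[k] E) :
    oneR k E x = TensorProduct.assoc k E E E (x ⊗ₜ 1) := rfl

@[simp] theorem oneR₃_tmul (a : E) (x : E ⊗[k] E) :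
    oneR₃ k E (a ⊗ₜ x) = a ⊗ₜ oneR k E x := rfl

@[simp] theorem splitFst₃_tmul (D : E →ₐ[k] E ⊗[k] E) (a : E) (x : E ⊗[k] E) :
    splitFst₃ D (a ⊗ₜ x) = TensorProduct.assoc k E E (E ⊗[k] E) (D a ⊗ₜ x) := rfl

@[simp] theorem splitSnd₃_tmul (D : E →ₐ[k] E ⊗[k] E) (a : E) (x : E ⊗[k] E) :
    splitSnd₃ D (a ⊗ₜ x) = a ⊗ₜ splitFst D x := rfl

@[simp] theorem splitThd₃_tmul (D : E →ₐ[k] E ⊗[k] E) (a : E) (x : E ⊗[k] E) :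
    splitThd₃ D (a ⊗ₜ x) = a ⊗ₜ splitSnd D x := rfl

/-! ### Compatibilities of the leg maps on tensor powers, and the pentagon -/

section Relations

variable (D : E →ₐ[k] E ⊗[k] E)

theorem splitThd₃_oneL (x : E ⊗[k] E) :
    splitThd₃ D (oneL k E _ x) = oneL k E _ (splitSnd D x) := rfl

theorem splitSnd₃_oneL (x : E ⊗[k] E) :
    splitSnd₃ D (oneL k E _ x) = oneL k E _ (splitFst D x) := rfl

theorem splitThd₃_oneR (x : E ⊗[k] E) :
    splitThd₃ D (oneR k E x) = oneR₃ k E (oneR k E x) := by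
  induction x with
  | zero => simp only [map_zero]
  | add x y hx hy => simp only [map_add, hx, hy]
  | tmul a b => simp [Algebra.TensorProduct.one_def]

theorem splitSnd₃_oneR (x : E ⊗[k] E) :
    splitSnd₃ D (oneR k E x) = oneR₃ k E (splitSnd D x) := by
  induction x with
  | zero => simp only [map_zero]
  | add x y hx hy => simp only [map_add, hx, hy]
  | tmul a b => simp

theorem splitFst₃_oneL (x : E ⊗[k] E) :
    splitFst₃ D (oneL k E _ x) = oneL k E _ (oneL k E _ x) := by
  simp [Algebra.TensorProduct.one_def]

theorem splitFst₃_oneR (x : E ⊗[k] E) :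
    splitFst₃ D (oneR k E x) = oneR₃ k E (splitFst D x) := by
  induction x with
  | zero => simp only [map_zero]
  | add x y hx hy => simp only [map_add, hx, hy]
  | tmul a b =>
    simp only [oneR_apply, TensorProduct.assoc_tmul, splitFst₃_tmul, splitFst_tmul]
    generalize D a = t
    induction t with
    | zero => simp only [map_zero, TensorProduct.zero_tmul]
    | add x y hx hy => simp only [map_add, TensorProduct.add_tmul, hx, hy]
    | tmul c d => simp

theorem splitThd₃_splitFst (x : E ⊗[k] E) :
    splitThd₃ D (splitFst D x) = splitFst₃ D (splitSnd D x) := by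
  induction x with
  | zero => simp only [map_zero]
  | add x y hx hy => simp only [map_add, hx, hy]
  | tmul a b =>
    simp only [splitSnd_tmul, splitFst₃_tmul, splitFst_tmul]
    generalize D a = t
    induction t with
    | zero => simp only [map_zero, TensorProduct.zero_tmul]
    | add x y hx hy => simp only [map_add, TensorProduct.add_tmul, hx, hy]
    | tmul c d => simp

theorem splitThd₃_splitSnd (hD : ∀ a, splitFst D (D a) = splitSnd D (D a)) (x : E ⊗[k] E) :
    splitThd₃ D (splitSnd D x) = splitSnd₃ D (splitSnd D x) := by
  induction x with
  | zero => simp only [map_zero]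
  | add x y hx hy => simp only [map_add, hx, hy]
  | tmul a b => simp only [splitSnd_tmul, splitThd₃_tmul, splitSnd₃_tmul, hD]

theorem splitFst₃_splitFst (hD : ∀ a, splitFst D (D a) = splitSnd D (D a)) (x : E ⊗[k] E) :
    splitFst₃ D (splitFst D x) = splitSnd₃ D (splitFst D x) := by
  induction x with
  | zero => simp only [map_zero]
  | add x y hx hy => simp only [map_add, hx, hy]
  | tmul a b =>
    -- The factor b is a spectator: after a fixed reassociation the two sides are `splitFst D (D a)`
    -- and `splitSnd D (D a)`, each tensored with b.
    have h1 : ∀ t : E ⊗[k] E, splitFst₃ D (TensorProduct.assoc k E E E (t ⊗ₜ b)) =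
        LinearMap.lTensor E (TensorProduct.assoc k E E E).toLinearMap
          (TensorProduct.assoc k E (E ⊗[k] E) E (splitFst D t ⊗ₜ b)) := by
      intro t
      induction t with
      | zero => simp only [map_zero, TensorProduct.zero_tmul]
      | add x y hx hy => simp only [map_add, TensorProduct.add_tmul, hx, hy]
      | tmul c d =>
        simp only [splitFst₃_tmul, splitFst_tmul, TensorProduct.assoc_tmul]
        generalize D c = t
        induction t with
        | zero => simp only [map_zero, TensorProduct.zero_tmul]
        | add x y hx hy => simp only [map_add, TensorProduct.add_tmul, hx, hy]
        | tmul e f => simp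
    have h2 : ∀ t : E ⊗[k] E, splitSnd₃ D (TensorProduct.assoc k E E E (t ⊗ₜ b)) =
        LinearMap.lTensor E (TensorProduct.assoc k E E E).toLinearMap
          (TensorProduct.assoc k E (E ⊗[k] E) E (splitSnd D t ⊗ₜ b)) := by
      intro t
      induction t with
      | zero => simp only [map_zero, TensorProduct.zero_tmul]
      | add x y hx hy => simp only [map_add, TensorProduct.add_tmul, hx, hy]
      | tmul c d => simp
    rw [splitFst_tmul, h1, h2, hD]

theorem oneR₃_oneL (x : E ⊗[k] E) :
    oneR₃ k E (oneL k E _ x) = oneL k E _ (oneR k E x) := rfl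

/-- The two elements live in disjoint pairs of tensor factors. -/
theorem oneR₃_oneR_mul_comm (x y : E ⊗[k] E) :
    oneR₃ k E (oneR k E x) * oneL k E _ (oneL k E _ y) =
      oneL k E _ (oneL k E _ y) * oneR₃ k E (oneR k E x) := by
  have key : ((LinearMap.mulRight k (oneL k E _ (oneL k E _ y))) ∘ₗ
        ((oneR₃ k E).comp (oneR k E)).toLinearMap) =
      ((LinearMap.mulLeft k (oneL k E _ (oneL k E _ y))) ∘ₗ
        ((oneR₃ k E).comp (oneR k E)).toLinearMap) := by
    refine TensorProduct.ext' fun a b => ?_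
    simp only [LinearMap.comp_apply, LinearMap.mulRight_apply, LinearMap.mulLeft_apply,
      AlgHom.toLinearMap_apply, AlgHom.comp_apply, oneR_apply, oneL_apply,
      TensorProduct.assoc_tmul, oneR₃_tmul, Algebra.TensorProduct.tmul_mul_tmul, one_mul,
      mul_one, ← Algebra.TensorProduct.one_def]
  exact LinearMap.congr_fun key x

theorem isUnit_algHom {R S : Type*} [Ring R] [Algebra k R] [Ring S] [Algebra k S]
    (f : R →ₐ[k] S) {x : R} (hx : IsUnit x) : IsUnit (f x) := hx.map f

/-- The pentagon reduced to cancellation in a monoid. Here a, b, c stand for J placed in legs 12,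
23, 34, and X₁, X₂, X₃ are the conjugates by them of φ₁, φ₂, φ₃, the images of φ under D applied to
the first, second and third leg; r₁, r₂, r₃, rL, rR are the five images of the relation defining φ.
Multiplied on the right by the unit a m s, both sides become c q u. The only commutation needed is a
c = c a. -/
theorem pentagon_aux {R : Type*} [Monoid R] {X₁ X₂ X₃ φL φR φ₁ φ₂ φ₃ a b c m n p q s t u : R}
    (ha : IsUnit a) (hm : IsUnit m) (hs : IsUnit s) (hac : a * c = c * a)
    (r₁ : φ₁ * (m * s) = c * t) (r₂ : φ₂ * (n * s) = p * u) (r₃ : φ₃ * (a * t) = q * u)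
    (rL : φL * (b * p) = c * q) (rR : φR * (a * m) = b * n)
    (h₁ : X₁ * a = a * φ₁) (h₂ : X₂ * b = b * φ₂) (h₃ : X₃ * c = c * φ₃) :
    X₃ * X₁ = φL * X₂ * φR := by
  refine ((ha.mul hm).mul hs).mul_left_injective ?_
  calc X₃ * X₁ * (a * m * s) = X₃ * (X₁ * a) * (m * s) := by simp only [mul_assoc]
    _ = X₃ * a * (φ₁ * (m * s)) := by rw [h₁]; simp only [mul_assoc]
    _ = X₃ * (a * c) * t := by rw [r₁]; simp only [mul_assoc]
    _ = X₃ * c * (a * t) := by rw [hac]; simp only [mul_assoc]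
    _ = c * (q * u) := by rw [h₃, mul_assoc, r₃]
    _ = φL * b * (p * u) := by rw [← mul_assoc, ← rL]; simp only [mul_assoc]
    _ = φL * (b * φ₂) * (n * s) := by rw [← r₂]; simp only [mul_assoc]
    _ = φL * X₂ * (b * n) * s := by rw [← h₂]; simp only [mul_assoc]
    _ = φL * X₂ * φR * (a * m * s) := by rw [← rR]; simp only [mul_assoc]

/-- The pentagon identity for the associator of a twist, in `E ⊗ E ⊗ E ⊗ E`. -/
theorem pentagon (hD : ∀ a, splitFst D (D a) = splitSnd D (D a))
    {J J' : E ⊗[k] E} (hJ : J * J' = 1) (hJ' : J' * J = 1)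
    {φ : E ⊗[k] (E ⊗[k] E)}
    (hφ : φ * (oneR k E J * splitFst D J) = oneL k E _ J * splitSnd D J)
    {X₁ X₂ X₃ : E ⊗[k] (E ⊗[k] (E ⊗[k] E))}
    (h₁ : X₁ * oneR₃ k E (oneR k E J) = oneR₃ k E (oneR k E J) * splitFst₃ D φ)
    (h₂ : X₂ * oneL k E _ (oneR k E J) = oneL k E _ (oneR k E J) * splitSnd₃ D φ)
    (h₃ : X₃ * oneL k E _ (oneL k E _ J) = oneL k E _ (oneL k E _ J) * splitThd₃ D φ) :
    X₃ * X₁ = oneL k E _ φ * X₂ * oneR₃ k E φ := by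
  have r₁ := congrArg (splitFst₃ D) hφ
  have r₂ := congrArg (splitSnd₃ D) hφ
  have r₃ := congrArg (splitThd₃ D) hφ
  have rL := congrArg (oneL k E _) hφ
  have rR := congrArg (oneR₃ k E) hφ
  rw [map_mul, map_mul, map_mul] at r₁ r₂ r₃ rL rR
  rw [splitFst₃_oneR, splitFst₃_oneL, ← splitThd₃_splitFst] at r₁
  rw [splitSnd₃_oneR, splitSnd₃_oneL, ← splitFst₃_splitFst D hD] at r₂
  rw [splitThd₃_oneR, splitThd₃_oneL, splitThd₃_splitSnd D hD] at r₃
  rw [oneR₃_oneL] at rR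
  have hu : IsUnit J := ⟨⟨J, J', hJ, hJ'⟩, rfl⟩
  exact pentagon_aux (isUnit_algHom _ (isUnit_algHom _ hu)) (isUnit_algHom _ (isUnit_algHom _ hu))
    (isUnit_algHom _ (isUnit_algHom _ hu)) (oneR₃_oneR_mul_comm J J) r₁ r₂ r₃ rL rR h₁ h₂ h₃

end Relations

end CoassocTwist

theorem TensorProduct.map_injective_of_field {k M N M' N' : Type*} [Field k] [AddCommGroup M]
    [Module k M] [AddCommGroup N] [Module k N] [AddCommGroup M'] [Module k M'] [AddCommGroup N']
    [Module k N'] {f : M →ₗ[k] M'} {g : N →ₗ[k] N'} (hf : Function.Injective f)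
    (hg : Function.Injective g) : Function.Injective (TensorProduct.map f g) :=
  TensorProduct.map_injective_of_flat_flat f g hf hg

/-! ### Quasi-bialgebra axioms for data realized as a twist -/

namespace CoassocTwist

variable {k V E : Type*} [Field k] [Ring E] [Algebra k E] [AddCommGroup V] [Module k V]
  (Q : QuasiBialgebraData k V)

/-- A realization of quasi-bialgebra data inside an algebra `E`, in such a way that the
comultiplication is the twist by `J` of a coassociative algebra map `D`, and the associator is the
corresponding coboundary. -/
structure Realization (E : Type*) [Ring E] [Algebra k E] where
  /-- the embedding -/
  j : V →ₗ[k] E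
  /-- the untwisted comultiplication -/
  D : E →ₐ[k] E ⊗[k] E
  /-- the twist -/
  J : E ⊗[k] E
  /-- the inverse of the twist -/
  Jinv : E ⊗[k] E
  injective : Function.Injective j
  j_mul : ∀ x y, j (Q.mul x y) = j x * j y
  j_one : j Q.one = 1
  coassoc : ∀ a, splitFst D (D a) = splitSnd D (D a)
  mul_inv : J * Jinv = 1
  inv_mul : Jinv * J = 1
  map_comul : ∀ v, TensorProduct.map j j (Q.comul v) * J = J * D (j v)
  map_associator : TensorProduct.map j (TensorProduct.map j j) Q.associator *
    (oneR k E J * splitFst D J) = oneL k E _ J * splitSnd D J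

namespace Realization

variable {Q}

/-- The embedding of `V ⊗ V`. -/
def j₂ (r : Realization Q E) : V ⊗[k] V →ₗ[k] E ⊗[k] E := TensorProduct.map r.j r.j

/-- The embedding of `V ⊗ V ⊗ V`. -/
def j₃ (r : Realization Q E) : V ⊗[k] (V ⊗[k] V) →ₗ[k] E ⊗[k] (E ⊗[k] E) := TensorProduct.map r.j r.j₂

/-- The embedding of `V ⊗ V ⊗ V ⊗ V`. -/
def j₄ (r : Realization Q E) : V ⊗[k] (V ⊗[k] (V ⊗[k] V)) →ₗ[k] E ⊗[k] (E ⊗[k] (E ⊗[k] E)) :=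
  TensorProduct.map r.j r.j₃

@[simp] theorem j₂_tmul (r : Realization Q E) (x y : V) : r.j₂ (x ⊗ₜ y) = r.j x ⊗ₜ r.j y := rfl
@[simp] theorem j₃_tmul (r : Realization Q E) (x : V) (y : V ⊗[k] V) : r.j₃ (x ⊗ₜ y) = r.j x ⊗ₜ r.j₂ y := rfl
@[simp] theorem j₄_tmul (r : Realization Q E) (x : V) (y : V ⊗[k] (V ⊗[k] V)) : r.j₄ (x ⊗ₜ y) = r.j x ⊗ₜ r.j₃ y := rfl

theorem j₂_injective (r : Realization Q E) : Function.Injective r.j₂ :=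
  TensorProduct.map_injective_of_field r.injective r.injective

theorem j₃_injective (r : Realization Q E) : Function.Injective r.j₃ :=
  TensorProduct.map_injective_of_field r.injective r.j₂_injective

theorem j₄_injective (r : Realization Q E) : Function.Injective r.j₄ :=
  TensorProduct.map_injective_of_field r.injective r.j₃_injective

theorem mul_eq_one_of_units {M : Type*} [Monoid M] (u : Mˣ) {y : M} (h : u * y = 1) :
    y * u = 1 := by
  have h' : y = ↑u⁻¹ := Units.eq_inv_of_mul_eq_one_left h
  rw [h', Units.inv_mul]

/-- Additivity reduces an intertwining relation to pure tensors. F and G are plain functions, so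
that composites of several maps can be inserted as they are. -/
theorem mul_eq_mul_of_tmul {M N R : Type*} [AddCommGroup M] [Module k M] [AddCommGroup N]
    [Module k N] [Ring R] {F G : M ⊗[k] N → R} {a b : R} (hF₀ : F 0 = 0) (hG₀ : G 0 = 0)
    (hF : ∀ x y, F (x + y) = F x + F y) (hG : ∀ x y, G (x + y) = G x + G y)
    (h : ∀ m n, F (m ⊗ₜ n) * a = b * G (m ⊗ₜ n)) (x : M ⊗[k] N) : F x * a = b * G x := by
  induction x with
  | zero => rw [hF₀, hG₀, zero_mul, mul_zero]
  | add x y hx hy => rw [hF, hG, add_mul, mul_add, hx, hy]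
  | tmul m n => exact h m n

theorem map_map₂ {M N R S : Type*} [AddCommMonoid M] [Module k M] [AddCommMonoid N] [Module k N]
    [Ring R] [Algebra k R] [Ring S] [Algebra k S] {m : M →ₗ[k] M →ₗ[k] M} {n : N →ₗ[k] N →ₗ[k] N}
    {f : M →ₗ[k] R} {g : N →ₗ[k] S} (hf : ∀ x y, f (m x y) = f x * f y)
    (hg : ∀ x y, g (n x y) = g x * g y) (x y : M ⊗[k] N) :
    TensorProduct.map f g (TensorProduct.map₂ m n x y) =
      TensorProduct.map f g x * TensorProduct.map f g y := by
  induction x with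
  | zero => simp
  | add x x' hx hx' => simp only [map_add, LinearMap.add_apply, add_mul, hx, hx']
  | tmul a b =>
    induction y with
    | zero => simp
    | add y y' hy hy' => simp only [map_add, mul_add, hy, hy']
    | tmul c d => simp [TensorProduct.map₂_apply_tmul, hf, hg]

theorem j₂_mul (r : Realization Q E) (x y : V ⊗[k] V) : r.j₂ (Q.mul₂ x y) = r.j₂ x * r.j₂ y :=
  map_map₂ r.j_mul r.j_mul x y

theorem j₃_mul (r : Realization Q E) (x y : V ⊗[k] (V ⊗[k] V)) : r.j₃ (Q.mul₃ x y) = r.j₃ x * r.j₃ y :=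
  map_map₂ r.j_mul r.j₂_mul x y

theorem j₄_mul (r : Realization Q E) (x y : V ⊗[k] (V ⊗[k] (V ⊗[k] V))) : r.j₄ (Q.mul₄ x y) = r.j₄ x * r.j₄ y :=
  map_map₂ r.j_mul r.j₃_mul x y

theorem j₃_one (r : Realization Q E) : r.j₃ Q.one₃ = 1 := by
  simp [QuasiBialgebraData.one₃, r.j_one, Algebra.TensorProduct.one_def]

theorem j₂_comul (r : Realization Q E) (v : V) : r.j₂ (Q.comul v) * r.J = r.J * r.D (r.j v) := r.map_comul v

theorem j₃_associator (r : Realization Q E) : r.j₃ Q.associator * (oneR k E r.J * splitFst r.D r.J) =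
    oneL k E _ r.J * splitSnd r.D r.J := r.map_associator

theorem isUnit_J (r : Realization Q E) : IsUnit r.J := ⟨⟨r.J, r.Jinv, r.mul_inv, r.inv_mul⟩, rfl⟩

theorem j₃_assoc_tmul (r : Realization Q E) (x : V ⊗[k] V) (v : V) :
    r.j₃ (TensorProduct.assoc k V V V (x ⊗ₜ v)) =
      TensorProduct.assoc k E E E (r.j₂ x ⊗ₜ r.j v) := by
  induction x with
  | zero => simp only [map_zero, TensorProduct.zero_tmul]
  | add x y hx hy => simp only [map_add, TensorProduct.add_tmul, hx, hy]
  | tmul a b => rfl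

theorem assoc_mul {R S T : Type*} [Ring R] [Algebra k R] [Ring S] [Algebra k S] [Ring T]
    [Algebra k T] (x y : (R ⊗[k] S) ⊗[k] T) :
    TensorProduct.assoc k R S T (x * y) =
      TensorProduct.assoc k R S T x * TensorProduct.assoc k R S T y :=
  map_mul (Algebra.TensorProduct.assoc k k k R S T) x y

theorem j₃_lTensor_comul (r : Realization Q E) (x : V ⊗[k] V) :
    r.j₃ (LinearMap.lTensor V Q.comul x) * oneL k E _ r.J =
      oneL k E _ r.J * splitSnd r.D (r.j₂ x) := by
  induction x with
  | zero => simp only [map_zero, zero_mul, mul_zero]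
  | add x y hx hy => simp only [map_add, add_mul, mul_add, hx, hy]
  | tmul a b =>
    simp only [LinearMap.lTensor_tmul, j₃_tmul, oneL_apply, j₂_tmul, splitSnd_tmul,
      Algebra.TensorProduct.tmul_mul_tmul, mul_one, one_mul, j₂_comul]

theorem j₃_rTensor_comul (r : Realization Q E) (x : V ⊗[k] V) :
    r.j₃ (TensorProduct.assoc k V V V (LinearMap.rTensor V Q.comul x)) * oneR k E r.J =
      oneR k E r.J * splitFst r.D (r.j₂ x) := by
  induction x with
  | zero => simp only [map_zero, zero_mul, mul_zero]
  | add x y hx hy => simp only [map_add, add_mul, mul_add, hx, hy]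
  | tmul a b =>
    simp only [LinearMap.rTensor_tmul, j₃_assoc_tmul, oneR_apply, j₂_tmul, splitFst_tmul,
      ← assoc_mul, Algebra.TensorProduct.tmul_mul_tmul, mul_one, one_mul, j₂_comul]

/-- The associator is a quotient of products of images of the unit J. -/
theorem isUnit_j₃_associator (r : Realization Q E) : IsUnit (r.j₃ Q.associator) := by
  have h1 : IsUnit (oneR k E r.J * splitFst r.D r.J) :=
    (isUnit_algHom _ r.isUnit_J).mul (isUnit_algHom _ r.isUnit_J)
  have h2 : IsUnit (oneL k E _ r.J * splitSnd r.D r.J) :=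
    (isUnit_algHom _ r.isUnit_J).mul (isUnit_algHom _ r.isUnit_J)
  obtain ⟨u, hu⟩ := h1
  obtain ⟨w, hw⟩ := h2
  have := r.j₃_associator
  rw [← hu, ← hw] at this
  rw [← Units.eq_mul_inv_iff_mul_eq] at this
  rw [this]
  exact w.isUnit.mul u⁻¹.isUnit

/-- The inverse found in E ⊗ E ⊗ E need not a priori come from V ⊗ V ⊗ V. But multiplication by the
associator is injective on the latter, hence surjective by finite dimension, so the unit is
attained. -/
theorem exists_isAssociatorInverse (r : Realization Q E) [FiniteDimensional k V] :
    ∃ y, Q.IsAssociatorInverse y := by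
  obtain ⟨u, hu⟩ := r.isUnit_j₃_associator
  have hinj : Function.Injective (Q.mul₃ Q.associator) := by
    intro x y h
    have h' := congrArg r.j₃ h
    rw [j₃_mul, j₃_mul, ← hu, Units.mul_right_inj] at h'
    exact r.j₃_injective h'
  obtain ⟨y, hy⟩ := LinearMap.injective_iff_surjective.1 hinj Q.one₃
  have h1 := congrArg r.j₃ hy
  rw [j₃_mul, j₃_one, ← hu] at h1
  refine ⟨y, hy, r.j₃_injective ?_⟩
  rw [j₃_mul, j₃_one, ← hu]
  exact mul_eq_one_of_units u h1

/-- Multiply on the right by (J ⊗ 1)(D ⊗ id)(J) and move J to the left past each Δ. What remains is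
D iterated on either leg, and these agree by coassociativity. -/
theorem quasi_coassoc (r : Realization Q E) (x : V) :
    Q.mul₃ (LinearMap.lTensor V Q.comul (Q.comul x)) Q.associator =
      Q.mul₃ Q.associator
        (TensorProduct.assoc k V V V (LinearMap.rTensor V Q.comul (Q.comul x))) := by
  apply r.j₃_injective
  rw [j₃_mul, j₃_mul]
  have hu : IsUnit (oneR k E r.J * splitFst r.D r.J) :=
    (isUnit_algHom _ r.isUnit_J).mul (isUnit_algHom _ r.isUnit_J)
  refine hu.mul_left_injective ?_
  simp only
  rw [mul_assoc, j₃_associator, ← mul_assoc, j₃_lTensor_comul, mul_assoc, ← map_mul, j₂_comul,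
    mul_assoc, ← mul_assoc _ (oneR k E r.J), j₃_rTensor_comul, mul_assoc, ← map_mul, j₂_comul,
    map_mul, map_mul, r.coassoc, ← mul_assoc, ← j₃_associator]
  simp only [mul_assoc]

theorem j₄_comul_fst (r : Realization Q E) (x : V ⊗[k] (V ⊗[k] V)) :
    r.j₄ (TensorProduct.assoc k V V (V ⊗[k] V) (LinearMap.rTensor (V ⊗[k] V) Q.comul x)) *
      oneR₃ k E (oneR k E r.J) = oneR₃ k E (oneR k E r.J) * splitFst₃ r.D (r.j₃ x) := by
  have e : oneR₃ k E (oneR k E r.J) = TensorProduct.assoc k E E (E ⊗[k] E) (r.J ⊗ₜ 1) := by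
    generalize r.J = t
    induction t with
    | zero => simp only [map_zero, TensorProduct.zero_tmul]
    | add x y hx hy => simp only [map_add, TensorProduct.add_tmul, hx, hy]
    | tmul a b => simp [Algebra.TensorProduct.one_def]
  have e' : ∀ (s : V ⊗[k] V) (b : V ⊗[k] V), r.j₄ (TensorProduct.assoc k V V (V ⊗[k] V)
      (s ⊗ₜ b)) = TensorProduct.assoc k E E (E ⊗[k] E) (r.j₂ s ⊗ₜ r.j₂ b) := by
    intro s b
    induction s with
    | zero => simp only [map_zero, TensorProduct.zero_tmul]
    | add x y hx hy => simp only [map_add, TensorProduct.add_tmul, hx, hy]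
    | tmul a c => rfl
  rw [e]
  refine mul_eq_mul_of_tmul (F := fun x => r.j₄ (TensorProduct.assoc k V V (V ⊗[k] V)
    (LinearMap.rTensor (V ⊗[k] V) Q.comul x)))
    (G := fun x => splitFst₃ r.D (r.j₃ x)) (by simp only [map_zero]) (by simp only [map_zero])
    (fun _ _ => by simp only [map_add]) (fun _ _ => by simp only [map_add]) (fun a b => ?_) x
  simp only [LinearMap.rTensor_tmul, e', j₃_tmul, splitFst₃_tmul,
    ← assoc_mul, Algebra.TensorProduct.tmul_mul_tmul, mul_one, one_mul, j₂_comul]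

theorem j₄_comul_snd (r : Realization Q E) (x : V ⊗[k] (V ⊗[k] V)) :
    r.j₄ (LinearMap.lTensor V ((TensorProduct.assoc k V V V).toLinearMap ∘ₗ
      LinearMap.rTensor V Q.comul) x) * oneL k E _ (oneR k E r.J) =
      oneL k E _ (oneR k E r.J) * splitSnd₃ r.D (r.j₃ x) := by
  refine mul_eq_mul_of_tmul (F := fun x => r.j₄ (LinearMap.lTensor V ((TensorProduct.assoc k V V V).toLinearMap ∘ₗ
    LinearMap.rTensor V Q.comul) x))
    (G := fun x => splitSnd₃ r.D (r.j₃ x)) (by simp only [map_zero]) (by simp only [map_zero])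
    (fun _ _ => by simp only [map_add]) (fun _ _ => by simp only [map_add]) (fun a b => ?_) x
  simp only [LinearMap.comp_apply, LinearEquiv.coe_coe,
    LinearMap.lTensor_tmul, j₄_tmul,
    j₃_tmul, splitSnd₃_tmul, oneL_apply, Algebra.TensorProduct.tmul_mul_tmul, mul_one, one_mul,
    j₃_rTensor_comul]

theorem j₄_comul_thd (r : Realization Q E) (x : V ⊗[k] (V ⊗[k] V)) :
    r.j₄ (LinearMap.lTensor V (LinearMap.lTensor V Q.comul) x) * oneL k E _ (oneL k E _ r.J) =
      oneL k E _ (oneL k E _ r.J) * splitThd₃ r.D (r.j₃ x) := by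
  refine mul_eq_mul_of_tmul (F := fun x => r.j₄ (LinearMap.lTensor V (LinearMap.lTensor V Q.comul) x))
    (G := fun x => splitThd₃ r.D (r.j₃ x)) (by simp only [map_zero]) (by simp only [map_zero])
    (fun _ _ => by simp only [map_add]) (fun _ _ => by simp only [map_add]) (fun a b => ?_) x
  have := r.j₃_lTensor_comul b
  rw [oneL_apply] at this
  simp only [LinearMap.lTensor_tmul, j₄_tmul,
    j₃_tmul, splitThd₃_tmul, oneL_apply, Algebra.TensorProduct.tmul_mul_tmul, mul_one, one_mul,
    this]

theorem j₄_one_tmul (r : Realization Q E) (x : V ⊗[k] (V ⊗[k] V)) : r.j₄ (Q.one ⊗ₜ x) = oneL k E _ (r.j₃ x) := by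
  rw [j₄_tmul, r.j_one]
  rfl

theorem j₄_tmul_one (r : Realization Q E) (x : V ⊗[k] (V ⊗[k] V)) :
    r.j₄ (LinearMap.lTensor V (TensorProduct.assoc k V V V).toLinearMap
      (TensorProduct.assoc k V (V ⊗[k] V) V (x ⊗ₜ Q.one))) = oneR₃ k E (r.j₃ x) := by
  induction x with
  | zero => simp only [map_zero, TensorProduct.zero_tmul]
  | add x y hx hy => simp only [map_add, TensorProduct.add_tmul, hx, hy]
  | tmul a b => simp [j₃_assoc_tmul, r.j_one]

theorem pentagon (r : Realization Q E) :
    Q.mul₄ (LinearMap.lTensor V (LinearMap.lTensor V Q.comul) Q.associator)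
        (TensorProduct.assoc k V V (V ⊗[k] V)
          (LinearMap.rTensor (V ⊗[k] V) Q.comul Q.associator)) =
      Q.mul₄
        (Q.mul₄ (Q.one ⊗ₜ Q.associator)
          (LinearMap.lTensor V ((TensorProduct.assoc k V V V).toLinearMap ∘ₗ
            LinearMap.rTensor V Q.comul) Q.associator))
        (LinearMap.lTensor V (TensorProduct.assoc k V V V).toLinearMap
          (TensorProduct.assoc k V (V ⊗[k] V) V (Q.associator ⊗ₜ Q.one))) := by
  apply r.j₄_injective
  rw [j₄_mul, j₄_mul, j₄_mul, j₄_one_tmul, j₄_tmul_one]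
  exact CoassocTwist.pentagon r.D r.coassoc r.mul_inv r.inv_mul r.j₃_associator
    (r.j₄_comul_fst _) (r.j₄_comul_snd _) (r.j₄_comul_thd _)

/-- Δ is conjugate by J to the algebra map D; cancel the unit J. -/
theorem comul_mul (r : Realization Q E) (x y : V) : Q.comul (Q.mul x y) = Q.mul₂ (Q.comul x) (Q.comul y) := by
  apply r.j₂_injective
  refine r.isUnit_J.mul_left_injective ?_
  simp only
  rw [j₂_mul, j₂_comul, mul_assoc, j₂_comul, ← mul_assoc, j₂_comul, r.j_mul, map_mul, mul_assoc]

theorem comul_one (r : Realization Q E) : Q.comul Q.one = Q.one ⊗ₜ Q.one := by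
  apply r.j₂_injective
  refine r.isUnit_J.mul_left_injective ?_
  simp only
  rw [j₂_comul, j₂_tmul, r.j_one, map_one, mul_one, ← Algebra.TensorProduct.one_def, one_mul]

/-- Quasi-bialgebra data with a realization and a compatible counit form a quasi-bialgebra. -/
theorem isQuasiBialgebra (r : Realization Q E) [FiniteDimensional k V]
    (counit_mul : ∀ x y, Q.counit (Q.mul x y) = Q.counit x * Q.counit y)
    (counit_one : Q.counit Q.one = 1)
    (counit_comul : ∀ x, TensorProduct.lid k V (LinearMap.rTensor V Q.counit (Q.comul x)) = x)
    (comul_counit : ∀ x, TensorProduct.rid k V (LinearMap.lTensor V Q.counit (Q.comul x)) = x)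
    (associator_counit : LinearMap.lTensor V ((TensorProduct.lid k V).toLinearMap ∘ₗ
      LinearMap.rTensor V Q.counit) Q.associator = Q.one ⊗ₜ Q.one) : Q.IsQuasiBialgebra where
  mul_assoc x y z := r.injective (by simp only [r.j_mul, mul_assoc])
  one_mul x := r.injective (by rw [r.j_mul, r.j_one, one_mul])
  mul_one x := r.injective (by rw [r.j_mul, r.j_one, mul_one])
  comul_mul := r.comul_mul
  comul_one := r.comul_one
  counit_mul := counit_mul
  counit_one := counit_one
  counit_comul := counit_comul
  comul_counit := comul_counit
  associator_invertible := r.exists_isAssociatorInverse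
  quasi_coassoc := r.quasi_coassoc
  pentagon := r.pentagon
  associator_counit := associator_counit

end Realization

end CoassocTwist

/-! ## The smash product `C* # H` -/

namespace MappingSystem

variable {k H B C : Type*} [Field k] [Ring H] [HopfAlgebra k H] [Ring B] [Algebra k B]
  [AddCommGroup C] [Module k C] [Coalgebra k C]

/-- The universal property of a smash product: maps on C* and on B that satisfy the exchange
relation multiply together to a multiplicative map. It asks only for linear maps and no units, and
serves for the representation of C* # H, for the maps out of it, for the embedding of C* # B and for
the counit. -/
theorem smash_lift_mul (P : MappingSystem k H B C) {R : Type*} [Ring R] [Algebra k R]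
    (α : Dual k C →ₗ[k] R) (β : B →ₗ[k] R) (hα : ∀ f g, α (dualMul k C f g) = α f * α g)
    (hβ : ∀ b c, β (b * c) = β b * β c)
    (hβα : ∀ b g, β b * α g = LinearMap.mul' k R (TensorProduct.map (α ∘ₗ P.hit.flip g) β (P.coact b)))
    (x y : Dual k C ⊗[k] B) :
    LinearMap.mul' k R (TensorProduct.map α β (P.smashMul x y)) =
      LinearMap.mul' k R (TensorProduct.map α β x) * LinearMap.mul' k R (TensorProduct.map α β y) := by
  induction x with
  | zero => simp
  | add x x' hx hx' => simp only [map_add, LinearMap.add_apply, add_mul, hx, hx']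
  | tmul f b =>
    induction y with
    | zero => simp
    | add y y' hy hy' => simp only [map_add, mul_add, hy, hy']
    | tmul g c =>
      have key : ∀ t : H ⊗[k] B, LinearMap.mul' k R (TensorProduct.map α β
          (TensorProduct.map₂ (P.hit.compr₂ (dualMul k C f)) (LinearMap.mul k B) t (g ⊗ₜ c))) =
          α f * LinearMap.mul' k R (TensorProduct.map (α ∘ₗ P.hit.flip g) β t) * β c := by
        intro t
        induction t with
        | zero => simp
        | add t t' ht ht' => simp only [map_add, LinearMap.add_apply, add_mul, mul_add, ht, ht']
        | tmul h d => simp [TensorProduct.map₂_apply_tmul, hα, hβ, mul_assoc]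
      rw [smashMul_tmul, key, ← hβα]
      simp [mul_assoc]

/-- The mapping system underlying `C* # H`. -/
def total (P : MappingSystem k H B C) : MappingSystem k H H C where
  ι := LinearMap.id
  coact := Coalgebra.comul
  π := P.π
  act := P.act
  -- Only the coaction and the action enter the smash product; these two entries are placeholders
  -- and are not claimed to be convolution inverse.
  ζ := LinearMap.id
  ζbar := LinearMap.id
  γ := P.γ
  γbar := P.γbar

namespace IsPAMS

variable {P : MappingSystem k H B C}

theorem hit_one (hP : P.IsPAMS) (f : Dual k C) : P.hit 1 f = f := by
  ext x; simp [hit_apply, hP.act_one]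

theorem hit_mul (hP : P.IsPAMS) (g h : H) (f : Dual k C) :
    P.hit (g * h) f = P.hit g (P.hit h f) := by
  ext x; simp [hit_apply, hP.act_mul]

theorem hit_counit (hP : P.IsPAMS) (h : H) : P.hit h (Coalgebra.counit (R := k) (A := C)) =
    Coalgebra.counit (R := k) h • Coalgebra.counit (R := k) (A := C) := by
  ext x; simp [hit_apply, hP.act_counit, mul_comm]

end IsPAMS

theorem dualMul_counit (f : Dual k C) : dualMul k C f Coalgebra.counit = f := by
  ext x
  rw [dualMul_apply]
  have := congrArg (fun t => f (TensorProduct.rid k C t)) (Coalgebra.lTensor_counit_comul x)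
  simp only [TensorProduct.rid_tmul, one_smul] at this
  rw [← this]
  generalize Coalgebra.comul (R := k) x = t
  induction t with
  | zero => simp
  | add x y hx hy => simp only [map_add, hx, hy]
  | tmul a b => simp [mul_comm]

theorem counit_dualMul (f : Dual k C) : dualMul k C Coalgebra.counit f = f := by
  ext x
  rw [dualMul_apply]
  have := congrArg (fun t => f (TensorProduct.lid k C t)) (Coalgebra.rTensor_counit_comul x)
  simp only [TensorProduct.lid_tmul, one_smul] at this
  rw [← this]
  generalize Coalgebra.comul (R := k) x = t
  induction t with
  | zero => simp
  | add x y hx hy => simp only [map_add, hx, hy]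
  | tmul a b => simp

/-- The right action of `C*` on `C ⊗ H`: `(x ⊗ g) · f = ∑ ⟨f, x₍₁₎⟩ x₍₂₎ ⊗ g`. -/
def reprDual (k H C : Type*) [Field k] [Ring H] [HopfAlgebra k H]
    [AddCommGroup C] [Module k C] [Coalgebra k C] :
    Dual k C →ₗ[k] (Module.End k (C ⊗[k] H))ᵐᵒᵖ :=
  (MulOpposite.opLinearEquiv k).toLinearMap ∘ₗ LinearMap.rTensorHom H ∘ₗ
    (LinearMap.lcomp k C (Coalgebra.comul (R := k) (A := C))) ∘ₗ
      (LinearMap.compRight k (TensorProduct.lid k C).toLinearMap) ∘ₗ LinearMap.rTensorHom C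

/-- The right action of `H` on `C ⊗ H`: `(x ⊗ g) · h = ∑ x ◁ h₍₁₎ ⊗ g h₍₂₎`. -/
def reprRing (P : MappingSystem k H B C) : H →ₗ[k] (Module.End k (C ⊗[k] H))ᵐᵒᵖ :=
  (MulOpposite.opLinearEquiv k).toLinearMap ∘ₗ
    (TensorProduct.map₂ P.act (LinearMap.mul k H)).flip ∘ₗ Coalgebra.comul

theorem reprDual_tmul (f : Dual k C) (x : C) (g : H) :
    (reprDual k H C f).unop (x ⊗ₜ g) =
      TensorProduct.lid k C (LinearMap.rTensor C f (Coalgebra.comul x)) ⊗ₜ g := rfl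

theorem reprRing_tmul (P : MappingSystem k H B C) (h : H) (x : C) (g : H) :
    (P.reprRing h).unop (x ⊗ₜ g) =
      TensorProduct.map (P.act x) (LinearMap.mulLeft k g) (Coalgebra.comul h) := rfl

theorem reprDual_mul (f g : Dual k C) :
    reprDual k H C (dualMul k C f g) = reprDual k H C f * reprDual k H C g := by
  apply MulOpposite.unop_injective
  refine TensorProduct.ext' fun x a => ?_
  rw [MulOpposite.unop_mul, Module.End.mul_apply, reprDual_tmul, reprDual_tmul, reprDual_tmul]
  congr 1
  let F : C ⊗[k] (C ⊗[k] C) →ₗ[k] C := (TensorProduct.lid k C).toLinearMap ∘ₗ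
    TensorProduct.map f ((TensorProduct.lid k C).toLinearMap ∘ₗ LinearMap.rTensor C g)
  have h1 : ∀ t : C ⊗[k] C, TensorProduct.lid k C (LinearMap.rTensor C (dualMul k C f g) t) =
      F (TensorProduct.assoc k C C C (LinearMap.rTensor C Coalgebra.comul t)) := by
    intro t
    induction t with
    | zero => simp
    | add s t hs ht => simp only [map_add, hs, ht]
    | tmul p q =>
      simp only [LinearMap.rTensor_tmul, TensorProduct.lid_tmul, dualMul_apply]
      generalize Coalgebra.comul (R := k) p = r
      induction r with
      | zero => simp
      | add s t hs ht => simp only [map_add, add_smul, TensorProduct.add_tmul, hs, ht]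
      | tmul c d =>
        simp only [F, TensorProduct.map_tmul, LinearMap.mul'_apply, mul_smul,
          TensorProduct.assoc_tmul, LinearMap.comp_apply, LinearMap.rTensor_tmul,
          LinearEquiv.coe_coe, TensorProduct.lid_tmul]
  have h2 : ∀ t : C ⊗[k] C, TensorProduct.lid k C (LinearMap.rTensor C g
      (Coalgebra.comul (TensorProduct.lid k C (LinearMap.rTensor C f t)))) =
      F (LinearMap.lTensor C Coalgebra.comul t) := by
    intro t
    induction t with
    | zero => simp
    | add s t hs ht => simp only [map_add, hs, ht]
    | tmul p q => simp [F]
  rw [h1, h2, Coalgebra.coassoc_apply]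

theorem IsPAMS.reprRing_mul {P : MappingSystem k H B C} (hP : P.IsPAMS) (g h : H) :
    P.reprRing (g * h) = P.reprRing g * P.reprRing h := by
  apply MulOpposite.unop_injective
  refine TensorProduct.ext' fun x a => ?_
  rw [MulOpposite.unop_mul, Module.End.mul_apply, reprRing_tmul, reprRing_tmul, Bialgebra.comul_mul]
  generalize Coalgebra.comul (R := k) g = t
  induction t with
  | zero => simp
  | add s t hs ht => simp only [map_add, add_mul, hs, ht]
  | tmul p q =>
    rw [TensorProduct.map_tmul, reprRing_tmul]
    generalize Coalgebra.comul (R := k) h = t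
    induction t with
    | zero => simp
    | add s t hs ht => simp only [map_add, mul_add, hs, ht]
    | tmul c d => simp [hP.act_mul]

/-- The exchange relation of the smash product, for operators, is the compatibility of the coproduct
of C with the action of H. -/
theorem IsPAMS.reprRing_mul_reprDual {P : MappingSystem k H B C} (hP : P.IsPAMS) (h : H)
    (g : Dual k C) : P.reprRing h * reprDual k H C g =
      LinearMap.mul' k _ (TensorProduct.map (reprDual k H C ∘ₗ P.hit.flip g) P.reprRing
        (Coalgebra.comul h)) := by
  apply MulOpposite.unop_injective
  refine TensorProduct.ext' fun x a => ?_
  rw [MulOpposite.unop_mul, Module.End.mul_apply, reprRing_tmul]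
  let r := Coalgebra.Repr.arbitrary k x
  -- Both operators send x ⊗ a to ∑ ⟨g, x₍₁₎ ◁ h₍₁₎⟩ x₍₂₎ ◁ h₍₂₎ ⊗ a h₍₃₎, the coproduct of h being
  -- iterated on one leg or the other.
  let F : H ⊗[k] (H ⊗[k] H) →ₗ[k] C ⊗[k] H := ∑ i ∈ r.index,
    (TensorProduct.lid k (C ⊗[k] H)).toLinearMap ∘ₗ TensorProduct.map (g ∘ₗ P.act (r.left i))
      (TensorProduct.map (P.act (r.right i)) (LinearMap.mulLeft k a))
  have h1 : ∀ t : H ⊗[k] H, (reprDual k H C g).unop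
      (TensorProduct.map (P.act x) (LinearMap.mulLeft k a) t) =
      F (TensorProduct.assoc k H H H (LinearMap.rTensor H Coalgebra.comul t)) := by
    intro t
    induction t with
    | zero => simp
    | add s t hs ht => simp only [map_add, hs, ht]
    | tmul p q =>
      rw [TensorProduct.map_tmul, reprDual_tmul, hP.act_comul, ← r.eq, LinearMap.rTensor_tmul]
      generalize Coalgebra.comul (R := k) p = t
      induction t with
      | zero => simp
      | add s t hs ht => simp only [map_add, TensorProduct.add_tmul, hs, ht]
      | tmul c d =>
        simp [F, map_sum, LinearMap.sum_apply, TensorProduct.map₂_apply_tmul,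
          TensorProduct.sum_tmul, TensorProduct.smul_tmul']
  have h2 : ∀ t : H ⊗[k] H, (LinearMap.mul' k _ (TensorProduct.map
      (reprDual k H C ∘ₗ P.hit.flip g) P.reprRing t)).unop (x ⊗ₜ a) =
      F (LinearMap.lTensor H Coalgebra.comul t) := by
    intro t
    induction t with
    | zero => simp
    | add s t hs ht => simp only [map_add, MulOpposite.unop_add, LinearMap.add_apply, hs, ht]
    | tmul p q =>
      rw [TensorProduct.map_tmul, LinearMap.mul'_apply, MulOpposite.unop_mul,
        Module.End.mul_apply, LinearMap.comp_apply, reprDual_tmul, ← r.eq]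
      simp [F, map_sum, LinearMap.sum_apply, TensorProduct.sum_tmul, hit_apply,
        ← TensorProduct.smul_tmul', reprRing_tmul]
  rw [h1, h2, Coalgebra.coassoc_apply]

/-- The action of `C* # H` on `C ⊗ H`. -/
def reprSmash (P : MappingSystem k H B C) :
    Dual k C ⊗[k] H →ₗ[k] (Module.End k (C ⊗[k] H))ᵐᵒᵖ :=
  LinearMap.mul' k _ ∘ₗ TensorProduct.map (reprDual k H C) P.reprRing

theorem IsPAMS.reprSmash_mul {P : MappingSystem k H B C} (hP : P.IsPAMS)
    (x y : Dual k C ⊗[k] H) :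
    P.reprSmash (P.total.smashMul x y) = P.reprSmash x * P.reprSmash y :=
  smash_lift_mul P.total (reprDual k H C) P.reprRing reprDual_mul hP.reprRing_mul
    hP.reprRing_mul_reprDual x y

/-- Acting on x ⊗ 1 and applying ε to the C-leg sends f # h to ⟨f, x⟩ h, and an element of C* ⊗ H is
determined by these values because C is finite-dimensional. -/
theorem IsPAMS.reprSmash_injective [FiniteDimensional k C] {P : MappingSystem k H B C}
    (hP : P.IsPAMS) : Function.Injective P.reprSmash := by
  have key : ∀ (t : Dual k C ⊗[k] H) (x : C), TensorProduct.lid k H (LinearMap.rTensor H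
      (Coalgebra.counit (R := k) (A := C)) ((P.reprSmash t).unop (x ⊗ₜ 1))) =
      dualTensorHom k C H t x := by
    intro t x
    induction t with
    | zero => simp
    | add s t hs ht => simp only [map_add, MulOpposite.unop_add, LinearMap.add_apply, hs, ht]
    | tmul f h =>
      simp only [reprSmash, LinearMap.comp_apply, TensorProduct.map_tmul, LinearMap.mul'_apply,
        MulOpposite.unop_mul, Module.End.mul_apply, reprDual_tmul, reprRing_tmul,
        dualTensorHom_apply]
      have h1 : ∀ y : C, TensorProduct.lid k H (LinearMap.rTensor H
          (Coalgebra.counit (R := k) (A := C)) (TensorProduct.map (P.act y)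
            (LinearMap.mulLeft k 1) (Coalgebra.comul h))) = Coalgebra.counit (R := k) y • h := by
        intro y
        have hc := congrArg (TensorProduct.lid k H) (Coalgebra.rTensor_counit_comul (R := k) h)
        rw [TensorProduct.lid_tmul, one_smul] at hc
        conv_rhs => rw [← hc]
        generalize Coalgebra.comul (R := k) h = t
        induction t with
        | zero => simp
        | add s t hs ht => simp only [map_add, smul_add, hs, ht]
        | tmul p q => simp [hP.act_counit, mul_smul]
      rw [h1]
      congr 1
      have hc := congrArg (fun t => f (TensorProduct.rid k C t))
        (Coalgebra.lTensor_counit_comul (R := k) x)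
      simp only [TensorProduct.rid_tmul, one_smul] at hc
      rw [← hc]
      generalize Coalgebra.comul (R := k) x = t
      induction t with
      | zero => simp
      | add s t hs ht => simp only [map_add, hs, ht]
      | tmul p q => simp [mul_comm]
  intro s t hst
  apply (dualTensorHomEquiv k C H).injective
  ext x
  change dualTensorHom k C H s x = dualTensorHom k C H t x
  rw [← key, ← key, hst]

/-! ### The algebra structure of C* # H -/

section TotalMul

variable {P : MappingSystem k H B C}

theorem total_smashMul_tmul (P : MappingSystem k H B C) (f : Dual k C) (h : H)
    (x : Dual k C ⊗[k] H) : P.total.smashMul (f ⊗ₜ h) x =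
      TensorProduct.map₂ (P.hit.compr₂ (dualMul k C f)) (LinearMap.mul k H)
        (Coalgebra.comul h) x := rfl

theorem IsPAMS.total_mul_dual (hP : P.IsPAMS) (f : Dual k C) (x : Dual k C ⊗[k] H) :
    P.total.smashMul (f ⊗ₜ 1) x = LinearMap.rTensor H (dualMul k C f) x := by
  rw [total_smashMul_tmul, Bialgebra.comul_one, Algebra.TensorProduct.one_def]
  induction x with
  | zero => simp only [map_zero]
  | add x y hx hy => simp only [map_add, hx, hy]
  | tmul g h => simp [TensorProduct.map₂_apply_tmul, hP.hit_one]

theorem IsPAMS.total_mul_ring (hP : P.IsPAMS) (h : H) (x : Dual k C ⊗[k] H) (g : H)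
    (hx : x = Coalgebra.counit ⊗ₜ g) :
    P.total.smashMul (Coalgebra.counit ⊗ₜ h) x = Coalgebra.counit ⊗ₜ (h * g) := by
  subst hx
  rw [total_smashMul_tmul]
  have hc := congrArg (TensorProduct.lid k H) (Coalgebra.rTensor_counit_comul (R := k) h)
  rw [TensorProduct.lid_tmul, one_smul] at hc
  conv_rhs => rw [← hc]
  generalize Coalgebra.comul (R := k) h = t
  induction t with
  | zero => simp
  | add s t hs ht =>
    simp only [map_add, LinearMap.add_apply, add_mul, TensorProduct.tmul_add, hs, ht]
  | tmul p q =>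
    simp [TensorProduct.map₂_apply_tmul, hP.hit_counit, dualMul_counit, TensorProduct.smul_tmul]

theorem IsPAMS.total_ring_mul_dual (_ : P.IsPAMS) (h : H) (g : Dual k C) :
    P.total.smashMul (Coalgebra.counit ⊗ₜ h) (g ⊗ₜ 1) =
      LinearMap.rTensor H (P.hit.flip g) (Coalgebra.comul h) := by
  rw [total_smashMul_tmul]
  generalize Coalgebra.comul (R := k) h = t
  induction t with
  | zero => simp only [map_zero, LinearMap.zero_apply]
  | add s t hs ht => simp only [map_add, LinearMap.add_apply, hs, ht]
  | tmul p q =>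
    rw [TensorProduct.map₂_apply_tmul, TensorProduct.map_tmul, LinearMap.compr₂_apply,
      counit_dualMul, LinearMap.mul_apply', mul_one]
    rfl

theorem IsPAMS.total_mul_one (hP : P.IsPAMS) (x : Dual k C ⊗[k] H) :
    P.total.smashMul x (Coalgebra.counit ⊗ₜ 1) = x := by
  induction x with
  | zero => simp only [map_zero, LinearMap.zero_apply]
  | add x y hx hy => simp only [map_add, LinearMap.add_apply, hx, hy]
  | tmul f h =>
    rw [total_smashMul_tmul]
    have hc := congrArg (TensorProduct.lid k H) (Coalgebra.rTensor_counit_comul (R := k) h)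
    rw [TensorProduct.lid_tmul, one_smul] at hc
    conv_rhs => rw [← hc]
    generalize Coalgebra.comul (R := k) h = t
    induction t with
    | zero => simp
    | add s t hs ht =>
      simp only [map_add, LinearMap.add_apply, TensorProduct.tmul_add, hs, ht]
    | tmul p q =>
      simp [TensorProduct.map₂_apply_tmul, hP.hit_counit, dualMul_counit, TensorProduct.smul_tmul]

/-- Associativity is inherited from endomorphisms through the faithful representation. -/
theorem IsPAMS.total_mul_assoc [FiniteDimensional k C] (hP : P.IsPAMS)
    (x y z : Dual k C ⊗[k] H) :
    P.total.smashMul (P.total.smashMul x y) z = P.total.smashMul x (P.total.smashMul y z) :=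
  hP.reprSmash_injective (by simp only [hP.reprSmash_mul, mul_assoc])

end TotalMul

/-- The smash product algebra `C* # H`. -/
def Smash (P : MappingSystem k H B C) (_ : P.IsPAMS) : Type _ := Dual k C ⊗[k] H

namespace Smash

variable {P : MappingSystem k H B C} (hP : P.IsPAMS)

section Instances

/-- The additive group underlying `C* # H`. -/
@[reducible] def addCommGroup : AddCommGroup (Smash P hP) :=
  inferInstanceAs (AddCommGroup (Dual k C ⊗[k] H))

attribute [local instance] addCommGroup

/-- The vector space underlying `C* # H`. -/
@[reducible] def module : Module k (Smash P hP) := inferInstanceAs (Module k (Dual k C ⊗[k] H))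

attribute [local instance] module

/-- The product of `C* # H`. -/
def mulHom : Smash P hP →ₗ[k] Smash P hP →ₗ[k] Smash P hP := P.total.smashMul

variable [FiniteDimensional k C]

instance : Ring (Smash P hP) where
  __ := addCommGroup hP
  mul x y := mulHom hP x y
  one := (Coalgebra.counit ⊗ₜ 1 : Dual k C ⊗[k] H)
  zero_mul x := LinearMap.map_zero₂ (mulHom hP) x
  mul_zero x := map_zero (mulHom hP x)
  left_distrib x y z := map_add (mulHom hP x) y z
  right_distrib x y z := LinearMap.map_add₂ (mulHom hP) x y z
  mul_assoc x y z := hP.total_mul_assoc x y z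
  one_mul x := by
    refine (hP.total_mul_dual Coalgebra.counit x).trans ?_
    have e : dualMul k C Coalgebra.counit = LinearMap.id := by
      ext1 f; exact counit_dualMul f
    rw [e, LinearMap.rTensor_id]
    rfl
  mul_one x := hP.total_mul_one x

instance : Algebra k (Smash P hP) := Algebra.ofModule
  (fun r x y => LinearMap.map_smul₂ (mulHom hP) r x y) (fun r x y => map_smul (mulHom hP x) r y)

end Instances

variable [FiniteDimensional k C]

/-- The space underlying `C* # H`. -/
def of : Dual k C ⊗[k] H ≃ₗ[k] Smash P hP :=
  { LinearEquiv.refl k (Dual k C ⊗[k] H) with }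

theorem one_def : (1 : Smash P hP) = of hP (Coalgebra.counit ⊗ₜ 1) := rfl

/-- `f ↦ f # 1` -/
def inl : Dual k C →ₗ[k] Smash P hP :=
  (of hP).toLinearMap ∘ₗ (TensorProduct.mk k (Dual k C) H).flip 1

/-- `h ↦ ε # h` -/
def inr : H →ₐ[k] Smash P hP :=
  AlgHom.ofLinearMap ((of hP).toLinearMap ∘ₗ TensorProduct.mk k (Dual k C) H Coalgebra.counit) rfl
    (fun g h => congrArg (of hP) (hP.total_mul_ring g _ h rfl).symm)

theorem inl_mul_inr (f : Dual k C) (h : H) : inl hP f * inr hP h = of hP (f ⊗ₜ h) := by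
  refine congrArg (of hP) ((hP.total_mul_dual f (Coalgebra.counit ⊗ₜ h)).trans ?_)
  rw [LinearMap.rTensor_tmul, dualMul_counit]

theorem inl_mul (f g : Dual k C) : inl hP (dualMul k C f g) = inl hP f * inl hP g :=
  (congrArg (of hP) (hP.total_mul_dual f (g ⊗ₜ 1))).symm

theorem inl_counit : inl hP Coalgebra.counit = 1 := rfl

theorem inr_mul_inl (h : H) (g : Dual k C) : inr hP h * inl hP g =
    LinearMap.mul' k _ (TensorProduct.map (inl hP ∘ₗ P.hit.flip g) (inr hP).toLinearMap
      (Coalgebra.comul h)) := by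
  refine (congrArg (of hP) (hP.total_ring_mul_dual h g)).trans ?_
  generalize Coalgebra.comul (R := k) h = t
  induction t with
  | zero => simp only [map_zero]
  | add s t hs ht => simp only [map_add, hs, ht]
  | tmul p q =>
    rw [LinearMap.rTensor_tmul, TensorProduct.map_tmul, LinearMap.mul'_apply,
      LinearMap.comp_apply, AlgHom.toLinearMap_apply, inl_mul_inr]

variable {hP} in
theorem induction_on {p : Smash P hP → Prop} (x : Smash P hP) (zero : p 0)
    (add : ∀ x y, p x → p y → p (x + y)) (tmul : ∀ f h, p (inl hP f * inr hP h)) : p x := by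
  obtain ⟨x, rfl⟩ := (of hP).surjective x
  induction x with
  | zero => rwa [map_zero]
  | add x y hx hy => rw [map_add]; exact add _ _ hx hy
  | tmul f h => rw [← inl_mul_inr]; exact tmul f h

section Lift

variable {R : Type*} [Ring R] [Algebra k R] (α : Dual k C →ₗ[k] R) (β : H →ₐ[k] R)
  (hα₁ : α Coalgebra.counit = 1) (hα : ∀ f g, α (dualMul k C f g) = α f * α g)
  (hβα : ∀ h g, β h * α g = LinearMap.mul' k R (TensorProduct.map (α ∘ₗ P.hit.flip g)
    β.toLinearMap (Coalgebra.comul h)))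

/-- An algebra map out of `C* # H`. -/
def lift : Smash P hP →ₐ[k] R :=
  AlgHom.ofLinearMap (LinearMap.mul' k R ∘ₗ TensorProduct.map α β.toLinearMap ∘ₗ
    (of hP).symm.toLinearMap)
    (by
      change LinearMap.mul' k R (TensorProduct.map α β.toLinearMap (Coalgebra.counit ⊗ₜ 1)) = 1
      simp [hα₁])
    (fun x y => smash_lift_mul P.total α β.toLinearMap hα (map_mul β) hβα
      ((of hP).symm x) ((of hP).symm y))

theorem lift_inl (f : Dual k C) : lift hP α β hα₁ hα hβα (inl hP f) = α f := by
  change LinearMap.mul' k R (TensorProduct.map α β.toLinearMap (f ⊗ₜ 1)) = α f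
  simp

theorem lift_inr (h : H) : lift hP α β hα₁ hα hβα (inr hP h) = β h := by
  change LinearMap.mul' k R (TensorProduct.map α β.toLinearMap (Coalgebra.counit ⊗ₜ h)) = β h
  simp [hα₁]

end Lift

variable {hP} in
theorem algHom_ext {R : Type*} [Ring R] [Algebra k R] {φ ψ : Smash P hP →ₐ[k] R}
    (h₁ : ∀ f, φ (inl hP f) = ψ (inl hP f)) (h₂ : ∀ h, φ (inr hP h) = ψ (inr hP h)) : φ = ψ := by
  ext x
  induction x using induction_on with
  | zero => rw [map_zero, map_zero]
  | add x y hx hy => rw [map_add, map_add, hx, hy]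
  | tmul f h => rw [map_mul, map_mul, h₁, h₂]

end Smash

end MappingSystem

/-! ### The embedding of C* # B, the untwisted coproduct and canonical elements -/

namespace MappingSystem

namespace Smash

variable {k H B C : Type*} [Field k] [Ring H] [HopfAlgebra k H] [Ring B] [Algebra k B]
  [AddCommGroup C] [Module k C] [Coalgebra k C] [FiniteDimensional k C]
  {P : MappingSystem k H B C} (hP : P.IsPAMS)

/-- The inclusion of `C* # B` in `C* # H`. -/
def emb : Dual k C ⊗[k] B →ₗ[k] Smash P hP :=
  LinearMap.mul' k _ ∘ₗ TensorProduct.map (inl hP) ((inr hP).toLinearMap ∘ₗ P.ι)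

@[simp] theorem emb_tmul (f : Dual k C) (b : B) :
    emb hP (f ⊗ₜ b) = inl hP f * inr hP (P.ι b) := rfl

theorem emb_eq (x : Dual k C ⊗[k] B) : emb hP x = of hP (LinearMap.lTensor (Dual k C) P.ι x) := by
  induction x with
  | zero => simp only [map_zero]
  | add x y hx hy => simp only [map_add, hx, hy]
  | tmul f b => exact inl_mul_inr hP f (P.ι b)

theorem emb_injective : Function.Injective (emb hP) := by
  intro x y h
  rw [emb_eq, emb_eq] at h
  exact Module.Flat.lTensor_preserves_injective_linearMap P.ι hP.ι_injective ((of hP).injective h)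

/-- The exchange relation for ι(b) in C* # H is the one of C* # B because ι is colinear. -/
theorem emb_mul (x y : Dual k C ⊗[k] B) : emb hP (P.smashMul x y) = emb hP x * emb hP y := by
  refine smash_lift_mul P (inl hP) ((inr hP).toLinearMap ∘ₗ P.ι) (inl_mul hP)
    (fun b c => by simp [hP.ι_mul]) (fun b g => ?_) x y
  rw [LinearMap.comp_apply, AlgHom.toLinearMap_apply, inr_mul_inl, hP.ι_coact,
    ← LinearMap.comp_apply (TensorProduct.map _ _), LinearMap.map_comp_lTensor]

theorem emb_inl (f : Dual k C) : emb hP (f ⊗ₜ 1) = inl hP f := by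
  rw [emb_tmul, hP.ι_one, map_one, mul_one]

theorem emb_inr (b : B) : emb hP (Coalgebra.counit ⊗ₜ b) = inr hP (P.ι b) := by
  rw [emb_tmul, inl_counit, one_mul]

/-- The algebra map `C* # H → (C* # H) ⊗ (C* # H)` with `f ↦ f ⊗ 1` for `f ∈ C*` and
`h ↦ ∑ h₍₁₎ ⊗ h₍₂₎` for `h ∈ H`. -/
def split : Smash P hP →ₐ[k] Smash P hP ⊗[k] Smash P hP :=
  lift hP ((TensorProduct.mk k _ _).flip 1 ∘ₗ inl hP)
    ((Algebra.TensorProduct.map (inr hP) (inr hP)).comp (Bialgebra.comulAlgHom k H))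
    (by simp [inl_counit, Algebra.TensorProduct.one_def]) (fun f g => by simp [inl_mul]) (fun h g => by
      -- F sends ∑ h₍₁₎ ⊗ h₍₂₎ ⊗ h₍₃₎ to ∑ (h₍₁₎ ⇀ g) h₍₂₎ ⊗ h₍₃₎; the exchange relation is
      -- preserved by coassociativity of H.
      let F : H ⊗[k] (H ⊗[k] H) →ₗ[k] Smash P hP ⊗[k] Smash P hP :=
        TensorProduct.map (LinearMap.mul' k _) LinearMap.id ∘ₗ
          (TensorProduct.assoc k _ _ _).symm.toLinearMap ∘ₗ
            TensorProduct.map (inl hP ∘ₗ P.hit.flip g)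
              (TensorProduct.map (inr hP).toLinearMap (inr hP).toLinearMap)
      have h1 : ∀ t : H ⊗[k] H, Algebra.TensorProduct.map (inr hP) (inr hP) t *
          (inl hP g ⊗ₜ 1) =
          F (TensorProduct.assoc k H H H (LinearMap.rTensor H Coalgebra.comul t)) := by
        intro t
        induction t with
        | zero => simp
        | add s t hs ht => simp only [map_add, add_mul, hs, ht]
        | tmul p q =>
          rw [Algebra.TensorProduct.map_tmul, Algebra.TensorProduct.tmul_mul_tmul, inr_mul_inl,
            mul_one, LinearMap.rTensor_tmul]
          generalize Coalgebra.comul (R := k) p = t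
          induction t with
          | zero => simp
          | add s t hs ht => simp only [map_add, TensorProduct.add_tmul, hs, ht]
          | tmul c d => simp [F]
      have h2 : ∀ t : H ⊗[k] H, LinearMap.mul' k _ (TensorProduct.map
          (((TensorProduct.mk k _ _).flip 1 ∘ₗ inl hP) ∘ₗ P.hit.flip g)
          ((Algebra.TensorProduct.map (inr hP) (inr hP)).comp
            (Bialgebra.comulAlgHom k H)).toLinearMap t) =
          F (LinearMap.lTensor H Coalgebra.comul t) := by
        intro t
        induction t with
        | zero => simp
        | add s t hs ht => simp only [map_add, hs, ht]
        | tmul p q =>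
          simp only [TensorProduct.map_tmul, LinearMap.mul'_apply, AlgHom.toLinearMap_apply,
            AlgHom.comp_apply, Bialgebra.comulAlgHom_apply, LinearMap.lTensor_tmul]
          generalize Coalgebra.comul (R := k) q = t
          induction t with
          | zero => simp
          | add s t hs ht => simp only [map_add, mul_add, TensorProduct.tmul_add, hs, ht]
          | tmul c d => simp [F]
      rw [h2, ← Coalgebra.coassoc_apply, ← h1]
      rfl)

theorem split_inl (f : Dual k C) : split hP (inl hP f) = inl hP f ⊗ₜ 1 :=
  lift_inl hP _ _ _ _ _ f

theorem split_inr (h : H) : split hP (inr hP h) =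
    Algebra.TensorProduct.map (inr hP) (inr hP) (Coalgebra.comul h) :=
  lift_inr hP _ _ _ _ _ h

open CoassocTwist in
-- It suffices to check generators: f goes to f ⊗ 1 ⊗ 1 either way, and on H the statement is
-- coassociativity.
theorem split_coassoc (x : Smash P hP) :
    splitFst (split hP) (split hP x) = splitSnd (split hP) (split hP x) := by
  have : (splitFst (split hP)).comp (split hP) = (splitSnd (split hP)).comp (split hP) := by
    refine algHom_ext (fun f => ?_) (fun h => ?_)
    · simp [split_inl, Algebra.TensorProduct.one_def]
    · let F : H ⊗[k] (H ⊗[k] H) →ₗ[k] Smash P hP ⊗[k] (Smash P hP ⊗[k] Smash P hP) :=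
        TensorProduct.map (inr hP).toLinearMap
          (TensorProduct.map (inr hP).toLinearMap (inr hP).toLinearMap)
      have h1 : ∀ t : H ⊗[k] H, splitFst (split hP)
          (Algebra.TensorProduct.map (inr hP) (inr hP) t) =
          F (TensorProduct.assoc k H H H (LinearMap.rTensor H Coalgebra.comul t)) := by
        intro t
        induction t with
        | zero => simp only [map_zero]
        | add s t hs ht => simp only [map_add, hs, ht]
        | tmul p q =>
          rw [Algebra.TensorProduct.map_tmul, splitFst_tmul, split_inr, LinearMap.rTensor_tmul]
          generalize Coalgebra.comul (R := k) p = t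
          induction t with
          | zero => simp only [map_zero, TensorProduct.zero_tmul]
          | add s t hs ht => simp only [map_add, TensorProduct.add_tmul, hs, ht]
          | tmul c d => rfl
      have h2 : ∀ t : H ⊗[k] H, splitSnd (split hP)
          (Algebra.TensorProduct.map (inr hP) (inr hP) t) =
          F (LinearMap.lTensor H Coalgebra.comul t) := by
        intro t
        induction t with
        | zero => simp only [map_zero]
        | add s t hs ht => simp only [map_add, hs, ht]
        | tmul p q =>
          rw [Algebra.TensorProduct.map_tmul, splitSnd_tmul, split_inr]
          rfl
      rw [AlgHom.comp_apply, AlgHom.comp_apply, split_inr, h1, h2, Coalgebra.coassoc_apply]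
  exact DFunLike.congr_fun this x

section Canon

variable {R R' : Type*} [Ring R] [Algebra k R] [Ring R'] [Algebra k R']

/-- The element `∑ⱼ u(xⱼ) ⊗ xⱼ*` determined by a linear map `u` on `C`. -/
def canon : (C →ₗ[k] R) →ₗ[k] R ⊗[k] Smash P hP :=
  ∑ j, (TensorProduct.mk k R (Smash P hP)).flip (inl hP ((finBasis k C).coord j)) ∘ₗ
    LinearMap.applyₗ (finBasis k C j)

theorem canon_apply (u : C →ₗ[k] R) :
    canon hP u = ∑ j, u (finBasis k C j) ⊗ₜ inl hP ((finBasis k C).coord j) := by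
  simp [canon]

/-- Rank one maps go to pure tensors. As they span, identities for `canon` can be checked on them,
and sums in any basis can be recognized. -/
theorem canon_smulRight (f : Dual k C) (r : R) : canon hP (f.smulRight r) = r ⊗ₜ inl hP f := by
  rw [canon_apply]
  simp only [LinearMap.smulRight_apply, TensorProduct.smul_tmul, ← TensorProduct.tmul_sum,
    ← map_smul, ← map_sum]
  rw [Basis.sum_dual_apply_smul_coord]

/-- The product of C* is dual to the coproduct of C, so R ⊗ C* is the convolution algebra Hom(C, R).
This turns computations with J into convolution identities. -/
theorem canon_mul (u v : C →ₗ[k] R) :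
    canon hP u * canon hP v = canon hP (toConv u * toConv v).ofConv := by
  have : (toConv u * toConv v).ofConv = ∑ i, ∑ j, (dualMul k C ((finBasis k C).coord i)
      ((finBasis k C).coord j)).smulRight (u (finBasis k C i) * v (finBasis k C j)) := by
    ext x
    simp only [LinearMap.sum_apply, LinearMap.smulRight_apply, dualMul_apply, toConv_mul_apply]
    generalize Coalgebra.comul (R := k) x = t
    induction t with
    | zero => simp
    | add s t hs ht => simp only [map_add, add_smul, Finset.sum_add_distrib, hs, ht]
    | tmul p q =>
      conv_lhs => rw [← (finBasis k C).sum_repr p, ← (finBasis k C).sum_repr q]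
      simp only [TensorProduct.map_tmul, LinearMap.mul'_apply, map_sum, map_smul,
        Finset.sum_mul_sum, smul_mul_smul_comm, Basis.coord_apply]
  rw [this, canon_apply, canon_apply, Finset.sum_mul_sum, map_sum]
  refine Finset.sum_congr rfl fun i _ => ?_
  rw [map_sum]
  refine Finset.sum_congr rfl fun j _ => ?_
  rw [canon_smulRight, inl_mul, Algebra.TensorProduct.tmul_mul_tmul]

theorem canon_one : canon hP (1 : WithConv (C →ₗ[k] R)).ofConv = 1 := by
  have : (1 : WithConv (C →ₗ[k] R)).ofConv =
      (Coalgebra.counit (R := k) (A := C)).smulRight (1 : R) := by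
    ext x; simp [LinearMap.convOne_def, Algebra.algebraMap_eq_smul_one]
  rw [this, canon_smulRight, inl_counit]
  rfl

theorem canon_mul_tmul_one (r : R) (u : C →ₗ[k] R) :
    canon hP u * (r ⊗ₜ 1) = canon hP (LinearMap.mulRight k r ∘ₗ u) := by
  simp [canon_apply, Finset.sum_mul]

theorem map_canon (φ : R →ₐ[k] R') (ψ : Smash P hP →ₐ[k] Smash P hP)
    (hψ : ∀ f, ψ (inl hP f) = inl hP f) (u : C →ₗ[k] R) :
    Algebra.TensorProduct.map φ ψ (canon hP u) = canon hP (φ.toLinearMap ∘ₗ u) := by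
  simp [canon_apply, map_sum, hψ]

/-- The map `h ↦ canon (u (· ◁ h))`. -/
def canonAct (u : C →ₗ[k] R) : H →ₗ[k] R ⊗[k] Smash P hP :=
  canon hP ∘ₗ LinearMap.llcomp k C C R u ∘ₗ P.act.flip

@[simp] theorem canonAct_apply (u : C →ₗ[k] R) (h : H) :
    canonAct hP u h = canon hP (u ∘ₗ P.act.flip h) := rfl

/-- `h ↦ 1 ⊗ h` -/
def inrSnd (R : Type*) [Ring R] [Algebra k R] : H →ₐ[k] R ⊗[k] Smash P hP :=
  Algebra.TensorProduct.includeRight.comp (inr hP)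

theorem inrSnd_apply (h : H) : inrSnd hP R h = 1 ⊗ₜ inr hP h := rfl

/-- This is the exchange relation (1 ⊗ h) canon(u) = ∑ canon(u(· ◁ h₍₁₎)) (1 ⊗ h₍₂₎), written as a
convolution in h. -/
theorem mulRight_canon_comp_inrSnd (u : C →ₗ[k] R) :
    toConv (LinearMap.mulRight k (canon hP u) ∘ₗ (inrSnd hP R).toLinearMap) =
      toConv (canonAct hP u) * toConv (inrSnd hP R).toLinearMap := by
  ext h
  rw [toConv_mul_apply]
  let r := Coalgebra.Repr.arbitrary k h
  have key : ∀ (f : Dual k C) (a : R), inrSnd hP R h * canon hP (f.smulRight a) =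
      LinearMap.mul' k _ (TensorProduct.map (canonAct hP (f.smulRight a))
        (inrSnd hP R).toLinearMap (Coalgebra.comul h)) := by
    intro f a
    rw [canon_smulRight, inrSnd_apply, Algebra.TensorProduct.tmul_mul_tmul, inr_mul_inl, one_mul]
    generalize Coalgebra.comul (R := k) h = t
    induction t with
    | zero => simp
    | add s t hs ht => simp only [map_add, TensorProduct.tmul_add, hs, ht]
    | tmul p q =>
      have : f.smulRight a ∘ₗ P.act.flip p = (P.hit p f).smulRight a := rfl
      simp [this, canon_smulRight, inrSnd_apply]
  -- Decomposing u into rank one maps reduces the claim to the exchange relation for a single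
  -- functional.
  have hu : u = ∑ j, ((finBasis k C).coord j).smulRight (u (finBasis k C j)) := by
    refine (finBasis k C).ext fun i => ?_
    simp [LinearMap.sum_apply, Finsupp.single_apply]
  have hc : canonAct hP u = ∑ j, canonAct hP
      (((finBasis k C).coord j).smulRight (u (finBasis k C j))) := by
    conv_lhs => rw [hu]
    simp only [canonAct]
    ext h
    simp
  rw [hc]
  conv_lhs => rw [hu]
  have hm : ∀ t : H ⊗[k] H, TensorProduct.map (∑ j, canonAct hP
      (((finBasis k C).coord j).smulRight (u (finBasis k C j)))) (inrSnd hP R).toLinearMap t =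
      ∑ j, TensorProduct.map (canonAct hP
        (((finBasis k C).coord j).smulRight (u (finBasis k C j)))) (inrSnd hP R).toLinearMap t := by
    intro t
    induction t with
    | zero => simp
    | add s t hs ht => simp only [map_add, Finset.sum_add_distrib, hs, ht]
    | tmul p q => simp [TensorProduct.sum_tmul]
  rw [hm, map_sum, LinearMap.comp_apply, LinearMap.mulRight_apply, AlgHom.toLinearMap_apply,
    map_sum, Finset.mul_sum]
  exact Finset.sum_congr rfl fun j _ => key _ _

end Canon

end Smash

end MappingSystem

/-! ### The twist and the comultiplication -/

namespace MappingSystem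

namespace Smash

variable {k H B C : Type*} [Field k] [Ring H] [HopfAlgebra k H] [Ring B] [Algebra k B]
  [AddCommGroup C] [Module k C] [Coalgebra k C] [FiniteDimensional k C]
  {P : MappingSystem k H B C} (hP : P.IsPAMS)

/-- The twist `∑ⱼ γ(xⱼ) ⊗ xⱼ*`. -/
def twist : Smash P hP ⊗[k] Smash P hP := canon hP ((inr hP).toLinearMap ∘ₗ P.γ)

/-- The inverse `∑ⱼ γbar(xⱼ) ⊗ xⱼ*` of the twist. -/
def twistInv : Smash P hP ⊗[k] Smash P hP := canon hP ((inr hP).toLinearMap ∘ₗ P.γbar)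

theorem twist_mul_twistInv : twist hP * twistInv hP = 1 := by
  rw [twist, twistInv, canon_mul, toConv_algHom_comp_mul, hP.γ_mul_γbar, toConv_algHom_comp_one,
    canon_one]

theorem twistInv_mul_twist : twistInv hP * twist hP = 1 := by
  rw [twist, twistInv, canon_mul, toConv_algHom_comp_mul, hP.γbar_mul_γ, toConv_algHom_comp_one,
    canon_one]

section

variable {R : Type*} [Ring R] [Algebra k R]

/-- The map `h ↦ canon (a (v(·) h))`. -/
def canonMul (a : H →ₗ[k] R) (v : C →ₗ[k] H) : H →ₗ[k] R ⊗[k] Smash P hP :=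
  canon hP ∘ₗ LinearMap.compRight k a ∘ₗ LinearMap.lcomp k H v ∘ₗ (LinearMap.mul k H).flip

@[simp] theorem canonMul_apply (a : H →ₗ[k] R) (v : C →ₗ[k] H) (h : H) :
    canonMul hP a v h = canon hP (a ∘ₗ LinearMap.mulRight k h ∘ₗ v) := rfl

/-- At x and h the claim is ∑ ι(ζ(γ(x₍₁₎) h₍₁₎)) γ(x₍₂₎ ◁ h₍₂₎) = γ(x) h inside φ. Colinearity of γ
replaces γ(x₍₁₎) ⊗ x₍₂₎ by γ(x)₍₁₎ ⊗ π(γ(x)₍₂₎), and the left side is then (ι∘ζ) * (γ∘π) = id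
evaluated at γ(x) h. -/
theorem canonMul_ζ_mul_canonAct_γ (φ : H →ₐ[k] R) :
    toConv (canonMul hP (φ.toLinearMap ∘ₗ P.ι ∘ₗ P.ζ) P.γ) *
      toConv (canonAct hP (φ.toLinearMap ∘ₗ P.γ)) = toConv (canonMul hP φ.toLinearMap P.γ) := by
  ext h
  rw [toConv_mul_apply]
  let r := Coalgebra.Repr.arbitrary k h
  rw [← r.eq, map_sum, map_sum]
  simp only [TensorProduct.map_tmul, LinearMap.mul'_apply, canonMul_apply, canonAct_apply,
    canon_mul]
  rw [← map_sum]
  congr 1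
  ext x
  simp only [LinearMap.sum_apply, toConv_mul_apply]
  let T : H → H → H ⊗[k] C →ₗ[k] R := fun l q => LinearMap.mul' k R ∘ₗ TensorProduct.map
    (φ.toLinearMap ∘ₗ P.ι ∘ₗ P.ζ ∘ₗ LinearMap.mulRight k l) (φ.toLinearMap ∘ₗ P.γ ∘ₗ P.act.flip q)
  have h1 : ∀ l q, LinearMap.mul' k R (TensorProduct.map
      ((φ.toLinearMap ∘ₗ P.ι ∘ₗ P.ζ) ∘ₗ LinearMap.mulRight k l ∘ₗ P.γ)
      ((φ.toLinearMap ∘ₗ P.γ) ∘ₗ P.act.flip q) (Coalgebra.comul x)) =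
      T l q (LinearMap.lTensor H P.π (Coalgebra.comul (P.γ x))) := by
    intro l q
    rw [hP.γ_coact]
    generalize Coalgebra.comul (R := k) x = t
    induction t with
    | zero => simp
    | add s t hs ht => simp only [map_add, hs, ht]
    | tmul c d => simp [T]
  simp only [h1]
  have h2 := LinearMap.congr_fun (congrArg ofConv hP.conv_eq_id) (P.γ x * h)
  rw [toConv_mul_apply, Bialgebra.comul_mul, ← r.eq] at h2
  have h3 : φ.toLinearMap (P.γ x * h) = φ.toLinearMap ((LinearMap.id : H →ₗ[k] H) (P.γ x * h)) := rfl
  simp only [LinearMap.comp_apply, LinearMap.mulRight_apply] at h2 ⊢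
  rw [h3, ← h2, Finset.mul_sum, map_sum, map_sum, map_sum]
  refine Finset.sum_congr rfl fun i _ => ?_
  generalize Coalgebra.comul (R := k) (P.γ x) = t
  induction t with
  | zero => simp
  | add s t hs ht => simp only [map_add, add_mul, hs, ht]
  | tmul c d => simp [T, hP.π_mul]

/-- Colinearity of γ in convolution form. -/
theorem toConv_comp_γ_mul (hP : P.IsPAMS) (Q : H →ₗ[k] R) (V : C →ₗ[k] R) :
    toConv (Q ∘ₗ P.γ) * toConv V = toConv ((toConv Q * toConv (V ∘ₗ P.π)).ofConv ∘ₗ P.γ) := by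
  ext x
  rw [toConv_mul_apply, LinearMap.comp_apply, toConv_mul_apply]
  have h := congrArg (fun t => LinearMap.mul' k R (TensorProduct.map Q V t)) (hP.γ_coact x)
  rw [← LinearMap.comp_apply (TensorProduct.map _ _), ← LinearMap.comp_apply (TensorProduct.map _ _),
    LinearMap.map_comp_lTensor, LinearMap.map_comp_rTensor] at h
  exact h.symm

theorem tmul_one_mul_inrSnd (r : R) (h : H) :
    (r ⊗ₜ 1) * inrSnd hP R h = r ⊗ₜ inr hP h := by
  rw [inrSnd_apply, Algebra.TensorProduct.tmul_mul_tmul, mul_one, one_mul]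

end

section Comul

variable [FiniteDimensional k H] [FiniteDimensional k B]

theorem map_emb_comulRight (b : B) : TensorProduct.map (emb hP) (emb hP) (P.comulRight b) =
    (toConv (canonMul hP ((inr hP).toLinearMap ∘ₗ P.ι ∘ₗ P.ζ) P.γ) *
      toConv (inrSnd hP (Smash P hP)).toLinearMap).ofConv (P.ι b) := by
  rw [toConv_mul_apply, hP.ι_coact]
  simp only [comulRight, LinearMap.sum_apply, map_sum, LinearMap.comp_apply]
  generalize P.coact b = t
  induction t with
  | zero => simp
  | add s t hs ht => simp only [map_add, Finset.sum_add_distrib, hs, ht]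
  | tmul h c =>
    simp only [TensorProduct.map_tmul, LinearMap.lTensor_tmul, LinearMap.mul'_apply,
      canonMul_apply, canon_apply, Finset.sum_mul, AlgHom.toLinearMap_apply, inrSnd_apply,
      Algebra.TensorProduct.tmul_mul_tmul, mul_one]
    refine Finset.sum_congr rfl fun j _ => ?_
    simp only [LinearMap.comp_apply, TensorProduct.mk_apply, emb_tmul]
    rw [show MappingSystem.inr k C (P.ζ (LinearMap.mulLeft k (P.γ (finBasis k C j)) h)) =
      Coalgebra.counit ⊗ₜ P.ζ (P.γ (finBasis k C j) * h) from rfl, emb_inr]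
    rfl

/-- Moving J to the left past 1 ⊗ b₍₂₎ produces canon(γ(· ◁ ·)), which absorbs the ζ-factor by
`canonMul_ζ_mul_canonAct_γ`. The result ∑ canon(γ(·) b₍₁₎)(1 ⊗ b₍₂₎) is J D(b). -/
theorem map_emb_comulRight_mul_twist (b : B) :
    TensorProduct.map (emb hP) (emb hP) (P.comulRight b) * twist hP =
      twist hP * split hP (inr hP (P.ι b)) := by
  have h1 := mul_toConv_mulRight_comp (twist hP)
    (canonMul hP ((inr hP).toLinearMap ∘ₗ P.ι ∘ₗ P.ζ) P.γ) (inrSnd hP (Smash P hP)).toLinearMap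
  rw [twist, mulRight_canon_comp_inrSnd, ← mul_assoc, canonMul_ζ_mul_canonAct_γ] at h1
  rw [map_emb_comulRight]
  have h2 := LinearMap.congr_fun (congrArg ofConv h1) (P.ι b)
  refine h2.symm.trans ?_
  rw [toConv_mul_apply, split_inr]
  generalize Coalgebra.comul (R := k) (P.ι b) = t
  induction t with
  | zero => simp
  | add s t hs ht => simp only [map_add, mul_add, hs, ht]
  | tmul p q =>
    have e : (inr hP).toLinearMap ∘ₗ LinearMap.mulRight k p ∘ₗ P.γ =
        LinearMap.mulRight k (inr hP p) ∘ₗ (inr hP).toLinearMap ∘ₗ P.γ := by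
      ext x; simp
    rw [TensorProduct.map_tmul, LinearMap.mul'_apply, canonMul_apply, e, ← canon_mul_tmul_one,
      Algebra.TensorProduct.map_tmul, mul_assoc, AlgHom.toLinearMap_apply, tmul_one_mul_inrSnd]
    rfl

/-- The double sum over dual bases is the canonical element of a single map on C, which makes the
convolution calculus applicable. -/
theorem map_emb_comulLeft (f : Dual k C) : TensorProduct.map (emb hP) (emb hP) (P.comulLeft f) =
    canon hP ((toConv (inl hP ∘ₗ P.hit.flip f) *
      toConv ((inr hP).toLinearMap ∘ₗ P.ι ∘ₗ P.ζ)).ofConv ∘ₗ P.γ) := by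
  simp only [comulLeft, LinearMap.sum_apply, map_sum, LinearMap.comp_apply,
    P.dualCoact_eq_sum (finBasis k H), TensorProduct.map_tmul]
  have : (toConv (inl hP ∘ₗ P.hit.flip f) *
      toConv ((inr hP).toLinearMap ∘ₗ P.ι ∘ₗ P.ζ)).ofConv ∘ₗ P.γ =
      ∑ i, ∑ m, (P.γ.dualMap (dualMul k H ((finBasis k H).coord m)
        (P.ζ.dualMap ((finBasis k B).coord i)))).smulRight
          (inl hP (P.hit (finBasis k H m) f) * inr hP (P.ι (finBasis k B i))) := by
    ext x
    simp only [LinearMap.sum_apply, LinearMap.smulRight_apply, LinearMap.dualMap_apply,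
      LinearMap.comp_apply, dualMul_apply, toConv_mul_apply]
    generalize Coalgebra.comul (R := k) (P.γ x) = t
    induction t with
    | zero => simp
    | add s t hs ht => simp only [map_add, add_smul, Finset.sum_add_distrib, hs, ht]
    | tmul p q =>
      simp only [TensorProduct.map_tmul, LinearMap.mul'_apply, LinearMap.comp_apply,
        LinearMap.flip_apply, AlgHom.toLinearMap_apply, LinearMap.dualMap_apply]
      conv_lhs => rw [← (finBasis k H).sum_repr p, ← (finBasis k B).sum_repr (P.ζ q)]
      simp only [map_sum, map_smul, LinearMap.sum_apply, LinearMap.smul_apply,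
        Finset.sum_mul_sum, smul_mul_smul_comm, Basis.coord_apply]
      exact Finset.sum_comm
  rw [this, map_sum]
  refine Finset.sum_congr rfl fun i _ => ?_
  rw [map_sum]
  refine Finset.sum_congr rfl fun m _ => ?_
  rw [canon_smulRight]
  exact congrArg₂ (fun x y => x ⊗ₜ[k] y) rfl (emb_inl hP _)

/-- After multiplication by J the factors ι∘ζ and γ∘π combine to id. What remains at γ(x) is ∑
(γ(x)₍₁₎ ⇀ f) γ(x)₍₂₎ = γ(x) f, so the product is J (f ⊗ 1). -/
theorem map_emb_comulLeft_mul_twist (f : Dual k C) :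
    TensorProduct.map (emb hP) (emb hP) (P.comulLeft f) * twist hP =
      twist hP * split hP (inl hP f) := by
  have h1 : toConv (inl hP ∘ₗ P.hit.flip f) * toConv (inr hP).toLinearMap =
      toConv (LinearMap.mulRight k (inl hP f) ∘ₗ (inr hP).toLinearMap) := by
    ext h
    rw [toConv_mul_apply, ← inr_mul_inl]
    rfl
  have h2 : toConv ((inr hP).toLinearMap ∘ₗ P.ι ∘ₗ P.ζ) *
      toConv ((inr hP).toLinearMap ∘ₗ P.γ ∘ₗ P.π) = toConv (inr hP).toLinearMap := by
    rw [toConv_algHom_comp_mul, hP.conv_eq_id]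
    rfl
  rw [map_emb_comulLeft, twist, canon_mul, toConv_comp_γ_mul hP, LinearMap.comp_assoc,
    toConv_ofConv, mul_assoc, h2, h1, split_inl, canon_mul_tmul_one]
  rfl

theorem map_emb_comul_mul_twist (x : Dual k C ⊗[k] B) :
    TensorProduct.map (emb hP) (emb hP) (P.partialDualComul x) * twist hP =
      twist hP * split hP (emb hP x) := by
  induction x with
  | zero => simp only [map_zero, zero_mul, mul_zero]
  | add x y hx hy => simp only [map_add, add_mul, mul_add, hx, hy]
  | tmul f b =>
    have e : ∀ s t, TensorProduct.map (emb hP) (emb hP)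
        (TensorProduct.map₂ P.smashMul P.smashMul s t) =
        TensorProduct.map (emb hP) (emb hP) s * TensorProduct.map (emb hP) (emb hP) t :=
      fun s t => CoassocTwist.Realization.map_map₂ (emb_mul hP) (emb_mul hP) s t
    rw [partialDualComul, TensorProduct.lift.tmul, LinearMap.compl₁₂_apply, e, mul_assoc,
      map_emb_comulRight_mul_twist, ← mul_assoc, map_emb_comulLeft_mul_twist, emb_tmul, map_mul,
      mul_assoc]

end Comul

end Smash

end MappingSystem

/-! ### The associator as the coboundary of the twist -/

namespace MappingSystem

namespace Smash

variable {k H B C : Type*} [Field k] [Ring H] [HopfAlgebra k H] [Ring B] [Algebra k B]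
  [AddCommGroup C] [Module k C] [Coalgebra k C] [FiniteDimensional k C]
  {P : MappingSystem k H B C} (hP : P.IsPAMS)

/-- `h ↦ h ⊗ 1` -/
def inrFst : H →ₐ[k] Smash P hP ⊗[k] Smash P hP :=
  Algebra.TensorProduct.includeLeft.comp (inr hP)

theorem inrFst_apply (h : H) : inrFst hP h = inr hP h ⊗ₜ 1 := rfl

/-- Since D(S(h)) = ∑ (1 ⊗ S(h₍₁₎))(S(h₍₂₎) ⊗ 1), the factor 1 ⊗ h cancels the first of these. -/
theorem inrSnd_mul_split_inr_antipode :
    toConv (inrSnd hP (Smash P hP)).toLinearMap *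
      toConv (((split hP).comp (inr hP)).toLinearMap ∘ₗ HopfAlgebra.antipode k) =
      toConv ((inrFst hP).toLinearMap ∘ₗ HopfAlgebra.antipode k) := by
  have h1 : toConv (((split hP).comp (inr hP)).toLinearMap ∘ₗ HopfAlgebra.antipode k) =
      toConv ((inrSnd hP (Smash P hP)).toLinearMap ∘ₗ HopfAlgebra.antipode k) *
        toConv ((inrFst hP).toLinearMap ∘ₗ HopfAlgebra.antipode k) := by
    ext h
    rw [toConv_mul_apply]
    simp only [LinearMap.comp_apply, AlgHom.toLinearMap_apply, AlgHom.comp_apply, split_inr,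
      comul_antipode]
    generalize Coalgebra.comul (R := k) h = t
    induction t with
    | zero => simp
    | add s t hs ht => simp only [map_add, hs, ht]
    | tmul p q => simp [inrSnd_apply, inrFst_apply]
  have h2 : toConv (inrSnd hP (Smash P hP)).toLinearMap *
      toConv ((inrSnd hP (Smash P hP)).toLinearMap ∘ₗ HopfAlgebra.antipode k) = 1 := by
    have := toConv_algHom_comp_mul (inrSnd hP (Smash P hP)) LinearMap.id (HopfAlgebra.antipode k)
    rw [LinearMap.id_mul_antipode, toConv_algHom_comp_one] at this
    exact this
  rw [h1, ← mul_assoc, h2, one_mul]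

/-- By `γ_mul_antipode` the left side at h is ∑ canon(γ(· ◁ h₍₁₎))(S(h₍₂₎) ⊗ 1), and the exchange
relation rewrites this as ∑ (1 ⊗ h₍₁₎) J D(S(h₍₂₎)). -/
theorem canonMul_ζbar_mul_twist [FiniteDimensional k H] :
    toConv (LinearMap.mulRight k (twist hP) ∘ₗ
      canonMul hP ((inr hP).toLinearMap ∘ₗ P.ι ∘ₗ P.ζbar) (antipodeInv k H ∘ₗ P.γbar)) =
      toConv (LinearMap.mulRight k (twist hP) ∘ₗ (inrSnd hP (Smash P hP)).toLinearMap) *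
        toConv (((split hP).comp (inr hP)).toLinearMap ∘ₗ HopfAlgebra.antipode k) := by
  rw [twist, mulRight_canon_comp_inrSnd, mul_assoc, inrSnd_mul_split_inr_antipode]
  ext h
  let r := Coalgebra.Repr.arbitrary k h
  rw [toConv_mul_apply, ← r.eq, map_sum, map_sum, LinearMap.comp_apply, LinearMap.mulRight_apply,
    canonMul_apply, canon_mul]
  have h1 := toConv_algHom_comp_mul (inr hP)
    (P.ι ∘ₗ P.ζbar ∘ₗ LinearMap.mulRight k h ∘ₗ antipodeInv k H ∘ₗ P.γbar) P.γ
  rw [hP.γ_mul_antipode r] at h1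
  refine (congrArg (fun u => canon hP (ofConv u)) h1).trans ?_
  have h2 : (inr hP).toLinearMap ∘ₗ (∑ i ∈ r.index,
      LinearMap.mulRight k (HopfAlgebra.antipode k (r.right i)) ∘ₗ P.γ ∘ₗ P.act.flip (r.left i)) =
      ∑ i ∈ r.index, LinearMap.mulRight k (inr hP (HopfAlgebra.antipode k (r.right i))) ∘ₗ
        ((inr hP).toLinearMap ∘ₗ P.γ) ∘ₗ P.act.flip (r.left i) := by
    ext x
    simp [LinearMap.sum_apply]
  simp only
  rw [h2, map_sum]
  refine Finset.sum_congr rfl fun i _ => ?_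
  rw [← canon_mul_tmul_one]
  rfl

section Associator

variable [FiniteDimensional k H] [FiniteDimensional k B]

/-- The linear map `C → (C* # H) ⊗ (C* # H)` representing the associator. -/
def associatorMap : C →ₗ[k] Smash P hP ⊗[k] Smash P hP :=
  (toConv ((inrSnd hP (Smash P hP)).toLinearMap ∘ₗ P.ι ∘ₗ P.ζbar) *
    toConv (canonMul hP ((inr hP).toLinearMap ∘ₗ P.ι ∘ₗ P.ζbar)
      (antipodeInv k H ∘ₗ P.γbar))).ofConv ∘ₗ antipodeInv k H ∘ₗ P.γbar

/-- By `canonMul_ζbar_mul_twist` and (ι∘ζbar) * id = γ∘π, the product with J is (1 ⊗ γ(π(·))) J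
convolved with D∘S, evaluated at S⁻¹(γbar(x)). The colinearity of γbar then turns the coproduct of
this element into ∑ (1 ⊗ γ(x₍₁₎)) J D(γbar(x₍₂₎)). -/
theorem associatorMap_mul_twist :
    toConv (LinearMap.mulRight k (twist hP) ∘ₗ associatorMap hP) =
      toConv (LinearMap.mulRight k (twist hP) ∘ₗ (inrSnd hP (Smash P hP)).toLinearMap ∘ₗ P.γ) *
        toConv (((split hP).comp (inr hP)).toLinearMap ∘ₗ P.γbar) := by
  have h1 := mul_toConv_mulRight_comp (twist hP)
    ((inrSnd hP (Smash P hP)).toLinearMap ∘ₗ P.ι ∘ₗ P.ζbar)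
    (canonMul hP ((inr hP).toLinearMap ∘ₗ P.ι ∘ₗ P.ζbar) (antipodeInv k H ∘ₗ P.γbar))
  have h2 : toConv ((inrSnd hP (Smash P hP)).toLinearMap ∘ₗ P.ι ∘ₗ P.ζbar) *
      toConv (inrSnd hP (Smash P hP)).toLinearMap =
      toConv ((inrSnd hP (Smash P hP)).toLinearMap ∘ₗ P.γ ∘ₗ P.π) := by
    have := toConv_algHom_comp_mul (inrSnd hP (Smash P hP)) (P.ι ∘ₗ P.ζbar) LinearMap.id
    rw [hP.ι_comp_ζbar_mul_id] at this
    exact this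
  rw [canonMul_ζbar_mul_twist, ← mul_assoc, mul_toConv_mulRight_comp, h2] at h1
  ext x
  rw [toConv_mul_apply]
  have h3 := LinearMap.congr_fun (congrArg ofConv h1) (antipodeInv k H (P.γbar x))
  refine h3.symm.trans ?_
  rw [toConv_mul_apply, comul_antipodeInv]
  let Y : C →ₗ[k] Smash P hP ⊗[k] Smash P hP :=
    LinearMap.mulRight k (twist hP) ∘ₗ (inrSnd hP (Smash P hP)).toLinearMap ∘ₗ P.γ
  have h4 : ∀ t : H ⊗[k] H, LinearMap.mul' k _ (TensorProduct.map (LinearMap.mulRight k (twist hP) ∘ₗ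
      ofConv (toConv ((inrSnd hP (Smash P hP)).toLinearMap ∘ₗ P.γ ∘ₗ P.π)))
      (((split hP).comp (inr hP)).toLinearMap ∘ₗ HopfAlgebra.antipode k)
      (TensorProduct.map (antipodeInv k H) (antipodeInv k H) (TensorProduct.comm k H H t))) =
      LinearMap.mul' k _ (TensorProduct.map Y ((split hP).comp (inr hP)).toLinearMap
        (TensorProduct.comm k H C (LinearMap.lTensor H (P.π ∘ₗ antipodeInv k H) t))) := by
    intro t
    induction t with
    | zero => simp
    | add s t hs ht => simp only [map_add, hs, ht]
    | tmul p q => simp [Y]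
  refine (h4 _).trans ?_
  rw [hP.γbar_coact]
  generalize Coalgebra.comul (R := k) x = t
  induction t with
  | zero => simp
  | add s t hs ht => simp only [map_add, hs, ht]
  | tmul p q => simp [Y]

/-- The third leg of the associator lies in C*, so the whole element is canonical for a map from C
to the first two legs; expanding that map in dual bases gives the defining triple sum. -/
theorem map_emb_associator :
    TensorProduct.map (emb hP) (TensorProduct.map (emb hP) (emb hP)) P.partialDualAssociator =
      TensorProduct.assoc k _ _ _ (canon hP (associatorMap hP)) := by
  let σ : Dual k H →ₗ[k] Dual k C := P.γbar.dualMap ∘ₗ (antipodeInv k H).dualMap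
  have key : associatorMap hP = ∑ j, ∑ m, ∑ i,
      (σ (dualMul k H (P.ζbar.dualMap ((finBasis k B).coord j))
        ((finBasis k H).coord m))).smulRight
        (inr hP (P.ι (finBasis k B i)) ⊗ₜ[k] (inr hP (P.ι (finBasis k B j)) *
          inl hP (σ (P.ζbar.dualMap ((finBasis k B).coord i) ∘ₗ
            LinearMap.mulRight k (finBasis k H m))))) := by
    have hm : ∀ m, canonMul hP ((inr hP).toLinearMap ∘ₗ P.ι ∘ₗ P.ζbar) (antipodeInv k H ∘ₗ P.γbar)
        (finBasis k H m) = ∑ i, inr hP (P.ι (finBasis k B i)) ⊗ₜ[k]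
          inl hP (σ (P.ζbar.dualMap ((finBasis k B).coord i) ∘ₗ
            LinearMap.mulRight k (finBasis k H m))) := by
      intro m
      simp only [← canon_smulRight, canonMul_apply]
      rw [← map_sum]
      congr 1
      ext x
      simp only [LinearMap.sum_apply, LinearMap.smulRight_apply, LinearMap.comp_apply, σ,
        LinearMap.dualMap_apply, AlgHom.toLinearMap_apply, Basis.coord_apply]
      conv_lhs => rw [← (finBasis k B).sum_repr (P.ζbar _)]
      simp only [map_sum, map_smul]
    ext x
    simp only [associatorMap, LinearMap.sum_apply, LinearMap.smulRight_apply, LinearMap.comp_apply,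
      toConv_mul_apply, σ, LinearMap.dualMap_apply, dualMul_apply]
    generalize Coalgebra.comul (R := k) (antipodeInv k H (P.γbar x)) = t
    induction t with
    | zero => simp
    | add s t hs ht => simp only [map_add, add_smul, Finset.sum_add_distrib, hs, ht]
    | tmul p q =>
      simp only [TensorProduct.map_tmul, LinearMap.mul'_apply, LinearMap.comp_apply,
        AlgHom.toLinearMap_apply, LinearMap.dualMap_apply]
      conv_lhs => rw [← (finBasis k H).sum_repr q, ← (finBasis k B).sum_repr (P.ζbar p)]
      simp only [map_sum, map_smul, hm, Basis.coord_apply]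
      rw [Finset.sum_mul_sum]
      refine Finset.sum_congr rfl fun j _ => Finset.sum_congr rfl fun m _ => ?_
      rw [smul_mul_smul_comm, Finset.mul_sum, Finset.smul_sum]
      refine Finset.sum_congr rfl fun i _ => ?_
      rw [inrSnd_apply, Algebra.TensorProduct.tmul_mul_tmul, one_mul]
      rfl
  rw [key]
  simp only [map_sum, partialDualAssociator, canon_smulRight,
    dualComul_eq_sum (finBasis k H), TensorProduct.tmul_sum, TensorProduct.map_tmul]
  rw [Finset.sum_comm]
  refine Finset.sum_congr rfl fun j _ => ?_
  rw [Finset.sum_comm]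
  refine Finset.sum_congr rfl fun m _ => Finset.sum_congr rfl fun i _ => ?_
  rw [TensorProduct.assoc_tmul]
  have e1 : emb hP (MappingSystem.inr k C (finBasis k B i)) = inr hP (P.ι (finBasis k B i)) :=
    emb_inr hP _
  have e2 : ∀ u, emb hP ((P.smashMul (MappingSystem.inr k C (finBasis k B j)) ∘ₗ P.γbarInv) u) =
      inr hP (P.ι (finBasis k B j)) * inl hP (σ u) := fun u =>
    (emb_mul hP _ _).trans (congrArg₂ (· * ·) (emb_inr hP _) (emb_inl hP _))
  have e3 : ∀ u, emb hP (P.γbarInv u) = inl hP (σ u) := fun u => emb_inl hP _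
  rw [e1, e2, LinearMap.comp_apply P.γbarInv, e3]

open CoassocTwist in
-- The second leg of J lies in C*, where D(f) = f ⊗ 1.
theorem splitSnd_split_twist : splitSnd (split hP) (twist hP) = oneR k _ (twist hP) := by
  rw [twist, canon_apply]
  simp only [map_sum, splitSnd_tmul, split_inl, oneR_apply, TensorProduct.assoc_tmul]

open CoassocTwist in
-- As (id ⊗ D)(J) = J ⊗ 1, all factors are canonical elements of maps on C. The factor D∘γbar from
-- `associatorMap_mul_twist` is cancelled by the D∘γ coming from (D ⊗ id)(J).
theorem map_emb_associator_mul :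
    TensorProduct.map (emb hP) (TensorProduct.map (emb hP) (emb hP)) P.partialDualAssociator *
      (oneR k _ (twist hP) * splitFst (split hP) (twist hP)) =
      oneL k _ _ (twist hP) * splitSnd (split hP) (twist hP) := by
  have h1 : splitFst (split hP) (twist hP) = TensorProduct.assoc k _ _ _
      (canon hP (((split hP).comp (inr hP)).toLinearMap ∘ₗ P.γ)) :=
    congrArg (TensorProduct.assoc k _ _ _) (map_canon hP (split hP) (AlgHom.id k _)
      (fun _ => rfl) _)
  have h2 : oneL k _ _ (twist hP) = TensorProduct.assoc k _ _ _
      (canon hP ((inrSnd hP (Smash P hP)).toLinearMap ∘ₗ P.γ)) := by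
    rw [twist, canon_apply, canon_apply, map_sum, map_sum]
    rfl
  have h3 : toConv (((split hP).comp (inr hP)).toLinearMap ∘ₗ P.γbar) *
      toConv (((split hP).comp (inr hP)).toLinearMap ∘ₗ P.γ) = 1 := by
    rw [toConv_algHom_comp_mul, hP.γbar_mul_γ, toConv_algHom_comp_one]
  rw [splitSnd_split_twist, map_emb_associator, h1, h2, oneR_apply, ← Realization.assoc_mul,
    ← Realization.assoc_mul, ← Realization.assoc_mul, ← mul_assoc, canon_mul_tmul_one,
    canon_mul_tmul_one, canon_mul, associatorMap_mul_twist, mul_assoc, h3, mul_one]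

end Associator

end Smash

end MappingSystem

namespace MappingSystem

/-! ### Counit axioms -/

namespace IsPAMS

variable {k H B C : Type*} [Field k] [Ring H] [HopfAlgebra k H] [Ring B] [Algebra k B]
  [AddCommGroup C] [Module k C] [Coalgebra k C] [FiniteDimensional k C]
  {P : MappingSystem k H B C}

theorem dualMul_π_one (hP : P.IsPAMS) (f g : Dual k C) :
    dualMul k C f g (P.π 1) = f (P.π 1) * g (P.π 1) := by
  rw [dualMul_apply, hP.comul_π_one, TensorProduct.map_tmul, LinearMap.mul'_apply]

@[simp] theorem partialDualCounit_tmul (f : Dual k C) (b : B) :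
    P.partialDualCounit (f ⊗ₜ b) = f (P.π 1) * Coalgebra.counit (R := k) (P.ι b) := rfl

/-- Evaluation at the grouplike π(1) and ε∘ι are characters of C* and B; the exchange relation
between them is π(ι(b)) = ε(b) π(1). -/
theorem partialDualCounit_mul (hP : P.IsPAMS) (x y : Dual k C ⊗[k] B) :
    P.partialDualCounit (P.smashMul x y) = P.partialDualCounit x * P.partialDualCounit y := by
  refine smash_lift_mul P (Dual.eval k C (P.π 1)) (Coalgebra.counit ∘ₗ P.ι) hP.dualMul_π_one
    (fun b c => by simp [hP.ι_mul]) (fun b g => ?_) x y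
  have h1 : ∀ t : H ⊗[k] B, LinearMap.mul' k k (TensorProduct.map
      (Dual.eval k C (P.π 1) ∘ₗ P.hit.flip g) (Coalgebra.counit ∘ₗ P.ι) t) =
      g (P.π (TensorProduct.rid k H (LinearMap.lTensor H (Coalgebra.counit ∘ₗ P.ι) t))) := by
    intro t
    induction t with
    | zero => simp
    | add s t hs ht => simp only [map_add, hs, ht]
    | tmul h c => simp [hit_apply, hP.act_π_one, mul_comm]
  rw [h1, hP.rid_lTensor_counit_coact, hP.π_ι]
  simp

theorem smashMul_dual_ring (hP : P.IsPAMS) (f : Dual k C) (b : B) :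
    P.smashMul (f ⊗ₜ 1) (Coalgebra.counit ⊗ₜ b) = f ⊗ₜ b :=
  Smash.emb_injective hP (by
    rw [Smash.emb_mul, Smash.emb_inl, Smash.emb_inr, Smash.emb_tmul])

/-- The case h = 1 of `γ_mul_antipode` says that (ι∘ζbar∘S⁻¹∘γbar) * γ = γ; cancel γ and use that ι
is injective. -/
theorem ζbar_antipodeInv_γbar [FiniteDimensional k H] (hP : P.IsPAMS) (x : C) :
    P.ζbar (antipodeInv k H (P.γbar x)) = algebraMap k B (Coalgebra.counit x) := by
  have h := hP.γ_mul_antipode (h := (1 : H)) (κ := Unit)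
    ⟨{()}, fun _ => 1, fun _ => 1, by simp [Algebra.TensorProduct.one_def]⟩
  have h1 : toConv (P.ι ∘ₗ P.ζbar ∘ₗ antipodeInv k H ∘ₗ P.γbar) * toConv P.γ = toConv P.γ := by
    have e : P.act.flip 1 = LinearMap.id := by ext x; simp [hP.act_one]
    simpa only [Finset.sum_singleton, HopfAlgebra.antipode_one, LinearMap.mulRight_one, e,
      LinearMap.id_comp, LinearMap.comp_id] using h
  have h2 : toConv (P.ι ∘ₗ P.ζbar ∘ₗ antipodeInv k H ∘ₗ P.γbar) = 1 := by
    have := congrArg (· * toConv P.γbar) h1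
    simpa only [mul_assoc, hP.γ_mul_γbar, mul_one] using this
  have h3 := LinearMap.congr_fun (congrArg ofConv h2) x
  rw [LinearMap.convOne_def] at h3
  apply hP.ι_injective
  refine h3.trans ?_
  exact (hP.ιAlgHom.commutes _).symm

variable [FiniteDimensional k H] [FiniteDimensional k B]

theorem comulLeft_eq_sum (f : Dual k C) : P.comulLeft f = ∑ i, ∑ m,
    (P.hit (finBasis k H m) f ⊗ₜ finBasis k B i) ⊗ₜ (P.γ.dualMap (dualMul k H
      ((finBasis k H).coord m) (P.ζ.dualMap ((finBasis k B).coord i))) ⊗ₜ 1) := by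
  simp only [comulLeft, LinearMap.sum_apply, LinearMap.comp_apply,
    P.dualCoact_eq_sum (finBasis k H), map_sum, TensorProduct.map_tmul]
  rfl

/-- At x the C*-leg becomes ∑ ⟨f, π(γ(x)₍₁₎)⟩ ε(ζ(γ(x)₍₂₎)), which is ⟨f, π(γ(x))⟩ = ⟨f, x⟩. -/
theorem counit_comulLeft (hP : P.IsPAMS) (f : Dual k C) : TensorProduct.lid k _
    (LinearMap.rTensor _ P.partialDualCounit (P.comulLeft f)) = f ⊗ₜ 1 := by
  have h1 : ∑ i, ∑ m, (f (P.π (finBasis k H m)) * Coalgebra.counit (R := k)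
      (P.ι (finBasis k B i))) • P.γ.dualMap (dualMul k H
      ((finBasis k H).coord m) (P.ζ.dualMap ((finBasis k B).coord i))) = f := by
    ext x
    have h2 : ∀ t : H ⊗[k] H, ∑ i, ∑ m, (f (P.π (finBasis k H m)) * Coalgebra.counit (R := k)
        (P.ι (finBasis k B i))) * LinearMap.mul' k k (TensorProduct.map ((finBasis k H).coord m)
          (P.ζ.dualMap ((finBasis k B).coord i)) t) =
        f (P.π (TensorProduct.rid k H (LinearMap.lTensor H Coalgebra.counit t))) := by
      intro t
      induction t with
      | zero => simp
      | add s t hs ht => simp only [map_add, mul_add, Finset.sum_add_distrib, hs, ht]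
      | tmul p q =>
        simp only [TensorProduct.map_tmul, LinearMap.mul'_apply, LinearMap.lTensor_tmul,
          TensorProduct.rid_tmul, map_smul, LinearMap.dualMap_apply, smul_eq_mul]
        rw [← hP.ζ_counit]
        conv_rhs => rw [← (finBasis k H).sum_repr p, ← (finBasis k B).sum_repr (P.ζ q)]
        simp only [map_sum, map_smul, Finset.sum_mul_sum, smul_eq_mul, Basis.coord_apply]
        exact Finset.sum_congr rfl fun i _ => Finset.sum_congr rfl fun m _ => by ring
    simp only [LinearMap.sum_apply, LinearMap.smul_apply, LinearMap.dualMap_apply, dualMul_apply,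
      smul_eq_mul]
    rw [h2, Coalgebra.lTensor_counit_comul, TensorProduct.rid_tmul, one_smul, hP.π_γ]
  simp only [comulLeft_eq_sum, map_sum, LinearMap.rTensor_tmul, TensorProduct.lid_tmul,
    partialDualCounit_tmul, hit_apply, hP.act_π_one]
  conv_rhs => rw [← h1]
  simp only [TensorProduct.sum_tmul, TensorProduct.smul_tmul']

theorem counit_comulRight (hP : P.IsPAMS) (b : B) : TensorProduct.lid k _
    (LinearMap.rTensor _ P.partialDualCounit (P.comulRight b)) = Coalgebra.counit ⊗ₜ b := by
  simp only [comulRight, LinearMap.sum_apply, map_sum, LinearMap.comp_apply]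
  have h1 : ∀ (t : H ⊗[k] B) j, TensorProduct.lid k _ (LinearMap.rTensor _ P.partialDualCounit
      (TensorProduct.map (MappingSystem.inr k C ∘ₗ P.ζ ∘ₗ
        LinearMap.mulLeft k (P.γ (finBasis k C j)))
        (TensorProduct.mk k (Dual k C) B ((finBasis k C).coord j)) t)) =
      (Coalgebra.counit (R := k) (finBasis k C j) • (finBasis k C).coord j) ⊗ₜ[k]
        TensorProduct.lid k B (LinearMap.rTensor B (Coalgebra.counit (R := k) (A := H)) t) := by
    intro t j
    induction t with
    | zero => simp
    | add s t hs ht => simp only [map_add, TensorProduct.tmul_add, hs, ht]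
    | tmul h c =>
      simp [MappingSystem.inr, hP.ζ_counit, hP.γ_counit, hP.π_counit, TensorProduct.smul_tmul,
        mul_smul]
      exact smul_comm _ _ _
  simp only [h1, hP.coact_counit]
  rw [← TensorProduct.sum_tmul, Basis.sum_dual_apply_smul_coord]

/-- The counit evaluates the second leg at π(1), and γ(π(1)) = 1 and ζ(1) = 1 collapse both basis
sums to expansions of 1. -/
theorem comulLeft_counit (hP : P.IsPAMS) (f : Dual k C) : TensorProduct.rid k _
    (LinearMap.lTensor _ P.partialDualCounit (P.comulLeft f)) = f ⊗ₜ 1 := by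
  simp only [comulLeft_eq_sum, map_sum, LinearMap.lTensor_tmul, TensorProduct.rid_tmul,
    partialDualCounit_tmul, hP.ι_one, Bialgebra.counit_one, mul_one, LinearMap.dualMap_apply,
    dualMul_apply, hP.γ_one, Bialgebra.comul_one, Algebra.TensorProduct.one_def,
    TensorProduct.map_tmul, LinearMap.mul'_apply, hP.ζ_one]
  conv_rhs => rw [← hP.hit_one f, ← (finBasis k H).sum_repr 1, ← (finBasis k B).sum_repr 1]
  simp only [map_sum, map_smul, LinearMap.sum_apply, LinearMap.smul_apply, TensorProduct.sum_tmul,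
    TensorProduct.tmul_sum, TensorProduct.smul_tmul', TensorProduct.tmul_smul,
    Basis.coord_apply]
  simp only [Finset.smul_sum, TensorProduct.smul_tmul', smul_smul, mul_comm]

theorem comulRight_counit (hP : P.IsPAMS) (b : B) : TensorProduct.rid k _
    (LinearMap.lTensor _ P.partialDualCounit (P.comulRight b)) = Coalgebra.counit ⊗ₜ b := by
  simp only [comulRight, LinearMap.sum_apply, map_sum, LinearMap.comp_apply]
  have h1 : ∀ (t : H ⊗[k] B), ∑ j, TensorProduct.rid k _ (LinearMap.lTensor _ P.partialDualCounit
      (TensorProduct.map (MappingSystem.inr k C ∘ₗ P.ζ ∘ₗ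
        LinearMap.mulLeft k (P.γ (finBasis k C j)))
        (TensorProduct.mk k (Dual k C) B ((finBasis k C).coord j)) t)) =
      Coalgebra.counit ⊗ₜ[k]
        P.ζ (TensorProduct.rid k H (LinearMap.lTensor H (Coalgebra.counit ∘ₗ P.ι) t)) := by
    intro t
    induction t with
    | zero => simp
    | add s t hs ht => simp only [map_add, TensorProduct.tmul_add, Finset.sum_add_distrib, hs, ht]
    | tmul h c =>
      -- The counit on the second leg pairs xⱼ* with π(1), so the sum over j reassembles γ(π(1)) = 1
      -- in front of h.
      have e : P.γ (∑ j, (finBasis k C).coord j (P.π 1) • finBasis k C j) = 1 := by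
        simp only [Basis.coord_apply, (finBasis k C).sum_repr, hP.γ_one]
      have e' : h = P.γ (∑ j, (finBasis k C).coord j (P.π 1) • finBasis k C j) * h := by
        rw [e, one_mul]
      simp only [LinearMap.lTensor_tmul, TensorProduct.rid_tmul, TensorProduct.map_tmul,
        map_smul, TensorProduct.tmul_smul]
      conv_rhs => rw [e']
      simp only [map_sum, map_smul, Finset.sum_mul, smul_mul_assoc, TensorProduct.tmul_sum,
        TensorProduct.tmul_smul, Finset.smul_sum]
      refine Finset.sum_congr rfl fun j _ => ?_
      rw [TensorProduct.mk_apply, partialDualCounit_tmul, mul_comm, mul_smul]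
      rfl
  rw [h1, hP.rid_lTensor_counit_coact, hP.ζ_ι]

/-- The counit turns the middle leg into ε(bⱼ) ⟨ζbar*(bᵢ*)₍₁₎, 1⟩, so the third leg becomes
γbar*S⁻¹(ζbar*(bⱼ*) ζbar*(bᵢ*)). Now ∑ⱼ ε(bⱼ) ζbar*(bⱼ*) = ε, and ζbar∘S⁻¹∘γbar = ε 1 leaves ∑ᵢ
⟨bᵢ*, 1⟩ bᵢ = 1 in the first leg. -/
theorem lTensor_counit_associator (hP : P.IsPAMS) :
    LinearMap.lTensor _ ((TensorProduct.lid k _).toLinearMap ∘ₗ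
      LinearMap.rTensor _ P.partialDualCounit) P.partialDualAssociator =
      (Coalgebra.counit ⊗ₜ 1) ⊗ₜ (Coalgebra.counit ⊗ₜ 1) := by
  have h1 : ∀ (b : B) (u w : Dual k H), TensorProduct.lid k _ (LinearMap.rTensor _
      P.partialDualCounit (TensorProduct.map (P.smashMul (MappingSystem.inr k C b) ∘ₗ P.γbarInv)
        (P.γbarInv ∘ₗ dualMul k H w) (dualComul k H u))) =
      Coalgebra.counit (R := k) (P.ι b) • P.γbarInv (dualMul k H w u) := by
    intro b u w
    have h2 : ∀ u, P.partialDualCounit (P.smashMul (MappingSystem.inr k C b) (P.γbarInv u)) =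
        Coalgebra.counit (R := k) (P.ι b) * u 1 := by
      intro u
      rw [hP.partialDualCounit_mul]
      change Coalgebra.counit (P.π 1) * Coalgebra.counit (P.ι b) *
        (u (antipodeInv k H (P.γbar (P.π 1))) * Coalgebra.counit (R := k) (P.ι 1)) = _
      rw [hP.π_counit, Bialgebra.counit_one, one_mul, hP.γbar_one, antipodeInv_one, hP.ι_one,
        Bialgebra.counit_one, mul_one]
    rw [dualComul_eq_sum (finBasis k H)]
    simp only [map_sum, TensorProduct.map_tmul, LinearMap.rTensor_tmul, TensorProduct.lid_tmul,
      LinearMap.comp_apply, h2, mul_smul, ← Finset.smul_sum, LinearMap.mulRight_apply, one_mul]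
    rw [← map_smul, ← map_smul]
    simp only [← map_smul, ← map_sum]
    rw [Basis.sum_dual_apply_smul_coord]
  have h3 : ∑ j, Coalgebra.counit (R := k) (P.ι (finBasis k B j)) •
      P.ζbar.dualMap ((finBasis k B).coord j) = Coalgebra.counit := by
    ext h
    simp only [LinearMap.sum_apply, LinearMap.smul_apply, LinearMap.dualMap_apply,
      Basis.coord_apply]
    rw [← hP.ζbar_counit]
    conv_rhs => rw [← (finBasis k B).sum_repr (P.ζbar h)]
    simp only [map_sum, map_smul, smul_eq_mul, mul_comm]
  have h4 : ∀ i, ∑ j, Coalgebra.counit (R := k) (P.ι (finBasis k B j)) • P.γbarInv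
      (dualMul k H (P.ζbar.dualMap ((finBasis k B).coord j))
        (P.ζbar.dualMap ((finBasis k B).coord i))) =
      (finBasis k B).coord i 1 • (Coalgebra.counit ⊗ₜ[k] 1 : Dual k C ⊗[k] B) := by
    intro i
    have e : ∀ w w' : Dual k H, P.γbarInv (dualMul k H w w') =
      (P.γbarInv ∘ₗ (dualMul k H).flip w') w := fun _ _ => rfl
    simp only [← map_smul, ← map_sum] at h3
    simp only [e, ← map_smul, ← map_sum]
    rw [h3, LinearMap.comp_apply, LinearMap.flip_apply, counit_dualMul, TensorProduct.smul_tmul']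
    refine congrArg (· ⊗ₜ[k] (1 : B)) ?_
    ext x
    refine (congrArg ((finBasis k B).coord i) (hP.ζbar_antipodeInv_γbar x)).trans ?_
    rw [Algebra.algebraMap_eq_smul_one, map_smul, LinearMap.smul_apply, smul_eq_mul, smul_eq_mul,
      mul_comm]
  simp only [partialDualAssociator, map_sum, LinearMap.lTensor_tmul, LinearMap.comp_apply,
    LinearEquiv.coe_coe, h1]
  simp only [← TensorProduct.tmul_sum, h4]
  simp only [← TensorProduct.smul_tmul, ← map_smul]
  rw [← TensorProduct.sum_tmul, ← map_sum]
  simp only [Basis.coord_apply, (finBasis k B).sum_repr]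
  rfl

/-- The realization of the left partial dual inside `C* # H`. -/
def realization (hP : P.IsPAMS) : CoassocTwist.Realization P.partialDual (Smash P hP) where
  j := Smash.emb hP
  D := Smash.split hP
  J := Smash.twist hP
  Jinv := Smash.twistInv hP
  injective := Smash.emb_injective hP
  j_mul := Smash.emb_mul hP
  j_one := (Smash.emb_inl hP Coalgebra.counit).trans (Smash.inl_counit hP)
  coassoc := Smash.split_coassoc hP
  mul_inv := Smash.twist_mul_twistInv hP
  inv_mul := Smash.twistInv_mul_twist hP
  map_comul := Smash.map_emb_comul_mul_twist hP
  map_associator := Smash.map_emb_associator_mul hP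

/-- The left partial dual determined by a partially admissible mapping system is a
quasi-bialgebra. -/
theorem partialDual_isQuasiBialgebra (hP : P.IsPAMS) : P.partialDual.IsQuasiBialgebra := by
  -- Contracting a leg with the counit is multiplicative, so the counit axioms need checking only on
  -- f # 1 and ε # b.
  have hmul : ∀ s t, TensorProduct.lid k _ (LinearMap.rTensor _ P.partialDualCounit
      (TensorProduct.map₂ P.smashMul P.smashMul s t)) =
      P.smashMul (TensorProduct.lid k _ (LinearMap.rTensor _ P.partialDualCounit s))
        (TensorProduct.lid k _ (LinearMap.rTensor _ P.partialDualCounit t)) := by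
    intro s t
    induction s with
    | zero => simp only [map_zero, LinearMap.zero_apply]
    | add s s' hs hs' => simp only [map_add, LinearMap.add_apply, hs, hs']
    | tmul a b =>
      induction t with
      | zero => simp only [map_zero]
      | add t t' ht ht' => simp only [map_add, ht, ht']
      | tmul c d =>
        simp only [TensorProduct.map₂_apply_tmul, TensorProduct.map_tmul, LinearMap.rTensor_tmul,
          TensorProduct.lid_tmul, hP.partialDualCounit_mul, map_smul, LinearMap.smul_apply, smul_smul, mul_comm]
  have hmul' : ∀ s t, TensorProduct.rid k _ (LinearMap.lTensor _ P.partialDualCounit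
      (TensorProduct.map₂ P.smashMul P.smashMul s t)) =
      P.smashMul (TensorProduct.rid k _ (LinearMap.lTensor _ P.partialDualCounit s))
        (TensorProduct.rid k _ (LinearMap.lTensor _ P.partialDualCounit t)) := by
    intro s t
    induction s with
    | zero => simp only [map_zero, LinearMap.zero_apply]
    | add s s' hs hs' => simp only [map_add, LinearMap.add_apply, hs, hs']
    | tmul a b =>
      induction t with
      | zero => simp only [map_zero]
      | add t t' ht ht' => simp only [map_add, ht, ht']
      | tmul c d =>
        simp only [TensorProduct.map₂_apply_tmul, TensorProduct.map_tmul, LinearMap.lTensor_tmul,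
          TensorProduct.rid_tmul, hP.partialDualCounit_mul, map_smul, LinearMap.smul_apply, smul_smul, mul_comm]
  refine hP.realization.isQuasiBialgebra hP.partialDualCounit_mul ?_ (fun x => ?_) (fun x => ?_)
    hP.lTensor_counit_associator
  · change Coalgebra.counit (P.π 1) * Coalgebra.counit (P.ι 1) = (1 : k)
    rw [hP.π_counit, hP.ι_one, Bialgebra.counit_one, one_mul]
  · change TensorProduct.lid k _ (LinearMap.rTensor _ P.partialDualCounit
      (P.partialDualComul x)) = x
    induction x with
    | zero => simp only [map_zero]
    | add x y hx hy => simp only [map_add, hx, hy]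
    | tmul f b =>
      rw [partialDualComul, TensorProduct.lift.tmul, LinearMap.compl₁₂_apply, hmul,
        hP.counit_comulLeft, hP.counit_comulRight, hP.smashMul_dual_ring]
  · change TensorProduct.rid k _ (LinearMap.lTensor _ P.partialDualCounit
      (P.partialDualComul x)) = x
    induction x with
    | zero => simp only [map_zero]
    | add x y hx hy => simp only [map_add, hx, hy]
    | tmul f b =>
      rw [partialDualComul, TensorProduct.lift.tmul, LinearMap.compl₁₂_apply, hmul',
        hP.comulLeft_counit, hP.comulRight_counit, hP.smashMul_dual_ring]

end IsPAMS

end MappingSystem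

/-! ### Opposites: realizations related by an anti-homomorphism -/

theorem TensorProduct.map_antimul {k R S R' S' : Type*} [Field k] [Ring R] [Algebra k R] [Ring S]
    [Algebra k S] [Ring R'] [Algebra k R'] [Ring S'] [Algebra k S'] {f : R →ₗ[k] R'}
    {g : S →ₗ[k] S'} (hf : ∀ x y, f (x * y) = f y * f x) (hg : ∀ x y, g (x * y) = g y * g x)
    (x y : R ⊗[k] S) : TensorProduct.map f g (x * y) =
      TensorProduct.map f g y * TensorProduct.map f g x := by
  induction x with
  | zero => rw [zero_mul, map_zero, mul_zero]
  | add x x' hx hx' => rw [add_mul, map_add, map_add, mul_add, hx, hx']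
  | tmul a b =>
    induction y with
    | zero => rw [mul_zero, map_zero, zero_mul]
    | add y y' hy hy' => rw [mul_add, map_add, map_add, add_mul, hy, hy']
    | tmul c d =>
      rw [Algebra.TensorProduct.tmul_mul_tmul, TensorProduct.map_tmul, TensorProduct.map_tmul,
        TensorProduct.map_tmul, Algebra.TensorProduct.tmul_mul_tmul, hf, hg]

namespace QuasiBialgebraData

variable {k V : Type*} [Field k] [AddCommGroup V] [Module k V] {Q : QuasiBialgebraData k V}

theorem isAssociatorInverse_associatorInv (h : ∃ y, Q.IsAssociatorInverse y) :
    Q.IsAssociatorInverse Q.associatorInv := Classical.epsilon_spec h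

end QuasiBialgebraData

namespace CoassocTwist

namespace Realization

variable {k V W E E' : Type*} [Field k] [Ring E] [Algebra k E] [Ring E'] [Algebra k E']
  [AddCommGroup V] [Module k V] [AddCommGroup W] [Module k W]
  {Q : QuasiBialgebraData k V} {Q' : QuasiBialgebraData k W}

/-- Data isomorphic to a quasi-bialgebra with a realization are a quasi-bialgebra. -/
theorem isQuasiBialgebraIso [FiniteDimensional k V] (r' : Realization Q' E')
    (hQ' : Q'.IsQuasiBialgebra) (e : V ≃ₗ[k] W)
    (map_mul : ∀ x y, e (Q.mul x y) = Q'.mul (e x) (e y)) (map_one : e Q.one = Q'.one)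
    (map_comul : ∀ x, TensorProduct.map e.toLinearMap e.toLinearMap (Q.comul x) = Q'.comul (e x))
    (map_counit : ∀ x, Q'.counit (e x) = Q.counit x)
    (map_associator : TensorProduct.map e.toLinearMap
      (TensorProduct.map e.toLinearMap e.toLinearMap) Q.associator = Q'.associator) :
    Q.IsQuasiBialgebraIso Q' e := by
  -- Composing the embedding with e realizes Q in the same algebra with the same D and J.
  let r : Realization Q E' :=
    { j := r'.j ∘ₗ e.toLinearMap
      D := r'.D
      J := r'.J
      Jinv := r'.Jinv
      injective := r'.injective.comp e.injective
      j_mul := fun x y => by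
        simp only [LinearMap.comp_apply, LinearEquiv.coe_coe, map_mul, r'.j_mul]
      j_one := by simp only [LinearMap.comp_apply, LinearEquiv.coe_coe, map_one, r'.j_one]
      coassoc := r'.coassoc
      mul_inv := r'.mul_inv
      inv_mul := r'.inv_mul
      map_comul := fun v => by
        rw [TensorProduct.map_comp, LinearMap.comp_apply, map_comul, r'.map_comul]
        rfl
      map_associator := by
        rw [TensorProduct.map_comp, TensorProduct.map_comp, LinearMap.comp_apply, map_associator,
          r'.map_associator] }
  have hl : ∀ t : V ⊗[k] V, e (TensorProduct.lid k V (LinearMap.rTensor V Q.counit t)) =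
      TensorProduct.lid k W (LinearMap.rTensor W Q'.counit
        (TensorProduct.map e.toLinearMap e.toLinearMap t)) := by
    intro t
    induction t with
    | zero => simp only [map_zero]
    | add s t hs ht => simp only [map_add, hs, ht]
    | tmul a b => simp [map_counit]
  have hr : ∀ t : V ⊗[k] V, e (TensorProduct.rid k V (LinearMap.lTensor V Q.counit t)) =
      TensorProduct.rid k W (LinearMap.lTensor W Q'.counit
        (TensorProduct.map e.toLinearMap e.toLinearMap t)) := by
    intro t
    induction t with
    | zero => simp only [map_zero]
    | add s t hs ht => simp only [map_add, hs, ht]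
    | tmul a b => simp [map_counit]
  have hm : ∀ t : V ⊗[k] (V ⊗[k] V), TensorProduct.map e.toLinearMap e.toLinearMap
      (LinearMap.lTensor V ((TensorProduct.lid k V).toLinearMap ∘ₗ
        LinearMap.rTensor V Q.counit) t) =
      LinearMap.lTensor W ((TensorProduct.lid k W).toLinearMap ∘ₗ LinearMap.rTensor W Q'.counit)
        (TensorProduct.map e.toLinearMap (TensorProduct.map e.toLinearMap e.toLinearMap) t) := by
    intro t
    induction t with
    | zero => simp only [map_zero]
    | add s t hs ht => simp only [map_add, hs, ht]
    | tmul a b =>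
      simp only [LinearMap.lTensor_tmul, TensorProduct.map_tmul, LinearMap.comp_apply,
        LinearEquiv.coe_coe, hl]
  refine ⟨r.isQuasiBialgebra (fun x y => ?_) ?_ (fun x => ?_) (fun x => ?_) ?_, hQ', map_mul,
    map_one, map_comul, map_counit, map_associator⟩
  · rw [← map_counit, map_mul, hQ'.counit_mul, map_counit, map_counit]
  · rw [← map_counit, map_one, hQ'.counit_one]
  · apply e.injective
    rw [hl, map_comul, hQ'.counit_comul]
  · apply e.injective
    rw [hr, map_comul, hQ'.comul_counit]
  · apply TensorProduct.map_injective_of_field (f := e.toLinearMap) (g := e.toLinearMap)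
      e.injective e.injective
    rw [hm, map_associator, hQ'.associator_counit, TensorProduct.map_tmul, LinearEquiv.coe_coe,
      map_one]

theorem map_op_mul (r : Realization Q E) (r' : Realization Q' E') (e : V ≃ₗ[k] W)
    (Ψ : E →ₗ[k] E') (Ψ_mul : ∀ x y, Ψ (x * y) = Ψ y * Ψ x)
    (hj : ∀ v, r'.j (e v) = Ψ (r.j v)) (x y : V) :
    e (Q.op.mul x y) = Q'.mul (e x) (e y) := by
  apply r'.injective
  rw [hj, r'.j_mul, hj, hj]
  exact (congrArg Ψ (r.j_mul y x)).trans (Ψ_mul _ _)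

theorem map_op_one (r : Realization Q E) (r' : Realization Q' E') (e : V ≃ₗ[k] W)
    (Ψ : E →ₗ[k] E') (Ψ_one : Ψ 1 = 1) (hj : ∀ v, r'.j (e v) = Ψ (r.j v)) :
    e Q.op.one = Q'.one := by
  apply r'.injective
  rw [hj, r'.j_one, ← Ψ_one, ← r.j_one]
  rfl

/-- An anti-homomorphism carries J⁻¹ Δ(v) = D(v) J⁻¹ to the intertwining relation that characterizes
Δ' for the twist J', the image of J⁻¹. -/
theorem map_op_comul (r : Realization Q E) (r' : Realization Q' E') (e : V ≃ₗ[k] W)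
    (Ψ : E →ₗ[k] E') (Ψ_mul : ∀ x y, Ψ (x * y) = Ψ y * Ψ x)
    (hj : ∀ v, r'.j (e v) = Ψ (r.j v))
    (hD : ∀ x, TensorProduct.map Ψ Ψ (r.D x) = r'.D (Ψ x))
    (hJ : TensorProduct.map Ψ Ψ r.Jinv = r'.J) (v : V) :
    TensorProduct.map e.toLinearMap e.toLinearMap (Q.op.comul v) = Q'.comul (e v) := by
  have hjc : r'.j ∘ₗ e.toLinearMap = Ψ ∘ₗ r.j := LinearMap.ext hj
  apply r'.j₂_injective
  refine r'.isUnit_J.mul_left_injective ?_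
  have h1 : r.Jinv * TensorProduct.map r.j r.j (Q.comul v) = r.D (r.j v) * r.Jinv := by
    have := congrArg (fun t => r.Jinv * t * r.Jinv) (r.map_comul v)
    simpa only [mul_assoc, r.mul_inv, mul_one, ← mul_assoc r.Jinv r.J, r.inv_mul, one_mul]
      using this
  have h2 := congrArg (TensorProduct.map Ψ Ψ) h1
  rw [TensorProduct.map_antimul Ψ_mul Ψ_mul, TensorProduct.map_antimul Ψ_mul Ψ_mul, hJ, hD,
    ← LinearMap.comp_apply (TensorProduct.map Ψ Ψ), ← TensorProduct.map_comp, ← hjc,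
    TensorProduct.map_comp] at h2
  refine h2.trans ?_
  rw [← hj]
  exact (r'.map_comul (e v)).symm

/-- Applying Ψ to the relation for φ reverses it and replaces J by J'⁻¹, which exhibits Ψ(φ) as
inverse to φ'. Hence φ⁻¹ is what maps to φ', in agreement with the associator of the opposite. -/
theorem map_op_associator [FiniteDimensional k V] (r : Realization Q E) (r' : Realization Q' E')
    (e : V ≃ₗ[k] W)
    (Ψ : E →ₗ[k] E') (Ψ_mul : ∀ x y, Ψ (x * y) = Ψ y * Ψ x) (Ψ_one : Ψ 1 = 1)
    (hj : ∀ v, r'.j (e v) = Ψ (r.j v))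
    (hD : ∀ x, TensorProduct.map Ψ Ψ (r.D x) = r'.D (Ψ x))
    (hJ : TensorProduct.map Ψ Ψ r.Jinv = r'.J) :
    TensorProduct.map e.toLinearMap (TensorProduct.map e.toLinearMap e.toLinearMap)
      Q.op.associator = Q'.associator := by
  have Ψ_mul₂ := TensorProduct.map_antimul Ψ_mul Ψ_mul
  have Ψ_mul₃ := TensorProduct.map_antimul Ψ_mul Ψ_mul₂
  have Ψ_one₂ : TensorProduct.map Ψ Ψ 1 = 1 := by
    rw [Algebra.TensorProduct.one_def, TensorProduct.map_tmul, Ψ_one]; rfl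
  have Ψ_one₃ : TensorProduct.map Ψ (TensorProduct.map Ψ Ψ) 1 = 1 := by
    rw [Algebra.TensorProduct.one_def, TensorProduct.map_tmul, Ψ_one, Ψ_one₂]; rfl
  have hJ' : r'.J * TensorProduct.map Ψ Ψ r.J = 1 := by
    rw [← hJ, ← Ψ_mul₂, r.mul_inv, Ψ_one₂]
  have hoL : ∀ x, TensorProduct.map Ψ (TensorProduct.map Ψ Ψ) (oneL k E _ x) =
      oneL k E' _ (TensorProduct.map Ψ Ψ x) := fun x => by
    rw [oneL_apply, TensorProduct.map_tmul, Ψ_one]; rfl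
  have hassoc : ∀ (x : E ⊗[k] E) (y : E), TensorProduct.map Ψ (TensorProduct.map Ψ Ψ)
      (TensorProduct.assoc k E E E (x ⊗ₜ y)) =
      TensorProduct.assoc k E' E' E' (TensorProduct.map Ψ Ψ x ⊗ₜ Ψ y) := by
    intro x y
    induction x with
    | zero => simp only [map_zero, TensorProduct.zero_tmul]
    | add x x' hx hx' => simp only [map_add, TensorProduct.add_tmul, hx, hx']
    | tmul a b => rfl
  have hoR : ∀ x, TensorProduct.map Ψ (TensorProduct.map Ψ Ψ) (oneR k E x) =
      oneR k E' (TensorProduct.map Ψ Ψ x) := fun x => by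
    rw [oneR_apply, hassoc, Ψ_one]; rfl
  have hsF : ∀ x, TensorProduct.map Ψ (TensorProduct.map Ψ Ψ) (splitFst r.D x) =
      splitFst r'.D (TensorProduct.map Ψ Ψ x) := by
    intro x
    induction x with
    | zero => simp only [map_zero]
    | add x x' hx hx' => simp only [map_add, hx, hx']
    | tmul a b => rw [splitFst_tmul, hassoc, hD]; rfl
  have hsS : ∀ x, TensorProduct.map Ψ (TensorProduct.map Ψ Ψ) (splitSnd r.D x) =
      splitSnd r'.D (TensorProduct.map Ψ Ψ x) := by
    intro x
    induction x with
    | zero => simp only [map_zero]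
    | add x x' hx hx' => simp only [map_add, hx, hx']
    | tmul a b => rw [splitSnd_tmul, TensorProduct.map_tmul, hD]; rfl
  -- The associator of the opposite is a chosen value; it is a true inverse because one exists.
  have hinv := QuasiBialgebraData.isAssociatorInverse_associatorInv r.exists_isAssociatorInverse
  have hY : r.j₃ Q.associator * r.j₃ Q.associatorInv = 1 := by
    rw [← r.j₃_mul, hinv.1, r.j₃_one]
  have hΨY := congrArg (TensorProduct.map Ψ (TensorProduct.map Ψ Ψ)) hY
  rw [Ψ_mul₃, Ψ_one₃] at hΨY
  have hA := congrArg (TensorProduct.map Ψ (TensorProduct.map Ψ Ψ)) r.j₃_associator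
  rw [Ψ_mul₃, Ψ_mul₃, Ψ_mul₃, hoL, hoR, hsF, hsS] at hA
  have hjc : r'.j₃ ∘ₗ TensorProduct.map e.toLinearMap
      (TensorProduct.map e.toLinearMap e.toLinearMap) =
      TensorProduct.map Ψ (TensorProduct.map Ψ Ψ) ∘ₗ r.j₃ := by
    have hjc : r'.j ∘ₗ e.toLinearMap = Ψ ∘ₗ r.j := LinearMap.ext hj
    simp only [j₃, j₂, ← TensorProduct.map_comp, hjc]
  set T := TensorProduct.map Ψ Ψ r.J with hT
  -- T = Ψ(J) is inverse to J', so products of images of J' under two algebra maps cancel against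
  -- those of T in reverse order.
  have hU : ∀ (f g : E' ⊗[k] E' →ₐ[k] E' ⊗[k] (E' ⊗[k] E')), f r'.J * g r'.J * (g T * f T) = 1 := by
    intro f g
    rw [mul_assoc, ← mul_assoc (g r'.J), ← map_mul, hJ', map_one, one_mul, ← map_mul, hJ', map_one]
  have hU' : ∀ (f g : E' ⊗[k] E' →ₐ[k] E' ⊗[k] (E' ⊗[k] E')), g T * f T * (f r'.J * g r'.J) = 1 := by
    have hT' : T * r'.J = 1 := by rw [hT, ← hJ, ← Ψ_mul₂, r.inv_mul, Ψ_one₂]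
    intro f g
    rw [mul_assoc, ← mul_assoc (f T), ← map_mul, hT', map_one, one_mul, ← map_mul, hT', map_one]
  apply r'.j₃_injective
  have hu : IsUnit (oneR k E' r'.J * splitFst r'.D r'.J) :=
    (isUnit_algHom _ r'.isUnit_J).mul (isUnit_algHom _ r'.isUnit_J)
  refine hu.mul_left_injective ?_
  change r'.j₃ _ * (oneR k E' r'.J * splitFst r'.D r'.J) =
    r'.j₃ Q'.associator * (oneR k E' r'.J * splitFst r'.D r'.J)
  rw [r'.j₃_associator, ← LinearMap.comp_apply, hjc, LinearMap.comp_apply]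
  have hB : oneR k E' r'.J * splitFst r'.D r'.J * (splitSnd r'.D T * oneL k E' _ T) =
      TensorProduct.map Ψ (TensorProduct.map Ψ Ψ) (r.j₃ Q.associator) := by
    rw [← hA, ← mul_assoc, hU, one_mul]
  calc _ = TensorProduct.map Ψ (TensorProduct.map Ψ Ψ) (r.j₃ Q.op.associator) *
        (oneR k E' r'.J * splitFst r'.D r'.J * (splitSnd r'.D T * oneL k E' _ T) *
          (oneL k E' _ r'.J * splitSnd r'.D r'.J)) := by
        rw [mul_assoc _ (splitSnd r'.D T * oneL k E' _ T), hU', mul_one]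
    _ = _ := by
        rw [hB, ← mul_assoc]
        exact (congrArg (· * (oneL k E' _ r'.J * splitSnd r'.D r'.J)) hΨY).trans (one_mul _)

end Realization

end CoassocTwist

/-! ### The anti-isomorphism of smash products -/

namespace MappingSystem

variable {k H B C : Type*} [Field k] [Ring H] [HopfAlgebra k H] [Ring B] [Algebra k B]
  [AddCommGroup C] [Module k C] [Coalgebra k C] [FiniteDimensional k C] [FiniteDimensional k H]
  {P : MappingSystem k H B C}

/-- The identity of `C*`, regarded as a map to the dual of `Cop C`. -/
def dualCop (k C : Type*) [Field k] [AddCommGroup C] [Module k C] :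
    Dual k C ≃ₗ[k] Dual k (Cop C) := (Cop.of k C).symm.dualMap

theorem dualCop_apply (f : Dual k C) (x : C) : dualCop k C f (Cop.of k C x) = f x := rfl

theorem dualCop_counit : dualCop k C (Coalgebra.counit (R := k) (A := C)) = Coalgebra.counit := rfl

theorem dualMul_dualCop (f g : Dual k C) : dualMul k (Cop C) (dualCop k C f) (dualCop k C g) =
    dualCop k C (dualMul k C g f) := by
  ext x
  obtain ⟨x, rfl⟩ := (Cop.of k C).surjective x
  rw [dualCop_apply, dualMul_apply, dualMul_apply, Cop.comul_of]
  generalize Coalgebra.comul (R := k) x = t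
  induction t with
  | zero => simp
  | add s t hs ht => simp only [map_add, hs, ht]
  | tmul p q => simp [dualCop_apply, mul_comm]

theorem hit_op (h : H) (f : Dual k C) : P.op.hit (MulOpposite.op h) (dualCop k C f) =
    dualCop k C (P.hit (antipodeInv k H h) f) := by
  ext x
  obtain ⟨x, rfl⟩ := (Cop.of k C).surjective x
  rw [dualCop_apply, hit_apply, hit_apply, op_act_apply, dualCop_apply]

namespace Smash

variable (hP : P.IsPAMS)

/-- In the smash product of the opposite system H acts through S⁻¹, so ∑ h₍₂₎ (h₍₁₎ ⇀ g) = ∑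
(S⁻¹(h₍₂₎) h₍₁₎ ⇀ g) h₍₃₎ = g h. This is the reversed exchange relation, exactly what `antiHom`
needs in order to be defined. -/
theorem inr_op_mul_inl_dualCop (h : H) (g : Dual k C) :
    inl hP.op (dualCop k C g) * inr hP.op (MulOpposite.op h) =
      LinearMap.mul' k _ (TensorProduct.comm k _ _ (TensorProduct.map
        (inl hP.op ∘ₗ (dualCop k C).toLinearMap ∘ₗ P.hit.flip g)
        ((inr hP.op).toLinearMap ∘ₗ (MulOpposite.opLinearEquiv k).toLinearMap)
        (Coalgebra.comul h))) := by
  let F : H ⊗[k] (H ⊗[k] H) →ₗ[k] Smash P.op hP.op := LinearMap.mul' k _ ∘ₗ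
    TensorProduct.map (inl hP.op ∘ₗ (dualCop k C).toLinearMap ∘ₗ P.hit.flip g ∘ₗ
      LinearMap.mul' k H ∘ₗ LinearMap.rTensor H (antipodeInv k H) ∘ₗ
        (TensorProduct.comm k H H).toLinearMap)
      ((inr hP.op).toLinearMap ∘ₗ (MulOpposite.opLinearEquiv k).toLinearMap) ∘ₗ
    (TensorProduct.assoc k H H H).symm.toLinearMap
  have h1 : ∀ t : H ⊗[k] H, LinearMap.mul' k _ (TensorProduct.comm k _ _ (TensorProduct.map
      (inl hP.op ∘ₗ (dualCop k C).toLinearMap ∘ₗ P.hit.flip g)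
      ((inr hP.op).toLinearMap ∘ₗ (MulOpposite.opLinearEquiv k).toLinearMap) t)) =
      F (LinearMap.lTensor H Coalgebra.comul t) := by
    intro t
    induction t with
    | zero => simp
    | add s t hs ht => simp only [map_add, hs, ht]
    | tmul p q =>
      simp only [TensorProduct.map_tmul, TensorProduct.comm_tmul, LinearMap.mul'_apply,
        LinearMap.comp_apply, LinearEquiv.coe_coe, AlgHom.toLinearMap_apply,
        MulOpposite.coe_opLinearEquiv, inr_mul_inl, comul_op, LinearMap.lTensor_tmul,
        LinearMap.flip_apply]
      generalize Coalgebra.comul (R := k) q = t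
      induction t with
      | zero => simp
      | add s t hs ht => simp only [map_add, TensorProduct.tmul_add, hs, ht]
      | tmul c d => simp [F, hit_op, hP.hit_mul]
  have h2 : ∀ t : H ⊗[k] H, F (TensorProduct.assoc k H H H
      (LinearMap.rTensor H Coalgebra.comul t)) =
      inl hP.op (dualCop k C g) * inr hP.op (MulOpposite.op
        (TensorProduct.lid k H (LinearMap.rTensor H Coalgebra.counit t))) := by
    intro t
    induction t with
    | zero => simp
    | add s t hs ht => simp only [map_add, MulOpposite.op_add, mul_add, hs, ht]
    | tmul p q =>
      simp only [F, LinearMap.comp_apply, LinearEquiv.coe_coe, LinearEquiv.symm_apply_apply,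
        LinearMap.rTensor_tmul, TensorProduct.map_tmul, LinearMap.mul'_apply,
        antipodeInv_mul_comul]
      simp [Algebra.algebraMap_eq_smul_one, hP.hit_one]
  rw [h1, ← Coalgebra.coassoc_apply, h2, Coalgebra.rTensor_counit_comul, TensorProduct.lid_tmul,
    one_smul]

/-- The anti-isomorphism from `C* # H` to the algebra `C*ᵒᵖ # Hᵒᵖ`. -/
def antiHom : Smash P hP →ₐ[k] (Smash P.op hP.op)ᵐᵒᵖ :=
  lift hP ((MulOpposite.opLinearEquiv k).toLinearMap ∘ₗ inl hP.op ∘ₗ (dualCop k C).toLinearMap)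
    (AlgHom.ofLinearMap ((MulOpposite.opLinearEquiv k).toLinearMap ∘ₗ (inr hP.op).toLinearMap ∘ₗ
      (MulOpposite.opLinearEquiv k).toLinearMap) (by simp) (by simp))
    (by simp [dualCop_counit, inl_counit])
    (fun f g => by simp [← MulOpposite.op_mul, ← inl_mul, dualMul_dualCop])
    (fun h g => by
      apply MulOpposite.unop_injective
      refine (inr_op_mul_inl_dualCop hP h g).trans ?_
      generalize Coalgebra.comul (R := k) h = t
      induction t with
      | zero => simp
      | add s t hs ht => simp only [map_add, MulOpposite.unop_add, hs, ht]
      | tmul p q => simp; rfl)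

theorem antiHom_inl (f : Dual k C) :
    antiHom hP (inl hP f) = MulOpposite.op (inl hP.op (dualCop k C f)) :=
  lift_inl hP _ _ _ _ _ f

theorem antiHom_inr (h : H) :
    antiHom hP (inr hP h) = MulOpposite.op (inr hP.op (MulOpposite.op h)) :=
  lift_inr hP _ _ _ _ _ h

/-- The anti-isomorphism from `C* # H` to `C*ᵒᵖ # Hᵒᵖ`, as a linear map. -/
def anti : Smash P hP →ₗ[k] Smash P.op hP.op :=
  (MulOpposite.opLinearEquiv k).symm.toLinearMap ∘ₗ (antiHom hP).toLinearMap

theorem anti_mul (x y : Smash P hP) : anti hP (x * y) = anti hP y * anti hP x :=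
  congrArg MulOpposite.unop (map_mul (antiHom hP) x y)

theorem anti_one : anti hP 1 = 1 := congrArg MulOpposite.unop (map_one (antiHom hP))

theorem anti_inl (f : Dual k C) : anti hP (inl hP f) = inl hP.op (dualCop k C f) :=
  congrArg MulOpposite.unop (antiHom_inl hP f)

theorem anti_inr (h : H) : anti hP (inr hP h) = inr hP.op (MulOpposite.op h) :=
  congrArg MulOpposite.unop (antiHom_inr hP h)

/-- D has the same formula on generators for both systems, and H and Hᵐᵒᵖ have the same coproduct.
-/
theorem map_anti_split (x : Smash P hP) :
    TensorProduct.map (anti hP) (anti hP) (split hP x) = split hP.op (anti hP x) := by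
  induction x using induction_on with
  | zero => simp only [map_zero]
  | add x y hx hy => simp only [map_add, hx, hy]
  | tmul f h =>
    have h1 : TensorProduct.map (anti hP) (anti hP) (split hP (inr hP h)) =
        split hP.op (inr hP.op (MulOpposite.op h)) := by
      rw [split_inr, split_inr, comul_op]
      generalize Coalgebra.comul (R := k) h = t
      induction t with
      | zero => simp only [map_zero]
      | add s t hs ht => simp only [map_add, hs, ht]
      | tmul p q => simp [anti_inr]
    rw [map_mul, TensorProduct.map_antimul (anti_mul hP) (anti_mul hP), anti_mul, map_mul, h1,
      anti_inr, anti_inl, split_inl, split_inl, TensorProduct.map_tmul, anti_inl, anti_one]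

theorem map_anti_canon (u : C →ₗ[k] Smash P hP) :
    TensorProduct.map (anti hP) (anti hP) (canon hP u) =
      canon hP.op (anti hP ∘ₗ u ∘ₗ (Cop.of k C).symm.toLinearMap) := by
  have : anti hP ∘ₗ u ∘ₗ (Cop.of k C).symm.toLinearMap = ∑ j,
      (dualCop k C ((finBasis k C).coord j)).smulRight (anti hP (u (finBasis k C j))) := by
    ext x
    obtain ⟨x, rfl⟩ := (Cop.of k C).surjective x
    simp only [LinearMap.sum_apply, LinearMap.smulRight_apply, dualCop_apply, Basis.coord_apply,
      LinearMap.comp_apply, LinearEquiv.coe_coe, LinearEquiv.symm_apply_apply]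
    conv_lhs => rw [← (finBasis k C).sum_repr x]
    simp only [map_sum, map_smul]
  rw [this, canon_apply, map_sum, map_sum]
  refine Finset.sum_congr rfl fun j _ => ?_
  rw [canon_smulRight, TensorProduct.map_tmul, anti_inl]

/-- J⁻¹ is built from γbar, which is the γ of the opposite system. This is why the mapping system
for Hᵐᵒᵖ has to use convolution inverses. -/
theorem map_anti_twistInv :
    TensorProduct.map (anti hP) (anti hP) (twistInv hP) = twist hP.op := by
  rw [twistInv, twist, map_anti_canon]
  congr 1
  ext x
  obtain ⟨x, rfl⟩ := (Cop.of k C).surjective x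
  exact anti_inr hP _

end Smash

/-! ### The isomorphism of quasi-bialgebras and its explicit formulas -/

section Iso

variable [FiniteDimensional k B]

theorem relabel_tmul (f : Dual k C) (b : B) :
    relabel k B C (f ⊗ₜ b) = dualCop k C f ⊗ₜ MulOpposite.op b := rfl

/-- The map `f # b ↦ (ε # b)(f # 1)`, the product being that of the partial dual of `Hᵐᵒᵖ`. -/
def opHom (P : MappingSystem k H B C) : Dual k C ⊗[k] B →ₗ[k] Dual k (Cop C) ⊗[k] Bᵐᵒᵖ :=
  TensorProduct.lift (P.op.smashMul.compl₁₂ ((relabel k B C).toLinearMap ∘ₗ inr k C)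
    ((relabel k B C).toLinearMap ∘ₗ inl 1)).flip

/-- The map `f # b ↦ (ε # b)(f # 1)`, the product being that of the partial dual of `H`. -/
def opInv (P : MappingSystem k H B C) : Dual k (Cop C) ⊗[k] Bᵐᵒᵖ →ₗ[k] Dual k C ⊗[k] B :=
  TensorProduct.lift (P.smashMul.compl₁₂ (inr k C) (inl 1)).flip ∘ₗ (relabel k B C).symm.toLinearMap

theorem opHom_tmul (f : Dual k C) (b : B) : P.opHom (f ⊗ₜ b) =
    P.op.smashMul (relabel k B C (Coalgebra.counit ⊗ₜ b)) (relabel k B C (f ⊗ₜ 1)) := rfl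

theorem opInv_relabel_tmul (f : Dual k C) (b : B) : P.opInv (relabel k B C (f ⊗ₜ b)) =
    P.smashMul (Coalgebra.counit ⊗ₜ b) (f ⊗ₜ 1) := by
  rw [opInv, LinearMap.comp_apply, LinearEquiv.coe_coe, LinearEquiv.symm_apply_apply]
  rfl

/-- The map is the restriction of `anti`: f # b is the product of f and b, which the
anti-homomorphism reverses. -/
theorem emb_opHom (hP : P.IsPAMS) (x : Dual k C ⊗[k] B) :
    Smash.emb hP.op (P.opHom x) = Smash.anti hP (Smash.emb hP x) := by
  induction x with
  | zero => simp only [map_zero]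
  | add x y hx hy => simp only [map_add, hx, hy]
  | tmul f b =>
    rw [opHom_tmul, Smash.emb_mul, relabel_tmul, relabel_tmul, dualCop_counit, Smash.emb_inr,
      MulOpposite.op_one, Smash.emb_inl, Smash.emb_tmul, Smash.anti_mul, Smash.anti_inl,
      Smash.anti_inr]
    rfl

theorem opHom_opInv (hP : P.IsPAMS) (x : Dual k (Cop C) ⊗[k] Bᵐᵒᵖ) : P.opHom (P.opInv x) = x := by
  obtain ⟨x, rfl⟩ := (relabel k B C).surjective x
  induction x with
  | zero => simp only [map_zero]
  | add x y hx hy => simp only [map_add, hx, hy]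
  | tmul f b =>
    apply Smash.emb_injective hP.op
    rw [emb_opHom hP, opInv_relabel_tmul, Smash.emb_mul, Smash.emb_inr, Smash.emb_inl,
      Smash.anti_mul, Smash.anti_inl, Smash.anti_inr, relabel_tmul, Smash.emb_tmul]
    rfl

/-- The isomorphism from `C* # B` to the partial dual of `Hᵐᵒᵖ`. -/
def opEquiv (hP : P.IsPAMS) : Dual k C ⊗[k] B ≃ₗ[k] Dual k (Cop C) ⊗[k] Bᵐᵒᵖ :=
  LinearEquiv.ofLinearMap P.opHom P.opInv (LinearMap.ext (opHom_opInv hP))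
    (LinearMap.ext fun x => by
      -- Only one composite was computed. After identifying source and target by `relabel`, a
      -- one-sided inverse of an endomorphism of a finite-dimensional space is two-sided.
      have h : ((relabel k B C).symm.toLinearMap ∘ₗ P.opHom) ∘ₗ
          (P.opInv ∘ₗ (relabel k B C).toLinearMap) = LinearMap.id :=
        LinearMap.ext fun x => by simp [opHom_opInv hP]
      have h' := LinearMap.congr_fun ((LinearMap.comp_eq_id_comm _ _).1 h) x
      simpa using h')

theorem hitRight_apply (b : B) (u : Dual k H) :
    P.hitRight b u = TensorProduct.lid k B (LinearMap.rTensor B u (P.coact b)) := rfl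

/-- Pairing the two coactions through dual bases of H gives ∑ (T(b₍₁₎) ⇀ f) ⊗ b₍₂₎. T = S⁻¹ is the
formula for φ and T = id the one for its inverse. -/
theorem lTensor_hitRight_dualCoact (T : H →ₗ[k] H) (f : Dual k C) (b : B) :
    LinearMap.lTensor (Dual k C) (P.hitRight b ∘ₗ T.dualMap) (P.dualCoact f) =
      TensorProduct.map (P.hit.flip f ∘ₗ T) LinearMap.id (P.coact b) := by
  rw [dualCoact_eq_sum _ (finBasis k H), map_sum]
  simp only [LinearMap.lTensor_tmul, LinearMap.comp_apply, hitRight_apply]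
  generalize P.coact b = t
  induction t with
  | zero => simp
  | add s t hs ht => simp only [map_add, TensorProduct.tmul_add, Finset.sum_add_distrib, hs, ht]
  | tmul h c =>
    rw [TensorProduct.map_tmul, LinearMap.comp_apply]
    conv_rhs => rw [← (finBasis k H).sum_repr (T h)]
    simp only [map_sum, map_smul, LinearMap.flip_apply,
      TensorProduct.sum_tmul, LinearMap.rTensor_tmul, LinearMap.id_apply,
      TensorProduct.lid_tmul, LinearMap.dualMap_apply, Basis.coord_apply, TensorProduct.tmul_smul,
      TensorProduct.smul_tmul']

theorem smashMul_ring_dual (P : MappingSystem k H B C) (b : B) (f : Dual k C) :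
    P.smashMul (Coalgebra.counit ⊗ₜ b) (f ⊗ₜ 1) =
      TensorProduct.map (P.hit.flip f) LinearMap.id (P.coact b) := by
  rw [smashMul_tmul]
  generalize P.coact b = t
  induction t with
  | zero => simp only [map_zero, LinearMap.zero_apply]
  | add s t hs ht => simp only [map_add, LinearMap.add_apply, hs, ht]
  | tmul p q => simp [TensorProduct.map₂_apply_tmul, counit_dualMul]

theorem opHom_tmul_eq (f : Dual k C) (b : B) : P.opHom (f ⊗ₜ b) = relabel k B C
    (LinearMap.lTensor (Dual k C) (P.hitRight b ∘ₗ (antipodeInv k H).dualMap)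
      (P.dualCoact f)) := by
  rw [lTensor_hitRight_dualCoact, opHom_tmul, relabel_tmul, relabel_tmul, dualCop_counit,
    MulOpposite.op_one, smashMul_ring_dual, op_coact_apply]
  generalize P.coact b = t
  induction t with
  | zero => simp only [map_zero]
  | add s t hs ht => simp only [map_add, hs, ht]
  | tmul p q => simp [hit_op, relabel_tmul]

theorem opInv_relabel_tmul_eq (f : Dual k C) (b : B) : P.opInv (relabel k B C (f ⊗ₜ b)) =
    LinearMap.lTensor (Dual k C) (P.hitRight b) (P.dualCoact f) := by
  have h := lTensor_hitRight_dualCoact (P := P) LinearMap.id f b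
  rw [LinearMap.dualMap_id, LinearMap.comp_id, LinearMap.comp_id] at h
  rw [opInv_relabel_tmul, smashMul_ring_dual, h]

theorem partialDualCounit_op (hP : P.IsPAMS) (x : Dual k C ⊗[k] B) :
    P.op.partialDualCounit (P.opHom x) = P.partialDualCounit x := by
  induction x with
  | zero => simp only [map_zero]
  | add x y hx hy => simp only [map_add, hx, hy]
  | tmul f b =>
    have h1 : P.op.π 1 = Cop.of k C (P.π 1) := by
      rw [← MulOpposite.op_one, op_π_apply, antipodeInv_one]
    rw [opHom_tmul, hP.op.partialDualCounit_mul, relabel_tmul, relabel_tmul,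
      IsPAMS.partialDualCounit_tmul, IsPAMS.partialDualCounit_tmul, IsPAMS.partialDualCounit_tmul,
      h1, dualCop_apply, dualCop_apply, hP.π_counit, op_ι_apply, op_ι_apply, counit_op, counit_op,
      hP.ι_one, Bialgebra.counit_one, one_mul, mul_one, mul_comm]

/-- All structure is compared inside the two smash products, where `anti` intertwines the maps D and
exchanges J⁻¹ with the twist of the opposite system. The quasi-bialgebra axioms of the opposite
itself come from the same realization. -/
theorem opEquiv_isQuasiBialgebraIso (hP : P.IsPAMS) :
    P.partialDual.op.IsQuasiBialgebraIso P.op.partialDual (opEquiv hP) :=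
  let r := hP.realization
  let r' := hP.op.realization
  have hj : ∀ v, r'.j (opEquiv hP v) = Smash.anti hP (r.j v) := emb_opHom hP
  r'.isQuasiBialgebraIso hP.op.partialDual_isQuasiBialgebra (opEquiv hP)
    (r.map_op_mul r' _ (Smash.anti hP) (Smash.anti_mul hP) hj)
    (r.map_op_one r' _ (Smash.anti hP) (Smash.anti_one hP) hj)
    (r.map_op_comul r' _ (Smash.anti hP) (Smash.anti_mul hP) hj (Smash.map_anti_split hP)
      (Smash.map_anti_twistInv hP))
    (partialDualCounit_op hP)
    (r.map_op_associator r' _ (Smash.anti hP) (Smash.anti_mul hP) (Smash.anti_one hP) hj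
      (Smash.map_anti_split hP) (Smash.map_anti_twistInv hP))

end Iso

end MappingSystem

end

theorem mainTheorem7 {k H B C : Type*} [Field k] [Ring H] [HopfAlgebra k H]
    [FiniteDimensional k H] [Ring B] [Algebra k B] [FiniteDimensional k B]
    [AddCommGroup C] [Module k C] [Coalgebra k C] [FiniteDimensional k C]
    (P : MappingSystem k H B C) (hP : P.IsPAMS) :
    P.op.IsPAMS ∧ P.cop.IsPAMS ∧
    P.op.partialDual = P.cop.partialDual ∧
    P.partialDual.IsQuasiBialgebra ∧
    ∃ φ : Dual k C ⊗[k] B ≃ₗ[k] Dual k (Cop C) ⊗[k] Bᵐᵒᵖ,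
      P.partialDual.op.IsQuasiBialgebraIso P.op.partialDual φ ∧
      (∀ (f : Dual k C) (b : B), φ (f ⊗ₜ b) =
        P.op.partialDual.mul
          (MappingSystem.relabel k B C (Coalgebra.counit ⊗ₜ b))
          (MappingSystem.relabel k B C (f ⊗ₜ 1))) ∧
      (∀ (f : Dual k C) (b : B), φ (f ⊗ₜ b) =
        MappingSystem.relabel k B C
          (LinearMap.lTensor (Dual k C) (P.hitRight b ∘ₗ (antipodeInv k H).dualMap)
            (P.dualCoact f))) ∧
      (∀ (f : Dual k C) (b : B), φ.symm (MappingSystem.relabel k B C (f ⊗ₜ b)) =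
        LinearMap.lTensor (Dual k C) (P.hitRight b) (P.dualCoact f)) := by
  exact ⟨hP.op, hP.cop, P.partialDual_cop.symm, hP.partialDual_isQuasiBialgebra,
    MappingSystem.opEquiv hP, MappingSystem.opEquiv_isQuasiBialgebraIso hP,
    MappingSystem.opHom_tmul, MappingSystem.opHom_tmul_eq, MappingSystem.opInv_relabel_tmul_eq⟩
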